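/- Let $\mathfrak g=\mathbb C\text{-span}\{z,d_k\mid k\in\mathbb Z\}$ be the Virasoro algebra, with $z$ central and $[d_j,d_k]=(j-k)d_{j+k}+\frac{\delta_{j,-k}}{12}(j^3-j)z$, and let $\mathfrak h=\mathrm{span}\{d_0,z\}$, $\mathfrak n^+=\mathrm{span}\{d_n\mid n>0\}$, $\mathfrak b^+=\mathfrak h\oplus\mathfrak n^+$. Category $\mathcal O$ consists of the finitely generated $\mathfrak g$-modules that are direct sums of their $\mathfrak h$-weight spaces and are $\mathfrak n^+$-locally finite. For $\mu\in\mathfrak h^*$ let $M(\mu)=U(\mathfrak g)\otimes_{U(\mathfrak b^+)}\mathbb C_\mu$ be the Verma module and $L(\mu)$ its unique simple quotient. Write $\mu<\gamma$ if $\mu=\gamma+n$ for some integer $n>0$ (where $n\in\mathfrak h^*$ is the weight with $d_0\mapsto n$, $z\mapsto 0$), and $\mu\preceq\gamma$ if $L(\mu)$ is a subquotient of $M(\gamma)$. A block of weights is an equivalence class $\Lambda\subset\mathfrak h^*$ of the equivalence relation generated by $\preceq$; the corresponding block $\mathcal C$ of $\mathcal O$ is the full subcategory of those $M\in\mathcal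 O$ such that $L(\gamma)$ is a subquotient of $M$ only for $\gamma\in\Lambda$. Suppose that $\Lambda$ is infinite and has a maximal element, i.e. there is $\mu\in\Lambda$ such that $\mu<\gamma$ for no $\gamma\in\Lambda$. Then for every $\gamma\in\Lambda$ the simple module $L(\gamma)$ has a projective cover in $\mathcal C$, and $M(\gamma)$ has a projective resolution in $\mathcal C$. Let $P(\gamma)$ denote a projective cover of $L(\gamma)$ in $\mathcal C$, put $P=\bigoplus_{\gamma\in\Lambda}P(\gamma)$ and $B=\mathrm{End}_{\mathfrak g}(P)^{\mathrm{op}}$, and regard $M\in\mathcal C$ as the $B$-module $\mathrm{Hom}_{\mathfrak g}(P,M)$. Let $\Omega\subset\Lambda$ be a finite coideal, i.e. a finite subset such that $\gamma\in\Omega$, $\delta\in\Lambda$ and $\gamma\preceq\delta$ imply $\delta\in\Omega$. Let $e\in B$ be the idempotent given by the projection of $P$ onto $\bigoplus_{\gamma\in\Omega}P(\gamma)$, let $\mathcal C(\Omega)=\mathrm{Mod}(eBe)$, and for $\lambda\in\Omega$ put $M_\Omega(\lambda)=eM(\lambda)$ and $L_\Omega(\lambda)=eL(\lambda)$. Then for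 all $\lambda,\nu\in\Omega$ and all $i\ge 0$ there is an isomorphism of complex vector spaces $$\mathrm{Ext}^i_{\mathcal C}(M(\lambda),L(\nu))\cong\mathrm{Ext}^i_{\mathcal C(\Omega)}(M_\Omega(\lambda),L_\Omega(\nu)),$$ where $\mathrm{Ext}_{\mathcal C}$ is computed from any projective resolution of $M(\lambda)$ in $\mathcal C$. -/

import Mathlib

open CategoryTheory Limits
open scoped ModuleCat

namespace VirO

noncomputable section

/-! ### The Virasoro algebra -/

def Virasoro : Type := (ℤ →₀ ℂ) × ℂ
namespace Virasoro
instance : AddCommGroup Virasoro := inferInstanceAs (AddCommGroup ((ℤ →₀ ℂ) × ℂ))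
instance : Module ℂ Virasoro := inferInstanceAs (Module ℂ ((ℤ →₀ ℂ) × ℂ))

/-- The basis vector `d_n`. -/
def d (n : ℤ) : Virasoro := (Finsupp.single n 1, 0)
/-- The central element `z`. -/
def z : Virasoro := (0, 1)

/-- `[d_j, d_k]` modulo the centre, extended bilinearly. -/
def wittBracket : (ℤ →₀ ℂ) →ₗ[ℂ] (ℤ →₀ ℂ) →ₗ[ℂ] (ℤ →₀ ℂ) :=
  Finsupp.linearCombination ℂ fun j : ℤ =>
    Finsupp.linearCombination ℂ fun k : ℤ => Finsupp.single (j + k) ((j : ℂ) - k)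

def cocycle : (ℤ →₀ ℂ) →ₗ[ℂ] (ℤ →₀ ℂ) →ₗ[ℂ] ℂ :=
  Finsupp.linearCombination ℂ fun j : ℤ =>
    Finsupp.linearCombination ℂ fun k : ℤ => if j = -k then ((j : ℂ) ^ 3 - j) / 12 else 0

instance : Bracket Virasoro Virasoro :=
  ⟨fun x y => (wittBracket x.1 y.1, cocycle x.1 y.1)⟩

theorem bracket_def (x y : Virasoro) : ⁅x, y⁆ = (wittBracket x.1 y.1, cocycle x.1 y.1) := rfl

theorem wittBracket_single (j k : ℤ) (a b : ℂ) :
    wittBracket (Finsupp.single j a) (Finsupp.single k b) =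
      Finsupp.single (j + k) (a * b * ((j : ℂ) - k)) := by
  simp only [wittBracket, Finsupp.linearCombination_single, LinearMap.smul_apply,
    Finsupp.smul_single, smul_eq_mul, mul_assoc]

theorem cocycle_single (j k : ℤ) (a b : ℂ) :
    cocycle (Finsupp.single j a) (Finsupp.single k b) =
      if j = -k then a * b * (((j : ℂ) ^ 3 - j) / 12) else 0 := by
  simp [cocycle, mul_assoc]

theorem wittBracket_skew (x y : ℤ →₀ ℂ) : wittBracket x y = - wittBracket y x := by
  induction x using Finsupp.induction_linear with
  | zero => simp
  | add f g hf hg => simp only [map_add, LinearMap.add_apply, hf, hg]; abel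
  | single j a =>
    induction y using Finsupp.induction_linear with
    | zero => simp
    | add f g hf hg => simp only [map_add, LinearMap.add_apply, hf, hg]; abel
    | single k b =>
      rw [wittBracket_single, wittBracket_single, ← Finsupp.single_neg, add_comm]
      congr 1; ring

theorem cocycle_skew (x y : ℤ →₀ ℂ) : cocycle x y = - cocycle y x := by
  induction x using Finsupp.induction_linear with
  | zero => simp
  | add f g hf hg => simp only [map_add, LinearMap.add_apply, hf, hg]; abel
  | single j a =>
    induction y using Finsupp.induction_linear with
    | zero => simp
    | add f g hf hg => simp only [map_add, LinearMap.add_apply, hf, hg]; abel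
    | single k b =>
      rw [cocycle_single, cocycle_single]
      by_cases h : j = -k
      · subst h; simp; ring
      · rw [if_neg h, if_neg (by omega)]; simp

theorem wittBracket_jacobi (x y w : ℤ →₀ ℂ) :
    wittBracket x (wittBracket y w) =
      wittBracket (wittBracket x y) w + wittBracket y (wittBracket x w) := by
  induction x using Finsupp.induction_linear with
  | zero => simp
  | add f g hf hg => simp only [map_add, LinearMap.add_apply, hf, hg]; abel
  | single j a =>
    induction y using Finsupp.induction_linear with
    | zero => simp
    | add f g hf hg => simp only [map_add, LinearMap.add_apply, hf, hg]; abel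
    | single k b =>
      induction w using Finsupp.induction_linear with
      | zero => simp
      | add f g hf hg => simp only [map_add, hf, hg]; abel
      | single l c =>
        simp only [wittBracket_single]
        rw [show k + (j + l) = j + (k + l) by ring, show j + k + l = j + (k + l) by ring,
          ← Finsupp.single_add]
        congr 1; push_cast; ring

theorem cocycle_jacobi (x y w : ℤ →₀ ℂ) :
    cocycle x (wittBracket y w) =
      cocycle (wittBracket x y) w + cocycle y (wittBracket x w) := by
  induction x using Finsupp.induction_linear with
  | zero => simp
  | add f g hf hg => simp only [map_add, LinearMap.add_apply, hf, hg]; abel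
  | single j a =>
    induction y using Finsupp.induction_linear with
    | zero => simp
    | add f g hf hg => simp only [map_add, LinearMap.add_apply, hf, hg]; abel
    | single k b =>
      induction w using Finsupp.induction_linear with
      | zero => simp
      | add f g hf hg => simp only [map_add, hf, hg]; abel
      | single l c =>
        simp only [wittBracket_single, cocycle_single]
        by_cases h : j + k + l = 0
        · obtain rfl : l = -j - k := by omega
          rw [if_pos (by ring), if_pos (by ring), if_pos (by ring)]
          push_cast; ring
        · rw [if_neg (by omega), if_neg (by omega), if_neg (by omega)]; simp

instance : LieRing Virasoro where
  add_lie x y w := by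
    refine Prod.ext ?_ ?_
    · change wittBracket (x.1 + y.1) w.1 = wittBracket x.1 w.1 + wittBracket y.1 w.1
      simp
    · change cocycle (x.1 + y.1) w.1 = cocycle x.1 w.1 + cocycle y.1 w.1
      simp
  lie_add x y w := by
    refine Prod.ext ?_ ?_
    · change wittBracket x.1 (y.1 + w.1) = wittBracket x.1 y.1 + wittBracket x.1 w.1
      simp
    · change cocycle x.1 (y.1 + w.1) = cocycle x.1 y.1 + cocycle x.1 w.1
      simp
  lie_self x := by
    refine Prod.ext ?_ ?_
    · exact self_eq_neg.mp (wittBracket_skew x.1 x.1)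
    · exact self_eq_neg.mp (cocycle_skew x.1 x.1)
  leibniz_lie x y w :=
    Prod.ext (wittBracket_jacobi x.1 y.1 w.1) (cocycle_jacobi x.1 y.1 w.1)

instance : LieAlgebra ℂ Virasoro where
  lie_smul c x y := by
    refine Prod.ext ?_ ?_
    · change wittBracket x.1 (c • y.1) = c • wittBracket x.1 y.1
      simp
    · change cocycle x.1 (c • y.1) = c • cocycle x.1 y.1
      simp

theorem lie_d_d (j k : ℤ) :
    ⁅d j, d k⁆ = ((j : ℂ) - k) • d (j + k) +
      (if j = -k then ((j : ℂ) ^ 3 - j) / 12 else 0) • z := by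
  refine Prod.ext ?_ ?_
  · change wittBracket (Finsupp.single j 1) (Finsupp.single k 1) =
      ((j : ℂ) - k) • Finsupp.single (j + k) 1 + (_ : ℂ) • (0 : ℤ →₀ ℂ)
    rw [wittBracket_single]; simp
  · change cocycle (Finsupp.single j 1) (Finsupp.single k 1) =
      ((j : ℂ) - k) • (0 : ℂ) + (_ : ℂ) • (1 : ℂ)
    rw [cocycle_single]; simp

theorem lie_d_z (k : ℤ) : ⁅d k, z⁆ = 0 := by
  refine Prod.ext ?_ ?_
  · change wittBracket (Finsupp.single k 1) 0 = 0
    simp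
  · change cocycle (Finsupp.single k 1) 0 = 0
    simp

theorem span_eq_top : Submodule.span ℂ (Set.range d ∪ {z}) = ⊤ := by
  refine eq_top_iff.mpr fun x _ => ?_
  obtain ⟨f, c⟩ := x
  have h1 : ((f, c) : (ℤ →₀ ℂ) × ℂ) = (f, 0) + c • ((0, 1) : (ℤ →₀ ℂ) × ℂ) := by simp
  refine (congrArg (· ∈ Submodule.span ℂ (Set.range d ∪ {z})) h1).mpr ?_
  refine Submodule.add_mem _ ?_
    (Submodule.smul_mem _ c (Submodule.subset_span (Or.inr rfl)))
  clear h1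
  induction f using Finsupp.induction_linear with
  | zero => exact Submodule.zero_mem _
  | add f g hf hg =>
    have h2 : ((f + g, 0) : (ℤ →₀ ℂ) × ℂ) = (f, 0) + (g, 0) := by simp
    exact (congrArg (· ∈ Submodule.span ℂ (Set.range d ∪ {z})) h2).mpr
      (Submodule.add_mem _ (hf trivial) (hg trivial))
  | single n a =>
    have h2 : ((Finsupp.single n a, 0) : (ℤ →₀ ℂ) × ℂ) = a • (Finsupp.single n 1, 0) := by simp
    exact (congrArg (· ∈ Submodule.span ℂ (Set.range d ∪ {z})) h2).mpr
      (Submodule.smul_mem _ a (Submodule.subset_span (Or.inl ⟨n, rfl⟩)))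
end Virasoro

open Virasoro

/-! ### Category `𝒪` -/

/-- The Cartan subalgebra `𝔥 = span {d_0, z}`. -/
def cartan : Submodule ℂ Virasoro := Submodule.span ℂ {d 0, z}

/-- The space `𝔥*` of weights. -/
abbrev Weight : Type := Module.Dual ℂ cartan

/-- The weight with `d_0 ↦ n`, `z ↦ 0` attached to an integer `n`. -/
def intWeight (n : ℤ) : Weight :=
  (n : ℂ) • ((Finsupp.lapply (0 : ℤ) ∘ₗ LinearMap.fst ℂ (ℤ →₀ ℂ) ℂ : Virasoro →ₗ[ℂ] ℂ) ∘ₗ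
    cartan.subtype)

/-- The strict partial order on weights: `μ < γ` iff `μ = γ + n` for some integer `n > 0`. -/
def WeightLT (μ γ : Weight) : Prop := ∃ n : ℤ, 0 < n ∧ μ = γ + intWeight n

/-- The universal enveloping algebra of the Virasoro algebra; modules over it are the
modules over the Virasoro algebra. -/
abbrev UVir : Type := UniversalEnvelopingAlgebra ℂ Virasoro

/-- The canonical map from the Virasoro algebra to its enveloping algebra. -/
abbrev toU (x : Virasoro) : UVir := UniversalEnvelopingAlgebra.ι ℂ x

/-- The weight space `M^μ`. -/
def weightSpace (M : ModuleCat.{0} UVir) (μ : Weight) : Submodule ℂ M where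
  carrier := {m | ∀ h : cartan, toU h • m = μ h • m}
  add_mem' ha hb h := by simp only [smul_add, ha h, hb h]
  zero_mem' h := by simp
  smul_mem' c m hm h := by rw [smul_comm, hm h, smul_comm]

open Classical in
/-- The objects of Category `𝒪`: weight modules which are finitely generated and locally finite
over `𝔫⁺ = span {d_n | n > 0}`. -/
structure InCategoryO (M : ModuleCat.{0} UVir) : Prop where
  weight : DirectSum.IsInternal (weightSpace M)
  finite : Module.Finite UVir M
  locallyFinite : ∀ m : M, ∃ W : Submodule ℂ M, m ∈ W ∧ FiniteDimensional ℂ W ∧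
    ∀ n : ℤ, 0 < n → ∀ w ∈ W, toU (d n) • w ∈ W

/-- The left ideal of the enveloping algebra generated by the `d_n`, `n > 0`, and the
`h - μ(h)`, `h ∈ 𝔥`. -/
def vermaIdeal (μ : Weight) : Submodule UVir UVir :=
  Submodule.span UVir ({u | ∃ n : ℤ, 0 < n ∧ u = toU (d n)} ∪
    {u | ∃ h : cartan, u = toU h - algebraMap ℂ UVir (μ h)})

/-- The Verma module `M(μ) = U(𝔤) ⊗_{U(𝔟⁺)} ℂ_μ`, as the quotient of `U(𝔤)` by the
left ideal generated by the annihilator in `U(𝔟⁺)` of `ℂ_μ`. -/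
def verma (μ : Weight) : ModuleCat.{0} UVir := ModuleCat.of UVir (UVir ⧸ vermaIdeal μ)

/-- The sum of all proper submodules of the Verma module `M(μ)`. -/
def vermaRadical (μ : Weight) : Submodule UVir (verma μ) :=
  sSup {N : Submodule UVir (verma μ) | N ≠ ⊤}

/-- The simple quotient `L(μ)` of `M(μ)`. -/
def simple (μ : Weight) : ModuleCat.{0} UVir := ModuleCat.of UVir (verma μ ⧸ vermaRadical μ)

/-- `S` is isomorphic to a subquotient of `M`, that is, to a quotient of a submodule of `M`. -/
def IsSubquotient (S M : ModuleCat.{0} UVir) : Prop :=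
  ∃ (N : Submodule UVir M) (f : N →ₗ[UVir] S), Function.Surjective f

/-- `μ ⪯ γ`: the module `L(μ)` is a subquotient of `M(γ)`. -/
def Preceq (μ γ : Weight) : Prop := IsSubquotient (simple μ) (verma γ)

/-- `Λ` is a block of weights: an equivalence class for the equivalence relation
generated by `⪯`. -/
def IsBlock (Λ : Set Weight) : Prop :=
  ∃ μ : Weight, Λ = {γ | Relation.EqvGen Preceq μ γ}

/-- The modules in Category `𝒪` whose subquotients `L(γ)` all have `γ ∈ Λ`. -/
def blockProperty (Λ : Set Weight) : ObjectProperty (ModuleCat.{0} UVir) :=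
  fun M => InCategoryO M ∧ ∀ γ : Weight, IsSubquotient (simple γ) M → γ ∈ Λ

/-- The full subcategory of Category `𝒪` attached to a set `Λ` of weights. -/
abbrev BlockCat (Λ : Set Weight) := (blockProperty Λ).FullSubcategory

/-! ### Verma modules and their simple quotients belong to their block -/

attribute [local instance] LieRing.ofAssociativeRing

theorem smul_mem_of_forall {M : ModuleCat.{0} UVir} (S : Submodule ℂ M)
    (hd : ∀ (n : ℤ), ∀ m ∈ S, toU (d n) • m ∈ S) (hz : ∀ m ∈ S, toU z • m ∈ S)
    (u : UVir) {m : M} (hm : m ∈ S) : u • m ∈ S := by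
  let T : Subalgebra ℂ UVir :=
    { carrier := {u | ∀ m ∈ S, u • m ∈ S}
      mul_mem' := fun {a b} ha hb m hm => by rw [mul_smul]; exact ha _ (hb _ hm)
      add_mem' := fun {a b} ha hb m hm => by rw [add_smul]; exact S.add_mem (ha _ hm) (hb _ hm)
      algebraMap_mem' := fun c m hm => by rw [algebraMap_smul]; exact S.smul_mem c hm }
  have hT : ∀ x : Virasoro, toU x ∈ T := by
    intro x
    have hx : x ∈ Submodule.span ℂ (Set.range d ∪ {z}) := span_eq_top ▸ Submodule.mem_top
    induction hx using Submodule.span_induction with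
    | mem x hx =>
      rcases hx with ⟨n, rfl⟩ | rfl
      · exact hd n
      · exact hz
    | zero => rw [toU, map_zero]; exact T.zero_mem
    | add x y _ _ hx hy => rw [toU, map_add]; exact T.add_mem hx hy
    | smul c x _ hx => rw [toU, map_smul]; exact T.smul_mem hx c
  let g : Virasoro →ₗ⁅ℂ⁆ T :=
    { toFun := fun x => ⟨toU x, hT x⟩
      map_add' := fun x y => Subtype.ext (map_add _ x y)
      map_smul' := fun c x => Subtype.ext (map_smul _ c x)
      map_lie' := fun {x y} => Subtype.ext (LieHom.map_lie _ x y) }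
  have hcomp : T.val.comp (UniversalEnvelopingAlgebra.lift ℂ g) = AlgHom.id ℂ UVir := by
    apply UniversalEnvelopingAlgebra.hom_ext
    ext x
    change ((UniversalEnvelopingAlgebra.lift ℂ g (UniversalEnvelopingAlgebra.ι ℂ x) : T) : UVir) = _
    rw [UniversalEnvelopingAlgebra.lift_ι_apply]
    rfl
  have hu : u ∈ T := by
    have := congrArg (fun f => f u) hcomp
    change ((UniversalEnvelopingAlgebra.lift ℂ g u : T) : UVir) = u at this
    rw [← this]; exact Subtype.property _
  exact hu m hm

theorem lie_smul_eq {M : ModuleCat.{0} UVir} (x y : Virasoro) (m : M) :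
    toU x • toU y • m = toU y • toU x • m + toU ⁅x, y⁆ • m := by
  rw [toU, toU, toU, LieHom.map_lie, LieRing.of_associative_ring_bracket, sub_smul, mul_smul,
    mul_smul]
  abel

theorem cartan_lie (h k : cartan) : ⁅(h : Virasoro), (k : Virasoro)⁆ = 0 := by
  obtain ⟨h, hh⟩ := h
  obtain ⟨k, hk⟩ := k
  obtain ⟨a, b, rfl⟩ := Submodule.mem_span_pair.mp hh
  obtain ⟨a', b', rfl⟩ := Submodule.mem_span_pair.mp hk
  have hzd : ⁅z, d 0⁆ = 0 := by rw [← lie_skew, lie_d_z, neg_zero]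
  simp [lie_d_z, hzd]

theorem iSupIndep_weightSpace (M : ModuleCat.{0} UVir) : iSupIndep (weightSpace M) := by
  let f : cartan → Module.End ℂ M := fun h =>
    { toFun := fun m => toU h • m
      map_add' := smul_add _
      map_smul' := fun c m => smul_comm _ c m }
  have hind := Module.End.independent_iInf_maxGenEigenspace_of_forall_mapsTo f (by
    intro i j φ
    apply Module.End.mapsTo_maxGenEigenspace_of_comm
    refine LinearMap.ext fun m => ?_
    change toU j • toU i • m = toU i • toU j • m
    rw [lie_smul_eq, cartan_lie, toU, toU, toU, map_zero, zero_smul, add_zero])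
  have hinj : Function.Injective fun (μ : Weight) (h : cartan) => μ h := fun μ γ h =>
    LinearMap.ext fun x => congrFun h x
  refine (hind.comp hinj).mono fun μ m hm => ?_
  simp only [Function.comp_apply, Submodule.mem_iInf]
  intro h
  refine (Module.End.mem_maxGenEigenspace _ _ _).mpr ⟨1, ?_⟩
  have : toU h • m = μ h • m := hm h
  rw [pow_one, LinearMap.sub_apply, LinearMap.smul_apply, Module.End.one_apply, sub_eq_zero]
  exact this

theorem smul_mem_weightSpace {M : ModuleCat.{0} UVir} {μ : Weight} {m : M}
    (hm : m ∈ weightSpace M μ) (n : ℤ) :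
    toU (d n) • m ∈ weightSpace M (μ - intWeight n) := by
  intro h
  have hh : ⁅(h : Virasoro), d n⁆ = -(intWeight n h) • d n := by
    obtain ⟨h, hh⟩ := h
    obtain ⟨a, b, rfl⟩ := Submodule.mem_span_pair.mp hh
    have h1 : intWeight n ⟨a • d 0 + b • z, hh⟩ = n * a := by
      change (n : ℂ) * ((a • (Finsupp.single (0 : ℤ) (1 : ℂ)) + b • (0 : ℤ →₀ ℂ)) 0) = n * a
      simp
    have hzd : ⁅z, d n⁆ = 0 := by rw [← lie_skew, lie_d_z, neg_zero]
    have h0 : ⁅d 0, d n⁆ = -(n : ℂ) • d n := by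
      rw [lie_d_d]
      by_cases hn : n = 0
      · subst hn; simp
      · simp [eq_comm, hn]
    rw [h1, add_lie, smul_lie, smul_lie, hzd, h0, smul_zero, add_zero, smul_smul]
    congr 1; ring
  have h2 : toU h • m = μ h • m := hm h
  rw [lie_smul_eq, h2, hh, smul_comm, toU, toU, map_smul, smul_assoc, ← add_smul]
  congr 1

theorem z_mem_cartan : z ∈ cartan := Submodule.subset_span (by simp)

theorem iSup_weightSpace_smul {M : ModuleCat.{0} UVir} (u : UVir) {m : M}
    (hm : m ∈ ⨆ μ, weightSpace M μ) : u • m ∈ ⨆ μ, weightSpace M μ := by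
  refine smul_mem_of_forall _ ?_ ?_ u hm
  · intro n m hm
    induction hm using Submodule.iSup_induction' with
    | mem μ x hx => exact Submodule.mem_iSup_of_mem _ (smul_mem_weightSpace hx n)
    | zero => rw [smul_zero]; exact Submodule.zero_mem _
    | add x y _ _ hx hy => rw [smul_add]; exact Submodule.add_mem _ hx hy
  · intro m hm
    induction hm using Submodule.iSup_induction' with
    | mem μ x hx =>
      have : toU z • x = μ ⟨z, z_mem_cartan⟩ • x := hx ⟨z, z_mem_cartan⟩
      rw [this]
      exact Submodule.smul_mem _ _ (Submodule.mem_iSup_of_mem _ hx)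
    | zero => rw [smul_zero]; exact Submodule.zero_mem _
    | add x y _ _ hx hy => rw [smul_add]; exact Submodule.add_mem _ hx hy

/-- The canonical generator of the Verma module. -/
def vermaGen (μ : Weight) : verma μ := Submodule.Quotient.mk (p := vermaIdeal μ) (1 : UVir)

theorem smul_vermaGen (μ : Weight) (u : UVir) :
    u • vermaGen μ = (Submodule.Quotient.mk (p := vermaIdeal μ) u : UVir ⧸ vermaIdeal μ) := by
  change u • (Submodule.Quotient.mk (p := vermaIdeal μ) (1 : UVir) : UVir ⧸ vermaIdeal μ) = _
  rw [← Submodule.Quotient.mk_smul, smul_eq_mul, mul_one]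

theorem exists_smul_vermaGen (μ : Weight) (m : verma μ) : ∃ u : UVir, m = u • vermaGen μ := by
  obtain ⟨u, hu⟩ := Submodule.Quotient.mk_surjective (vermaIdeal μ) m
  exact ⟨u, by rw [smul_vermaGen, hu]⟩

theorem d_smul_vermaGen (μ : Weight) {n : ℤ} (hn : 0 < n) : toU (d n) • vermaGen μ = 0 := by
  rw [smul_vermaGen]
  exact (Submodule.Quotient.mk_eq_zero _).mpr (Submodule.subset_span (Or.inl ⟨n, hn, rfl⟩))

theorem vermaGen_mem (μ : Weight) : vermaGen μ ∈ weightSpace (verma μ) μ := by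
  intro h
  have h1 : (toU h - algebraMap ℂ UVir (μ h)) • vermaGen μ = 0 := by
    rw [smul_vermaGen]
    exact (Submodule.Quotient.mk_eq_zero _).mpr (Submodule.subset_span (Or.inr ⟨h, rfl⟩))
  rw [sub_smul, algebraMap_smul, sub_eq_zero] at h1
  exact h1

/-- The action of an element of the enveloping algebra, as a linear map. -/
def act (M : ModuleCat.{0} UVir) (u : UVir) : M →ₗ[ℂ] M where
  toFun m := u • m
  map_add' := smul_add _
  map_smul' c m := smul_comm _ c m

/-- The span of the vectors `d_{-k_1} ⋯ d_{-k_r} v` with `k_i ≥ 1` and `∑ k_i ≤ N`, where `v` is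
the generator of the Verma module. -/
def vermaLevel (μ : Weight) (N : ℕ) : Submodule ℂ (verma μ) :=
  Submodule.span ℂ {vermaGen μ} ⊔
    ⨆ k : Fin N, (vermaLevel μ (N - 1 - k)).map (act (verma μ) (toU (d (-((k : ℤ) + 1)))))
termination_by N
decreasing_by have := k.2; omega

theorem vermaLevel_finite (μ : Weight) (N : ℕ) : FiniteDimensional ℂ (vermaLevel μ N) := by
  induction N using Nat.strong_induction_on with
  | _ N ih =>
    rw [vermaLevel]
    have : ∀ k : Fin N, FiniteDimensional ℂ
        ((vermaLevel μ (N - 1 - k)).map (act (verma μ) (toU (d (-((k : ℤ) + 1)))))) := by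
      intro k
      have := ih (N - 1 - k) (by have := k.2; omega)
      infer_instance
    infer_instance

theorem vermaGen_mem_level (μ : Weight) (N : ℕ) : vermaGen μ ∈ vermaLevel μ N := by
  rw [vermaLevel]
  exact Submodule.mem_sup_left (Submodule.mem_span_singleton_self _)

theorem vermaLevel_induction (μ : Weight) (p : ∀ N : ℕ, Submodule ℂ (verma μ))
    (h0 : ∀ N, vermaGen μ ∈ p N)
    (hs : ∀ N k : ℕ, k < N → ∀ w ∈ vermaLevel μ (N - 1 - k),
      (∀ N' < N, vermaLevel μ N' ≤ p N') → toU (d (-((k : ℤ) + 1))) • w ∈ p N) (N : ℕ) :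
    vermaLevel μ N ≤ p N := by
  induction N using Nat.strong_induction_on with
  | _ N ih =>
    rw [vermaLevel]
    refine sup_le ?_ (iSup_le fun k => ?_)
    · rw [Submodule.span_singleton_le_iff_mem]; exact h0 N
    · rintro _ ⟨w, hw, rfl⟩
      exact hs N k k.2 w hw ih

theorem neg_smul_mem_level (μ : Weight) (N k : ℕ) {w : verma μ} (hw : w ∈ vermaLevel μ N) :
    toU (d (-((k : ℤ) + 1))) • w ∈ vermaLevel μ (N + (k + 1)) := by
  rw [vermaLevel]
  refine Submodule.mem_sup_right (Submodule.mem_iSup_of_mem ⟨k, by omega⟩ ⟨w, ?_, rfl⟩)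
  have : N + (k + 1) - 1 - k = N := by omega
  simpa [this] using hw

theorem vermaLevel_mono (μ : Weight) {N N' : ℕ} (h : N ≤ N') :
    vermaLevel μ N ≤ vermaLevel μ N' := by
  obtain ⟨j, rfl⟩ := Nat.exists_eq_add_of_le h
  refine vermaLevel_induction μ (fun N => vermaLevel μ (N + j))
    (fun N => vermaGen_mem_level μ _) ?_ N
  intro N k hk w hw ih
  have := neg_smul_mem_level μ (N - 1 - k + j) k (ih (N - 1 - k) (by omega) hw)
  rwa [show N - 1 - k + j + (k + 1) = N + j by omega] at this

theorem z_smul_mem_level (μ : Weight) (N : ℕ) {w : verma μ} (hw : w ∈ vermaLevel μ N) :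
    toU z • w ∈ vermaLevel μ N := by
  refine vermaLevel_induction μ (fun N => (vermaLevel μ N).comap (act (verma μ) (toU z)))
    ?_ ?_ N hw
  · intro N
    change toU z • vermaGen μ ∈ vermaLevel μ N
    have : toU z • vermaGen μ = μ ⟨z, z_mem_cartan⟩ • vermaGen μ := vermaGen_mem μ ⟨z, z_mem_cartan⟩
    rw [this]
    exact Submodule.smul_mem _ _ (vermaGen_mem_level μ N)
  · intro N k hk w hw ih
    change toU z • toU (d (-((k : ℤ) + 1))) • w ∈ vermaLevel μ N
    have h0 : ⁅z, d (-((k : ℤ) + 1))⁆ = 0 := by rw [← lie_skew, lie_d_z, neg_zero]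
    rw [lie_smul_eq, h0, toU, toU, toU, map_zero, zero_smul, add_zero]
    have := neg_smul_mem_level μ (N - 1 - k) k (ih (N - 1 - k) (by omega) hw)
    rwa [show N - 1 - k + (k + 1) = N by omega] at this

theorem nonneg_smul_mem_level (μ : Weight) (N n : ℕ) {w : verma μ} (hw : w ∈ vermaLevel μ N) :
    toU (d n) • w ∈ vermaLevel μ N := by
  suffices h : vermaLevel μ N ≤
      ⨅ n : ℕ, (vermaLevel μ N).comap (act (verma μ) (toU (d n))) from
    (Submodule.mem_iInf _).mp (h hw) n
  refine vermaLevel_induction μ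
    (fun N => ⨅ n : ℕ, (vermaLevel μ N).comap (act (verma μ) (toU (d n)))) ?_ ?_ N
  · intro N
    refine (Submodule.mem_iInf _).mpr fun n => ?_
    change toU (d n) • vermaGen μ ∈ vermaLevel μ N
    rcases Nat.eq_zero_or_pos n with rfl | hn
    · have h0 : d 0 ∈ cartan := Submodule.subset_span (by simp)
      have : toU (d 0) • vermaGen μ = μ ⟨d 0, h0⟩ • vermaGen μ := vermaGen_mem μ ⟨d 0, h0⟩
      rw [Nat.cast_zero, this]
      exact Submodule.smul_mem _ _ (vermaGen_mem_level μ N)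
    · rw [d_smul_vermaGen μ (by exact_mod_cast hn)]
      exact Submodule.zero_mem _
  · intro N k hk w hw ih
    refine (Submodule.mem_iInf _).mpr fun n => ?_
    change toU (d n) • toU (d (-((k : ℤ) + 1))) • w ∈ vermaLevel μ N
    have hih : ∀ n : ℕ, toU (d n) • w ∈ vermaLevel μ (N - 1 - k) := fun n =>
      (Submodule.mem_iInf _).mp (ih (N - 1 - k) (by omega) hw) n
    have hle : vermaLevel μ (N - 1 - k) ≤ vermaLevel μ N := vermaLevel_mono μ (by omega)
    rw [lie_smul_eq, lie_d_d, toU, toU, toU, map_add, map_smul, map_smul, add_smul, smul_assoc,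
      smul_assoc]
    refine Submodule.add_mem _ ?_ (Submodule.add_mem _ (Submodule.smul_mem _ _ ?_)
      (Submodule.smul_mem _ _ (hle (z_smul_mem_level μ _ hw))))
    · have := neg_smul_mem_level μ (N - 1 - k) k (hih n)
      rwa [show N - 1 - k + (k + 1) = N by omega] at this
    · by_cases hnk : k + 1 ≤ n
      · obtain ⟨j, rfl⟩ := Nat.exists_eq_add_of_le hnk
        have hj : (((k + 1 + j : ℕ) : ℤ) + -((k : ℤ) + 1)) = (j : ℤ) := by push_cast; ring
        rw [hj]
        exact hle (hih j)
      · obtain ⟨j, rfl⟩ : ∃ j, k = n + j := Nat.exists_eq_add_of_le (by omega)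
        have hj : ((n : ℤ) + -(((n + j : ℕ) : ℤ) + 1)) = -((j : ℤ) + 1) := by push_cast; ring
        rw [hj]
        exact vermaLevel_mono μ (by omega) (neg_smul_mem_level μ (N - 1 - (n + j)) j hw)

theorem exists_mem_level (μ : Weight) (m : verma μ) : ∃ N, m ∈ vermaLevel μ N := by
  have hdir : Directed (· ≤ ·) (vermaLevel μ) :=
    directed_of_isDirected_le fun _ _ h => vermaLevel_mono μ h
  obtain ⟨u, rfl⟩ := exists_smul_vermaGen μ m
  refine (Submodule.mem_iSup_of_directed _ hdir).mp ?_
  refine smul_mem_of_forall (⨆ N, vermaLevel μ N) ?_ ?_ u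
    (Submodule.mem_iSup_of_mem 0 (vermaGen_mem_level μ 0))
  · intro n w hw
    obtain ⟨N, hN⟩ := (Submodule.mem_iSup_of_directed _ hdir).mp hw
    rcases le_or_gt 0 n with hn | hn
    · obtain ⟨n, rfl⟩ := Int.eq_ofNat_of_zero_le hn
      exact Submodule.mem_iSup_of_mem N (nonneg_smul_mem_level μ N n hN)
    · obtain ⟨k, rfl⟩ : ∃ k : ℕ, n = -((k : ℤ) + 1) := ⟨(-n - 1).toNat, by omega⟩
      exact Submodule.mem_iSup_of_mem _ (neg_smul_mem_level μ N k hN)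
  · intro w hw
    obtain ⟨N, hN⟩ := (Submodule.mem_iSup_of_directed _ hdir).mp hw
    exact Submodule.mem_iSup_of_mem N (z_smul_mem_level μ N hN)

theorem verma_inCategoryO (μ : Weight) : InCategoryO (verma μ) where
  weight := by
    classical
    refine (DirectSum.isInternal_submodule_iff_iSupIndep_and_iSup_eq_top _).mpr
      ⟨iSupIndep_weightSpace _, eq_top_iff.mpr fun m _ => ?_⟩
    obtain ⟨u, rfl⟩ := exists_smul_vermaGen μ m
    exact iSup_weightSpace_smul u (Submodule.mem_iSup_of_mem μ (vermaGen_mem μ))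
  finite := by
    refine ⟨⟨{vermaGen μ}, eq_top_iff.mpr fun m _ => ?_⟩⟩
    obtain ⟨u, rfl⟩ := exists_smul_vermaGen μ m
    exact Submodule.smul_mem _ u (Submodule.subset_span (by simp))
  locallyFinite m := by
    obtain ⟨N, hN⟩ := exists_mem_level μ m
    refine ⟨vermaLevel μ N, hN, vermaLevel_finite μ N, fun n hn w hw => ?_⟩
    obtain ⟨n, rfl⟩ := Int.eq_ofNat_of_zero_le hn.le
    exact nonneg_smul_mem_level μ N n hw

theorem InCategoryO.of_surjective {M N : ModuleCat.{0} UVir} (hM : InCategoryO M)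
    (f : M →ₗ[UVir] N) (hf : Function.Surjective f) : InCategoryO N where
  weight := by
    classical
    have hM' := ((DirectSum.isInternal_submodule_iff_iSupIndep_and_iSup_eq_top _).mp hM.weight).2
    refine (DirectSum.isInternal_submodule_iff_iSupIndep_and_iSup_eq_top _).mpr
      ⟨iSupIndep_weightSpace _, eq_top_iff.mpr fun n _ => ?_⟩
    obtain ⟨m, rfl⟩ := hf n
    have hm : m ∈ ⨆ μ, weightSpace M μ := hM' ▸ Submodule.mem_top
    induction hm using Submodule.iSup_induction' with
    | mem μ x hx =>
      refine Submodule.mem_iSup_of_mem μ fun h => ?_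
      have : toU h • x = μ h • x := hx h
      rw [← map_smul, this, f.map_smul_of_tower]
    | zero => rw [map_zero]; exact Submodule.zero_mem _
    | add x y _ _ hx hy => rw [map_add]; exact Submodule.add_mem _ (hx trivial) (hy trivial)
  finite := by
    have := hM.finite
    exact Module.Finite.of_surjective f hf
  locallyFinite n := by
    obtain ⟨m, rfl⟩ := hf n
    obtain ⟨W, hm, hW, hs⟩ := hM.locallyFinite m
    refine ⟨W.map (f.restrictScalars ℂ), ⟨m, hm, rfl⟩, inferInstance, ?_⟩
    rintro k hk _ ⟨w, hw, rfl⟩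
    exact ⟨toU (d k) • w, hs k hk w hw, map_smul f _ _⟩

theorem IsSubquotient.of_surjective {S M N : ModuleCat.{0} UVir} (f : M →ₗ[UVir] N)
    (hf : Function.Surjective f) (h : IsSubquotient S N) : IsSubquotient S M := by
  obtain ⟨K, g, hg⟩ := h
  refine ⟨K.comap f, g ∘ₗ f.restrict (p := K.comap f) (q := K) fun x hx => hx, ?_⟩
  intro s
  obtain ⟨⟨k, hk⟩, rfl⟩ := hg s
  obtain ⟨m, rfl⟩ := hf k
  exact ⟨⟨m, hk⟩, rfl⟩

theorem verma_blockProperty {Λ : Set Weight} (hΛ : IsBlock Λ) {γ : Weight} (hγ : γ ∈ Λ) :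
    blockProperty Λ (verma γ) := by
  refine ⟨verma_inCategoryO γ, fun δ hδ => ?_⟩
  obtain ⟨μ, rfl⟩ := hΛ
  exact Relation.EqvGen.trans _ _ _ hγ
    (Relation.EqvGen.symm _ _ (Relation.EqvGen.rel (r := Preceq) δ γ hδ))

theorem simple_blockProperty {Λ : Set Weight} (hΛ : IsBlock Λ) {γ : Weight} (hγ : γ ∈ Λ) :
    blockProperty Λ (simple γ) :=
  ⟨(verma_inCategoryO γ).of_surjective _ (Submodule.mkQ_surjective (vermaRadical γ)),
    fun δ hδ => (verma_blockProperty hΛ hγ).2 δ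
      (hδ.of_surjective _ (Submodule.mkQ_surjective (vermaRadical γ)))⟩

/-- The Verma module `M(γ)`, `γ ∈ Λ`, as an object of the block. -/
def vermaObj {Λ : Set Weight} (hΛ : IsBlock Λ) (γ : Λ) : BlockCat Λ :=
  ⟨verma γ, verma_blockProperty hΛ γ.2⟩

/-- The simple module `L(γ)`, `γ ∈ Λ`, as an object of the block. -/
def simpleObj {Λ : Set Weight} (hΛ : IsBlock Λ) (γ : Λ) : BlockCat Λ :=
  ⟨simple γ, simple_blockProperty hΛ γ.2⟩

/-! ### Projective covers, projective resolutions and `Ext` in a block -/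

/-- `p : P ⟶ X` is a projective cover: `P` is projective and `p` is an essential epimorphism. -/
structure IsProjectiveCover {C : Type*} [Category C] {P X : C} (p : P ⟶ X) : Prop where
  projective : Projective P
  epi : Epi p
  essential : ∀ {Q : C} (q : Q ⟶ P), Epi (q ≫ p) → Epi q

/-- A projective resolution `⋯ → P_1 → P_0 → X → 0` in the block: the `P_n` are projective objects
of the block, and the sequence is exact. -/
structure BlockResolution {Λ : Set Weight} (X : BlockCat Λ) where
  complex : ChainComplex (BlockCat Λ) ℕ
  projective : ∀ n, Projective (complex.X n)
  π : complex.X 0 ⟶ X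
  surjective : Function.Surjective π.hom.hom
  exact_zero : Function.Exact (complex.d 1 0).hom.hom π.hom.hom
  exact_succ : ∀ n, Function.Exact (complex.d (n + 2) (n + 1)).hom.hom
    (complex.d (n + 1) n).hom.hom

/-- `Ext^i(X, Y)` in the block, computed from a projective resolution of `X`: the `i`-th cohomology
of the complex `Hom(P_0, Y) → Hom(P_1, Y) → ⋯` of complex vector spaces. -/
def BlockResolution.ext {Λ : Set Weight} {X : BlockCat Λ} (R : BlockResolution X)
    (Y : BlockCat Λ) (i : ℕ) : ModuleCat.{0} ℂ :=
  ((((linearYoneda ℂ (BlockCat Λ)).obj Y).rightOp.mapHomologicalComplex _).obj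
    R.complex).unop.homology i

/-! ### Corner algebras -/

section Corner

variable {B : Type} [Ring B] [Algebra ℂ B] {e : B} (he : IsIdempotentElem e)

instance cornerSMul : SMul ℂ he.Corner :=
  ⟨fun c x => ⟨c • x.1, by
    obtain ⟨b, hb⟩ := x.2
    exact ⟨c • b, by rw [← hb]; simp⟩⟩⟩

instance cornerModule : Module ℂ he.Corner where
  one_smul x := Subtype.ext (one_smul ℂ x.1)
  mul_smul a b x := Subtype.ext (mul_smul a b x.1)
  smul_zero a := Subtype.ext (smul_zero a)
  smul_add a x y := Subtype.ext (smul_add a x.1 y.1)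
  add_smul a b x := Subtype.ext (add_smul a b x.1)
  zero_smul x := Subtype.ext (zero_smul ℂ x.1)

/-- `eBe` is an algebra over `ℂ`. -/
instance cornerAlgebra : Algebra ℂ he.Corner :=
  Algebra.ofModule (fun a x y => Subtype.ext (smul_mul_assoc a x.1 y.1))
    (fun a x y => Subtype.ext (mul_smul_comm a x.1 y.1))

variable (N : Type) [AddCommGroup N] [Module B N]

/-- The subgroup `eN = {n ∈ N | en = n}` of a `B`-module `N`. -/
def cornerPart (e : B) : AddSubgroup N where
  carrier := {n | e • n = n}
  add_mem' ha hb := by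
    simp only [Set.mem_ofPred_eq] at ha hb ⊢
    rw [smul_add, ha, hb]
  zero_mem' := smul_zero e
  neg_mem' ha := by
    simp only [Set.mem_ofPred_eq] at ha ⊢
    rw [smul_neg, ha]

/-- `eN` is a module over `eBe`. -/
instance cornerPartModule : Module he.Corner (cornerPart N e) where
  smul x n := ⟨x.1 • n.1, by
    change e • x.1 • n.1 = x.1 • n.1
    rw [← mul_smul, ((Subsemigroup.mem_corner_iff he).mp x.2).1]⟩
  one_smul n := Subtype.ext n.2
  mul_smul x y n := Subtype.ext (mul_smul x.1 y.1 n.1)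
  smul_zero x := Subtype.ext (smul_zero x.1)
  smul_add x n n' := Subtype.ext (smul_add x.1 n.1 n'.1)
  add_smul x y n := Subtype.ext (add_smul x.1 y.1 n.1)
  zero_smul n := Subtype.ext (zero_smul B n.1)

end Corner

/-! ### The quotient category -/

section Quotient

variable {Λ : Set Weight} (P : Λ → BlockCat Λ)

/-- The module `P = ⨁_{γ ∈ Λ} P(γ)`. -/
def totalModule : ModuleCat.{0} UVir := ModuleCat.of UVir (DirectSum Λ fun γ => (P γ).obj)

/-- The algebra `B = End(P)ᵒᵖ`. -/
abbrev EndAlg : Type := (End (totalModule P))ᵐᵒᵖ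

open Classical in
/-- The idempotent `e` of `B`: the projection of `P` onto `⨁_{γ ∈ Ω} P(γ)`. -/
def idem (Ω : Set Λ) : EndAlg P :=
  MulOpposite.op (End.of (ModuleCat.ofHom
    (DFinsupp.filterLinearMap UVir (fun γ : Λ => ((P γ).obj : Type)) (· ∈ Ω))))

theorem idem_isIdempotentElem (Ω : Set Λ) : IsIdempotentElem (idem P Ω) := by
  classical
  apply MulOpposite.unop_injective
  have key : ∀ x : DFinsupp fun γ : Λ => ((P γ).obj : Type),
      DFinsupp.filter (· ∈ Ω) (DFinsupp.filter (· ∈ Ω) x) = DFinsupp.filter (· ∈ Ω) x := by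
    intro x
    ext γ
    by_cases h : γ ∈ Ω <;> simp [DFinsupp.filter_apply, h]
  exact ModuleCat.hom_ext (LinearMap.ext key)

/-- The algebra `A = eBe`. -/
abbrev QuotAlg (Ω : Set Λ) : Type := (idem_isIdempotentElem P Ω).Corner

/-- The `eBe`-module `eM`, where an object `M` of the block is regarded as the
`B`-module `Hom(P, M)`. -/
def quotModule (Ω : Set Λ) (M : BlockCat Λ) : ModuleCat.{0} (QuotAlg P Ω) :=
  ModuleCat.of (QuotAlg P Ω) (cornerPart (totalModule P ⟶ M.obj) (idem P Ω))

end Quotient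

/-- `Ω` is a coideal of `(Λ, ⪯)`. -/
def IsCoideal {Λ : Set Weight} (Ω : Set Λ) : Prop :=
  ∀ γ ∈ Ω, ∀ δ : Λ, Preceq γ δ → δ ∈ Ω

end

end VirO

/-!
The weights of a block `Λ` with a maximal element `μ` all have the form `μ + n` with `n ≥ 0`, so the
objects of the block are weight modules whose weights are `μ, μ + 1, μ + 2, …`. Call such modules
bounded; they are graded by `n`, and `d_k` lowers the degree by `k`. No information on the structure
of Verma modules is needed, and neither is a Poincaré–Birkhoff–Witt basis.

*Projective covers.* On bounded modules the functor `M ↦ M^{μ + n}` is corepresented by a quotient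
`Q(n)` of `U(𝔤)` (`bigProj`): divide by the left ideal of elements that annihilate the vectors of
degree `n` of all bounded modules. The module `Q(n)` is bounded and finitely generated with finite
dimensional graded pieces, and it is projective relative to bounded modules. A Fitting type argument
cuts out of it a summand `P` with an essential map onto `L(μ + n)` (`exists_essential_summand`).

*Verma flags.* Let `W ⊆ Q(n)` be the `𝔟⁺`-submodule generated by the universal vector. The induced
module `U(𝔫⁻) ⊗ W` is again bounded, so the universal property of `Q(n)` inverts `U(𝔫⁻) ⊗ W → Q(n)`
(`mulMap_posSpan_bijective`), and `Q(n)` is free over `U(𝔫⁻)`. Therefore a summand `P` of `Q(n)`,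
filtered by the submodules `low μ P j` generated in degrees `< j`, has a flag of Verma modules
`M(μ + j)`, where `P` has generators in degree `j` (`IsProjSummand.flag`). If `P` covers `L(γ)` and
has generators in degree `j`, then a functional on these generators is a singular vector of the dual
of `P` twisted by `d_k ↦ d_{-k}`, and the functionals coming from `L(γ)` lie in the submodule
generated by it; this submodule is a quotient of `M(μ + j)`, whence `γ ⪯ μ + j`
(`preceq_of_essential`). So `P(γ)` has a flag with top `M(γ)` and with other subquotients `M(δ)`,
`γ ⪯ δ`. Since all these `δ` lie in `Λ`, the module `P` belongs to the block.

*Resolutions.* Let `Ω` be a coideal. By the last statement the kernel of `P(γ) → M(γ)`, `γ ∈ Ω`, has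
a Verma flag with weights in `Ω`, and by the horseshoe construction every module with such a flag is
a quotient of a finite sum of modules `P(γ)`, `γ ∈ Ω`, with a kernel of the same kind. Iterating this
yields a resolution of `M(λ)`, `λ ∈ Ω`, by such sums (`Flag.exists_resolution`); for `Ω = Λ` this
shows that `M(λ)` has a projective resolution in the block.

*Comparison.* The functor `M ↦ eM` from the block to modules over `eBe` is exact. It sends `P(γ)`,
`γ ∈ Ω`, to a direct summand of `eBe`, and it is bijective on homomorphisms starting in `P(γ)`. So
it takes the resolution above to a projective resolution of `eM(λ)` without changing the complexes
of homomorphisms (`homComplexIso`). Any two resolutions being homotopy equivalent, the Ext spaces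
agree (`BlockResolution.nonempty_ext_iso`).
-/

open CategoryTheory Limits
open scoped ModuleCat TensorProduct

namespace VirO

noncomputable section

open Virasoro

attribute [local instance 100] LieRing.ofAssociativeRing

section

/-! ### Induction from a subalgebra with a complementary subalgebra -/

section EnvelopingAlgebra

variable {K L : Type*} [CommRing K] [LieRing L] [LieAlgebra K L]

/-- Induction on the enveloping algebra acting on a module: a subspace stable under the Lie algebra
is stable under the enveloping algebra. -/
theorem uea_smul_mem {M : Type*} [AddCommGroup M] [Module K M]
    [Module (UniversalEnvelopingAlgebra K L) M]
    [IsScalarTower K (UniversalEnvelopingAlgebra K L) M] (S : Submodule K M)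
    (h : ∀ x : L, ∀ m ∈ S, UniversalEnvelopingAlgebra.ι K x • m ∈ S)
    (u : UniversalEnvelopingAlgebra K L) {m : M} (hm : m ∈ S) : u • m ∈ S := by
  let T : Subalgebra K (UniversalEnvelopingAlgebra K L) :=
    { carrier := {u | ∀ m ∈ S, u • m ∈ S}
      mul_mem' := fun {a b} ha hb m hm => by rw [mul_smul]; exact ha _ (hb _ hm)
      add_mem' := fun {a b} ha hb m hm => by rw [add_smul]; exact S.add_mem (ha _ hm) (hb _ hm)
      algebraMap_mem' := fun c m hm => by rw [algebraMap_smul]; exact S.smul_mem c hm }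
  let g : L →ₗ⁅K⁆ T :=
    { toFun := fun x => ⟨UniversalEnvelopingAlgebra.ι K x, h x⟩
      map_add' := fun x y => Subtype.ext (map_add _ x y)
      map_smul' := fun c x => Subtype.ext (map_smul _ c x)
      map_lie' := fun {x y} => Subtype.ext (LieHom.map_lie _ x y) }
  have hcomp : T.val.comp (UniversalEnvelopingAlgebra.lift K g) = AlgHom.id K _ := by
    apply UniversalEnvelopingAlgebra.hom_ext
    ext x
    change T.val (UniversalEnvelopingAlgebra.lift K g (UniversalEnvelopingAlgebra.ι K x)) = _
    rw [UniversalEnvelopingAlgebra.lift_ι_apply]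
    rfl
  have hu : u ∈ T := by
    have := congrArg (fun f => f u) hcomp
    change ((UniversalEnvelopingAlgebra.lift K g u : T) : _) = u at this
    rw [← this]; exact Subtype.property _
  exact hu m hm

theorem uea_induction {p : UniversalEnvelopingAlgebra K L → Prop} (one : p 1)
    (add : ∀ a b, p a → p b → p (a + b)) (smul : ∀ (c : K) a, p a → p (c • a))
    (mul : ∀ x a, p a → p (UniversalEnvelopingAlgebra.ι K x * a))
    (a : UniversalEnvelopingAlgebra K L) : p a := by
  let S : Submodule K (UniversalEnvelopingAlgebra K L) :=
    { carrier := {a | p a}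
      add_mem' := fun {a b} ha hb => add a b ha hb
      zero_mem' := by simpa using smul 0 1 one
      smul_mem' := fun c a ha => smul c a ha }
  have : a • (1 : UniversalEnvelopingAlgebra K L) ∈ S :=
    uea_smul_mem S (fun x m hm => mul x m hm) a one
  rw [smul_eq_mul, mul_one] at this
  exact this

end EnvelopingAlgebra

section Induced

variable {K L : Type*} [Field K] [LieRing L] [LieAlgebra K L] {n b : LieSubalgebra K L}
  (hnb : IsCompl n.toSubmodule b.toSubmodule) {W : Type*} [AddCommGroup W] [Module K W]
  (τ : b →ₗ⁅K⁆ Module.End K W)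

/-- The action of the Lie algebra on `1 ⊗ W` inside `U(n) ⊗ W`. -/
def indBase : L →ₗ[K] W →ₗ[K] (UniversalEnvelopingAlgebra K n) ⊗[K] W :=
  (TensorProduct.mk K (UniversalEnvelopingAlgebra K n) W) ∘ₗ
      ((UniversalEnvelopingAlgebra.ι K : n →ₗ⁅K⁆ UniversalEnvelopingAlgebra K n) :
        n →ₗ[K] UniversalEnvelopingAlgebra K n) ∘ₗ
      (Submodule.projectionOnto _ _ hnb : L →ₗ[K] n) +
    (LinearMap.compRight K (TensorProduct.mk K (UniversalEnvelopingAlgebra K n) W 1)) ∘ₗ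
      (τ : b →ₗ[K] Module.End K W) ∘ₗ
      (Submodule.projectionOnto _ _ hnb.symm : L →ₗ[K] b)

theorem indBase_left (x : n) (w : W) :
    indBase hnb τ x w = UniversalEnvelopingAlgebra.ι K x ⊗ₜ w := by
  have h1 := Submodule.projectionOnto_apply_left hnb x
  have h2 := Submodule.projectionOnto_apply_right hnb.symm x
  simp only [indBase, LinearMap.add_apply, LinearMap.comp_apply]
  rw [h1, h2]
  simp

theorem indBase_right (y : b) (w : W) : indBase hnb τ y w = 1 ⊗ₜ τ y w := by
  have h1 := Submodule.projectionOnto_apply_left hnb.symm y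
  have h2 := Submodule.projectionOnto_apply_right hnb y
  simp only [indBase, LinearMap.add_apply, LinearMap.comp_apply]
  rw [h1, h2]
  simp

section Twist

variable (n W) {T : Type*} [AddCommGroup T] [Module K T]
  [Module (UniversalEnvelopingAlgebra K n) T] [IsScalarTower K (UniversalEnvelopingAlgebra K n) T]

/-- The action of `n` on the space of bilinear maps `L × W → T` with values in an `n`-module `T`,
given by `(x φ) (y, w) = x · φ (y, w) + φ ([y, x], w)`. -/
def indTwist : n →ₗ⁅K⁆ Module.End K (L →ₗ[K] W →ₗ[K] T) where
  toFun x :=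
    { toFun := fun φ =>
        (LinearMap.compRight K (Algebra.lsmul K K T (UniversalEnvelopingAlgebra.ι K x))) ∘ₗ
          φ - φ ∘ₗ (LieAlgebra.ad K L x : L →ₗ[K] L)
      map_add' := fun φ ψ => by
        ext y w
        simp only [LinearMap.sub_apply, LinearMap.comp_apply, LinearMap.add_apply,
          LinearMap.compRight_apply, map_add]
        abel
      map_smul' := fun c φ => by
        ext y w
        simp only [LinearMap.sub_apply, LinearMap.comp_apply, LinearMap.smul_apply,
          LinearMap.compRight_apply, map_smul, RingHom.id_apply, smul_sub] }
  map_add' x x' := by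
    ext φ y w
    simp
    abel
  map_smul' c x := by
    ext φ y w
    simp [smul_sub]
  map_lie' {x x'} := by
    ext φ y w
    simp [LieRing.of_associative_ring_bracket, smul_sub]
    abel

/-- The extension of `indTwist` to the enveloping algebra, applied to a fixed bilinear map. -/
def twistAct (φ : L →ₗ[K] W →ₗ[K] T) : (UniversalEnvelopingAlgebra K n) →ₗ[K] L →ₗ[K] W →ₗ[K] T :=
  LinearMap.applyₗ φ ∘ₗ (UniversalEnvelopingAlgebra.lift K (indTwist n W (T := T))).toLinearMap

variable {n W} (φ : L →ₗ[K] W →ₗ[K] T)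

theorem twistAct_one : twistAct n W φ 1 = φ := by
  simp [twistAct]

theorem twistAct_mul (x : n) (a : (UniversalEnvelopingAlgebra K n)) (y : L) (w : W) :
    twistAct n W φ (UniversalEnvelopingAlgebra.ι K x * a) y w =
      UniversalEnvelopingAlgebra.ι K x • twistAct n W φ a y w +
        twistAct n W φ a ⁅y, (x : L)⁆ w := by
  have h : twistAct n W φ (UniversalEnvelopingAlgebra.ι K x * a) =
      indTwist n W x (twistAct n W φ a) := by
    change UniversalEnvelopingAlgebra.lift K (indTwist n W (T := T))
      (UniversalEnvelopingAlgebra.ι K x * a) φ = _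
    rw [map_mul, UniversalEnvelopingAlgebra.lift_ι_apply]
    rfl
  have h' : ⁅y, (x : L)⁆ = -⁅(x : L), y⁆ := (lie_skew _ _).symm
  rw [h, h', map_neg]
  exact sub_eq_add_neg _ _

end Twist

/-- The operator by which an element of `L` acts on `U(n) ⊗ W`. -/
def indOp : L →ₗ[K] (UniversalEnvelopingAlgebra K n) ⊗[K] W →ₗ[K]
    (UniversalEnvelopingAlgebra K n) ⊗[K] W :=
  (TensorProduct.lift.equiv (RingHom.id K) (UniversalEnvelopingAlgebra K n) W
      ((UniversalEnvelopingAlgebra K n) ⊗[K] W)).toLinearMap ∘ₗ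
    (twistAct n W (indBase hnb τ)).flip

theorem indOp_tmul (y : L) (a : (UniversalEnvelopingAlgebra K n)) (w : W) : indOp hnb τ y (a ⊗ₜ w) =
    twistAct n W (indBase hnb τ) a y w := rfl

theorem indOp_one (y : L) (w : W) : indOp hnb τ y (1 ⊗ₜ w) = indBase hnb τ y w := by
  rw [indOp_tmul, twistAct_one]

theorem ind_induction {p : (UniversalEnvelopingAlgebra K n) ⊗[K] W → Prop} (one : ∀ w, p (1 ⊗ₜ w))
    (add : ∀ s t, p s → p t → p (s + t)) (smul : ∀ (c : K) t, p t → p (c • t))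
    (mul : ∀ (x : n) t, p t → p (UniversalEnvelopingAlgebra.ι K x • t))
    (t : (UniversalEnvelopingAlgebra K n) ⊗[K] W) : p t := by
  induction t with
  | zero => simpa using smul 0 _ (one 0)
  | add s t hs ht => exact add s t hs ht
  | tmul a w =>
    induction a using uea_induction with
    | one => exact one w
    | add a b ha hb => rw [TensorProduct.add_tmul]; exact add _ _ ha hb
    | smul c a ha => rw [← TensorProduct.smul_tmul']; exact smul _ _ ha
    | mul x a ha => exact mul x _ ha

/-- The commutation rule defining the induced module. -/
theorem indOp_smul (y : L) (x : n) (t : (UniversalEnvelopingAlgebra K n) ⊗[K] W) :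
    indOp hnb τ y (UniversalEnvelopingAlgebra.ι K x • t) =
      UniversalEnvelopingAlgebra.ι K x • indOp hnb τ y t + indOp hnb τ ⁅y, (x : L)⁆ t := by
  induction t with
  | zero => simp
  | add s t hs ht => simp only [smul_add, map_add, hs, ht]; abel
  | tmul a w =>
    rw [TensorProduct.smul_tmul', indOp_tmul, smul_eq_mul, twistAct_mul]
    rfl

theorem indOp_left (x : n) (t : (UniversalEnvelopingAlgebra K n) ⊗[K] W) :
    indOp hnb τ x t = UniversalEnvelopingAlgebra.ι K x • t := by
  induction t using ind_induction generalizing x with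
  | one w => rw [indOp_one, indBase_left, TensorProduct.smul_tmul', smul_eq_mul, mul_one]
  | add s t hs ht => rw [map_add, hs, ht, smul_add]
  | smul c t ht => rw [map_smul, ht, smul_comm]
  | mul x' t ht =>
    have h : ⁅(x : L), (x' : L)⁆ = ((⁅x, x'⁆ : n) : L) := rfl
    rw [indOp_smul, ht, h, ht, LieHom.map_lie, LieRing.of_associative_ring_bracket, sub_smul,
      mul_smul, mul_smul]
    abel

theorem indOp_right (y : b) (w : W) : indOp hnb τ y (1 ⊗ₜ w) = 1 ⊗ₜ τ y w := by
  rw [indOp_one, indBase_right]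

theorem indOp_lie (y y' : L) (t : (UniversalEnvelopingAlgebra K n) ⊗[K] W) : indOp hnb τ ⁅y, y'⁆ t =
    indOp hnb τ y (indOp hnb τ y' t) - indOp hnb τ y' (indOp hnb τ y t) := by
  have hleft : ∀ (y : L) (x : n) (t : (UniversalEnvelopingAlgebra K n) ⊗[K] W),
      indOp hnb τ ⁅y, (x : L)⁆ t =
        indOp hnb τ y (indOp hnb τ x t) - indOp hnb τ x (indOp hnb τ y t) := by
    intro y x t
    rw [indOp_left, indOp_left, indOp_smul]
    abel
  induction t using ind_induction generalizing y y' with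
  | one w =>
    have hdec : ∀ y : L, ∃ (x : n) (z : b), y = x + z := fun y => by
      obtain ⟨x, hx, z, hz, h⟩ := Submodule.mem_sup.mp
        (hnb.sup_eq_top ▸ Submodule.mem_top : y ∈ n.toSubmodule ⊔ b.toSubmodule)
      exact ⟨⟨x, hx⟩, ⟨z, hz⟩, h.symm⟩
    obtain ⟨x, z, rfl⟩ := hdec y
    obtain ⟨x', z', rfl⟩ := hdec y'
    have h1 : ⁅(x : L) + z, (x' : L) + z'⁆ =
        ⁅(x : L) + z, (x' : L)⁆ - ⁅(z' : L), (x : L)⁆ + ((⁅z, z'⁆ : b) : L) := by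
      rw [lie_add, add_lie _ _ (z' : L), ← lie_skew (x : L) (z' : L), LieSubalgebra.coe_bracket]
      abel
    rw [h1, map_add, LinearMap.add_apply, map_sub, LinearMap.sub_apply, hleft, hleft,
      indOp_right _ _ ⁅z, z'⁆, LieHom.map_lie, LieRing.of_associative_ring_bracket]
    simp only [map_add, LinearMap.add_apply, indOp_right, LinearMap.sub_apply,
      Module.End.mul_apply, TensorProduct.tmul_sub]
    abel
  | add s t hs ht => simp only [map_add, hs y y', ht y y']; abel
  | smul c t ht => simp only [map_smul, ht y y', smul_sub]
  | mul x t ht =>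
    have hj : ⁅⁅y, y'⁆, (x : L)⁆ = ⁅y, ⁅y', (x : L)⁆⁆ - ⁅y', ⁅y, (x : L)⁆⁆ := lie_lie _ _ _
    simp only [indOp_smul, map_add]
    rw [hj, map_sub, LinearMap.sub_apply, ht y y', ht y ⁅y', (x : L)⁆, ht y' ⁅y, (x : L)⁆, smul_sub]
    abel

/-- The representation of `L` on `U(n) ⊗ W` induced from a representation of `b` on `W`. -/
def indRep : L →ₗ⁅K⁆ Module.End K ((UniversalEnvelopingAlgebra K n) ⊗[K] W) :=
  { indOp hnb τ with
    map_lie' := fun {y y'} => by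
      refine LinearMap.ext fun t => ?_
      exact indOp_lie hnb τ y y' t }

end Induced

end

section

/-! ### Graded pieces of weight modules -/

theorem d_zero_mem_cartan : d 0 ∈ cartan := Submodule.subset_span (by simp)

theorem intWeight_d_zero (n : ℤ) : intWeight n ⟨d 0, d_zero_mem_cartan⟩ = n := by
  change (n : ℂ) * ((Finsupp.single (0 : ℤ) (1 : ℂ)) 0) = n
  simp

theorem intWeight_add (m n : ℤ) : intWeight (m + n) = intWeight m + intWeight n := by
  simp [intWeight, add_smul]

theorem intWeight_sub (m n : ℤ) : intWeight (m - n) = intWeight m - intWeight n := by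
  simp [intWeight, sub_smul]

theorem intWeight_zero : intWeight 0 = 0 := by simp [intWeight]

theorem intWeight_injective : Function.Injective intWeight := fun m n h => by
  have := congrArg (fun w : Weight => w ⟨d 0, d_zero_mem_cartan⟩) h
  simpa [intWeight_d_zero] using this

theorem map_mem_weightSpace {M N : ModuleCat.{0} UVir} (f : M →ₗ[UVir] N) {γ : Weight} {m : M}
    (hm : m ∈ weightSpace M γ) : f m ∈ weightSpace N γ := fun h => by
  have h1 : toU h • m = γ h • m := hm h
  rw [← map_smul, h1, f.map_smul_of_tower]

theorem mem_weightSpace_of_map {M N : ModuleCat.{0} UVir} {f : M →ₗ[UVir] N}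
    (hf : Function.Injective f) {γ : Weight} {m : M}
    (hm : f m ∈ weightSpace N γ) : m ∈ weightSpace M γ := fun h => by
  apply hf
  have h1 : toU h • f m = γ h • f m := hm h
  rw [map_smul, h1, f.map_smul_of_tower]

theorem mem_weightSpace_iff {M : ModuleCat.{0} UVir} {γ : Weight} {m : M} :
    m ∈ weightSpace M γ ↔ toU (d 0) • m = γ ⟨d 0, d_zero_mem_cartan⟩ • m ∧
      toU z • m = γ ⟨z, z_mem_cartan⟩ • m := by
  refine ⟨fun h => ⟨h ⟨d 0, d_zero_mem_cartan⟩, h ⟨z, z_mem_cartan⟩⟩, fun ⟨h0, hz⟩ => ?_⟩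
  rintro ⟨h, hh⟩
  obtain ⟨a, b, rfl⟩ := Submodule.mem_span_pair.mp hh
  have h1 : (⟨a • d 0 + b • z, hh⟩ : cartan) =
      a • ⟨d 0, d_zero_mem_cartan⟩ + b • ⟨z, z_mem_cartan⟩ := rfl
  rw [h1, map_add, map_smul, map_smul]
  change toU (a • d 0 + b • z) • m = _
  rw [toU, map_add, map_smul, map_smul, add_smul, add_smul, smul_assoc, smul_assoc, h0, hz,
    smul_assoc, smul_assoc]

/-- The piece of degree `n` of `M`, relative to a base weight `μ`: the weight space for the weight
`μ + n`. The operator `d_k` lowers the degree by `k`. -/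
def grd (μ : Weight) (M : ModuleCat.{0} UVir) (n : ℤ) : Submodule ℂ M :=
  weightSpace M (μ + intWeight n)

variable {μ : Weight} {M N : ModuleCat.{0} UVir}

theorem d_smul_mem_grd (k : ℤ) {n : ℤ} {m : M} (hm : m ∈ grd μ M n) :
    toU (d k) • m ∈ grd μ M (n - k) := by
  have := smul_mem_weightSpace hm k
  rwa [add_sub_assoc, ← intWeight_sub] at this

theorem d_zero_smul_of_mem_grd {n : ℤ} {m : M} (hm : m ∈ grd μ M n) :
    toU (d 0) • m = (μ ⟨d 0, d_zero_mem_cartan⟩ + n) • m := by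
  have := (mem_weightSpace_iff.mp hm).1
  rwa [LinearMap.add_apply, intWeight_d_zero] at this

theorem z_smul_of_mem_grd {n : ℤ} {m : M} (hm : m ∈ grd μ M n) :
    ∃ c : ℂ, toU z • m = c • m := ⟨_, (mem_weightSpace_iff.mp hm).2⟩

theorem map_mem_grd (f : M →ₗ[UVir] N) {n : ℤ} {m : M}
    (hm : m ∈ grd μ M n) : f m ∈ grd μ N n := map_mem_weightSpace f hm

theorem iSupIndep_grd (μ : Weight) (M : ModuleCat.{0} UVir) : iSupIndep (grd μ M) :=
  (iSupIndep_weightSpace M).comp fun _ _ h => intWeight_injective (add_left_cancel h)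

/-- `M` is the sum of its weight spaces for the weights `μ, μ + 1, μ + 2, …`, that is, `M` is a
weight module all of whose weights are at most `μ`. -/
def IsBdd (μ : Weight) (M : ModuleCat.{0} UVir) : Prop := ⨆ n : ℕ, grd μ M n = ⊤

theorem IsBdd.isInternal (h : IsBdd μ M) : DirectSum.IsInternal (grd μ M) := by
  refine (DirectSum.isInternal_submodule_iff_iSupIndep_and_iSup_eq_top _).mpr
    ⟨iSupIndep_grd μ M, eq_top_iff.mpr ?_⟩
  rw [← h]
  exact iSup_le fun n => le_iSup (grd μ M) (n : ℤ)

/-- The decomposition of a bounded weight module into its graded pieces. -/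
def IsBdd.equiv (h : IsBdd μ M) : (DirectSum ℤ fun n => grd μ M n) ≃ₗ[ℂ] M :=
  LinearEquiv.ofBijective (DirectSum.coeLinearMap (grd μ M))
    (show Function.Bijective _ from h.isInternal)

/-- The projection of a bounded weight module to its piece of degree `n`. -/
def comp (h : IsBdd μ M) (n : ℤ) : M →ₗ[ℂ] M :=
  (grd μ M n).subtype ∘ₗ DirectSum.component ℂ ℤ (fun n => grd μ M n) n ∘ₗ
    h.equiv.symm.toLinearMap

theorem comp_mem (h : IsBdd μ M) (n : ℤ) (m : M) : comp h n m ∈ grd μ M n :=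
  Subtype.property _

theorem comp_of_mem_eq (h : IsBdd μ M) {k : ℤ} {m : M} (hm : m ∈ grd μ M k) (n : ℤ) :
    comp h n m = if k = n then m else 0 := by
  have h1 : h.equiv.symm m =
      DirectSum.lof ℂ ℤ (fun n => grd μ M n) k ⟨m, hm⟩ := by
    rw [LinearEquiv.symm_apply_eq]
    exact (DirectSum.coeLinearMap_lof (grd μ M) k ⟨m, hm⟩).symm
  change ((DirectSum.component ℂ ℤ (fun n => grd μ M n) n
    (h.equiv.symm m) :
      grd μ M n) : M) = _
  rw [h1]
  split_ifs with hk
  · subst hk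
    rw [DirectSum.component.lof_self]
  · rw [DirectSum.component.of, dif_neg hk]
    rfl

theorem comp_of_mem (h : IsBdd μ M) {n : ℤ} {m : M} (hm : m ∈ grd μ M n) : comp h n m = m := by
  rw [comp_of_mem_eq h hm, if_pos rfl]

theorem comp_of_ne (h : IsBdd μ M) {k n : ℤ} (hk : k ≠ n) {m : M} (hm : m ∈ grd μ M k) :
    comp h n m = 0 := by
  rw [comp_of_mem_eq h hm, if_neg hk]

theorem IsBdd.induction (h : IsBdd μ M) {p : M → Prop} (zero : p 0)
    (add : ∀ a b, p a → p b → p (a + b)) (mem : ∀ (n : ℕ), ∀ m ∈ grd μ M n, p m) (m : M) : p m := by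
  have hm : m ∈ ⨆ n : ℕ, grd μ M n := h ▸ Submodule.mem_top
  exact Submodule.iSup_induction _ (motive := p) hm mem zero add

theorem comp_eq_zero_of_neg (h : IsBdd μ M) {n : ℤ} (hn : n < 0) (m : M) : comp h n m = 0 := by
  induction m using h.induction with
  | zero => exact map_zero _
  | add a b ha hb => rw [map_add, ha, hb, add_zero]
  | mem k m hk => exact comp_of_ne h (by omega) hk

theorem grd_eq_zero_of_neg (h : IsBdd μ M) {n : ℤ} (hn : n < 0) {m : M} (hm : m ∈ grd μ M n) :
    m = 0 := by
  rw [← comp_of_mem h hm, comp_eq_zero_of_neg h hn]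

theorem exists_sum_comp (h : IsBdd μ M) (m : M) :
    ∃ s : Finset ℕ, ∀ t : Finset ℕ, s ⊆ t → ∑ n ∈ t, comp h n m = m := by
  classical
  induction m using h.induction with
  | zero => exact ⟨∅, fun t _ => by simp⟩
  | add a b ha hb =>
    obtain ⟨s, hs⟩ := ha
    obtain ⟨s', hs'⟩ := hb
    refine ⟨s ∪ s', fun t ht => ?_⟩
    simp only [map_add, Finset.sum_add_distrib]
    rw [hs t (Finset.union_subset_left ht), hs' t (Finset.union_subset_right ht)]
  | mem k m hk =>
    refine ⟨{k}, fun t ht => ?_⟩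
    rw [Finset.sum_eq_single_of_mem k (ht (Finset.mem_singleton_self k))
      fun n _ hn => comp_of_ne h (by exact_mod_cast hn.symm) hk, comp_of_mem h hk]

theorem mem_of_comp_mem (h : IsBdd μ M) (S : Submodule ℂ M) (m : M)
    (hS : ∀ n : ℕ, comp h n m ∈ S) : m ∈ S := by
  obtain ⟨s, hs⟩ := exists_sum_comp h m
  rw [← hs s subset_rfl]
  exact S.sum_mem fun n _ => hS n

theorem comp_mem_of_mem_iSup (h : IsBdd μ M) {Y : ℤ → Submodule ℂ M} (hY : ∀ n, Y n ≤ grd μ M n)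
    {m : M} (hm : m ∈ ⨆ n, Y n) (n : ℤ) : comp h n m ∈ Y n := by
  induction hm using Submodule.iSup_induction' with
  | mem k x hx =>
    rw [comp_of_mem_eq h (hY k hx)]
    split_ifs with hk
    · exact hk ▸ hx
    · exact zero_mem _
  | zero => rw [map_zero]; exact zero_mem _
  | add x y _ _ hx hy => rw [map_add]; exact add_mem hx hy

theorem map_comp (hM : IsBdd μ M) (hN : IsBdd μ N) (f : M →ₗ[UVir] N) (n : ℤ) (m : M) :
    f (comp hM n m) = comp hN n (f m) := by
  induction m using hM.induction with
  | zero => simp only [map_zero]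
  | add a b ha hb => simp only [map_add, ha, hb]
  | mem k m hk =>
    rw [comp_of_mem_eq hM hk, comp_of_mem_eq hN (map_mem_grd f hk)]
    split_ifs
    · rfl
    · exact map_zero f

theorem map_mem_iSup_grd (hM : IsBdd μ M) (f : M →ₗ[UVir] N) (m : M) :
    f m ∈ ⨆ n : ℕ, grd μ N n := by
  induction m using hM.induction with
  | zero => rw [map_zero]; exact zero_mem _
  | add a b ha hb => rw [map_add]; exact add_mem ha hb
  | mem k m hk => exact Submodule.mem_iSup_of_mem k (map_mem_grd f hk)

theorem IsBdd.of_surjective (hM : IsBdd μ M) (f : M →ₗ[UVir] N) (hf : Function.Surjective f) :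
    IsBdd μ N := by
  refine eq_top_iff.mpr fun n _ => ?_
  obtain ⟨m, rfl⟩ := hf n
  exact map_mem_iSup_grd hM f m

theorem comp_mem_submodule (hM : IsBdd μ M) (S : Submodule UVir M) {m : M} (hm : m ∈ S) (n : ℤ) :
    comp hM n m ∈ S := by
  have hq : IsBdd μ (ModuleCat.of UVir (M ⧸ S)) :=
    hM.of_surjective S.mkQ S.mkQ_surjective
  have h := map_comp hM hq S.mkQ n m
  have h0 : S.mkQ m = 0 := (Submodule.Quotient.mk_eq_zero S).mpr hm
  rw [h0, map_zero] at h
  exact (Submodule.Quotient.mk_eq_zero S).mp h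

theorem IsBdd.of_injective (hM : IsBdd μ M) (f : N →ₗ[UVir] M) (hf : Function.Injective f) :
    IsBdd μ N := by
  refine eq_top_iff.mpr fun x _ => ?_
  have h : f x ∈ (⨆ n : ℕ, grd μ N n).map (f.restrictScalars ℂ) := by
    refine mem_of_comp_mem hM _ _ fun n => ?_
    obtain ⟨y, hy⟩ := comp_mem_submodule hM (LinearMap.range f) ⟨x, rfl⟩ n
    refine ⟨y, Submodule.mem_iSup_of_mem n (mem_weightSpace_of_map hf ?_), hy⟩
    rw [hy]
    exact comp_mem hM n _
  obtain ⟨y, hy, hyx⟩ := h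
  rwa [← hf hyx]

theorem IsBdd.submodule (hM : IsBdd μ M) (S : Submodule UVir M) : IsBdd μ (ModuleCat.of UVir S) :=
  hM.of_injective S.subtype S.subtype_injective

theorem IsBdd.prod (hM : IsBdd μ M) (hN : IsBdd μ N) : IsBdd μ (ModuleCat.of UVir (M × N)) := by
  refine eq_top_iff.mpr fun x _ => ?_
  have hx : x = LinearMap.inl UVir M N x.1 + LinearMap.inr UVir M N x.2 := by simp
  rw [hx]
  exact add_mem (map_mem_iSup_grd (N := ModuleCat.of UVir (M × N)) hM _ _)
    (map_mem_iSup_grd (N := ModuleCat.of UVir (M × N)) hN _ _)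

/-- Elements of a given degree lift along surjections of bounded weight modules. -/
theorem exists_mem_grd_map_eq (hM : IsBdd μ M) (hN : IsBdd μ N) {f : M →ₗ[UVir] N}
    (hf : Function.Surjective f) {n : ℤ} {y : N} (hy : y ∈ grd μ N n) :
    ∃ x ∈ grd μ M n, f x = y := by
  obtain ⟨x, rfl⟩ := hf y
  exact ⟨comp hM n x, comp_mem hM n x, by rw [map_comp hM hN, comp_of_mem hN hy]⟩

/-! ### The triangular decomposition -/

/-- The subalgebra spanned by the `d_k` with `k < 0`. -/
def nMinus : LieSubalgebra ℂ Virasoro where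
  toSubmodule := Submodule.span ℂ (Set.range fun k : ℕ => d (-((k : ℤ) + 1)))
  lie_mem' {x y} hx hy := by
    change x ∈ Submodule.span ℂ _ at hx
    change y ∈ Submodule.span ℂ _ at hy
    change _ ∈ Submodule.span ℂ _
    induction hx, hy using Submodule.span_induction₂ with
    | mem_mem x y hx hy =>
      obtain ⟨j, rfl⟩ := hx
      obtain ⟨k, rfl⟩ := hy
      rw [lie_d_d, if_neg (by omega), zero_smul, add_zero]
      refine Submodule.smul_mem _ _ (Submodule.subset_span ⟨j + k + 1, ?_⟩)
      congr 1
    | zero_left y hy => rw [zero_lie]; exact zero_mem _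
    | zero_right x hx => rw [lie_zero]; exact zero_mem _
    | add_left x y w _ _ _ h1 h2 => rw [add_lie]; exact add_mem h1 h2
    | add_right x y w _ _ _ h1 h2 => rw [lie_add]; exact add_mem h1 h2
    | smul_left c x y _ _ h => rw [smul_lie]; exact Submodule.smul_mem _ _ h
    | smul_right c x y _ _ h => rw [lie_smul]; exact Submodule.smul_mem _ _ h

/-- The subalgebra spanned by `z` and the `d_k` with `k ≥ 0`. -/
def bPlus : LieSubalgebra ℂ Virasoro where
  toSubmodule := Submodule.span ℂ (insert z (Set.range fun k : ℕ => d (k : ℤ)))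
  lie_mem' {x y} hx hy := by
    change x ∈ Submodule.span ℂ _ at hx
    change y ∈ Submodule.span ℂ _ at hy
    change _ ∈ Submodule.span ℂ _
    have hzd : ∀ k, ⁅z, d k⁆ = 0 := fun k => by rw [← lie_skew, lie_d_z, neg_zero]
    induction hx, hy using Submodule.span_induction₂ with
    | mem_mem x y hx hy =>
      rcases hx with rfl | ⟨j, rfl⟩ <;> rcases hy with rfl | ⟨k, rfl⟩
      · rw [lie_self]; exact zero_mem _
      · rw [hzd]; exact zero_mem _
      · rw [lie_d_z]; exact zero_mem _
      · rw [lie_d_d]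
        refine add_mem (Submodule.smul_mem _ _ (Submodule.subset_span (Or.inr ⟨j + k, ?_⟩)))
          (Submodule.smul_mem _ _ (Submodule.subset_span (Or.inl rfl)))
        push_cast; rfl
    | zero_left y hy => rw [zero_lie]; exact zero_mem _
    | zero_right x hx => rw [lie_zero]; exact zero_mem _
    | add_left x y w _ _ _ h1 h2 => rw [add_lie]; exact add_mem h1 h2
    | add_right x y w _ _ _ h1 h2 => rw [lie_add]; exact add_mem h1 h2
    | smul_left c x y _ _ h => rw [smul_lie]; exact Submodule.smul_mem _ _ h
    | smul_right c x y _ _ h => rw [lie_smul]; exact Submodule.smul_mem _ _ h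

theorem d_mem_nMinus (k : ℕ) : d (-((k : ℤ) + 1)) ∈ nMinus := Submodule.subset_span ⟨k, rfl⟩

theorem d_mem_bPlus (k : ℕ) : d k ∈ bPlus := Submodule.subset_span (Or.inr ⟨k, rfl⟩)

theorem z_mem_bPlus : z ∈ bPlus := Submodule.subset_span (Or.inl rfl)

/-- The coefficient of `d_k`. -/
def dCoeff (k : ℤ) : Virasoro →ₗ[ℂ] ℂ := Finsupp.lapply k ∘ₗ LinearMap.fst ℂ (ℤ →₀ ℂ) ℂ

/-- The coefficient of `z`. -/
def zCoeff : Virasoro →ₗ[ℂ] ℂ := LinearMap.snd ℂ (ℤ →₀ ℂ) ℂ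

theorem dCoeff_d (k j : ℤ) : dCoeff k (d j) = if j = k then 1 else 0 := by
  change (Finsupp.single j (1 : ℂ)) k = _
  rw [Finsupp.single_apply]

theorem dCoeff_z (k : ℤ) : dCoeff k z = 0 := rfl

theorem zCoeff_d (j : ℤ) : zCoeff (d j) = 0 := rfl

theorem zCoeff_z : zCoeff z = 1 := rfl

theorem isCompl_nMinus_bPlus : IsCompl nMinus.toSubmodule bPlus.toSubmodule := by
  constructor
  · refine Submodule.disjoint_def.mpr fun x hx hx' => ?_
    have h1 : ∀ k : ℤ, 0 ≤ k → dCoeff k x = 0 := by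
      intro k hk
      have : nMinus.toSubmodule ≤ LinearMap.ker (dCoeff k) := by
        refine Submodule.span_le.mpr ?_
        rintro _ ⟨j, rfl⟩
        change dCoeff k (d _) = 0
        rw [dCoeff_d, if_neg (by omega)]
      exact this hx
    have h2 : zCoeff x = 0 := by
      have : nMinus.toSubmodule ≤ LinearMap.ker zCoeff := by
        refine Submodule.span_le.mpr ?_
        rintro _ ⟨j, rfl⟩
        exact zCoeff_d _
      exact this hx
    have h3 : ∀ k : ℤ, k < 0 → dCoeff k x = 0 := by
      intro k hk
      have : bPlus.toSubmodule ≤ LinearMap.ker (dCoeff k) := by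
        refine Submodule.span_le.mpr ?_
        rintro _ (rfl | ⟨j, rfl⟩)
        · exact dCoeff_z k
        · change dCoeff k (d _) = 0
          rw [dCoeff_d, if_neg (by omega)]
      exact this hx'
    refine Prod.ext (Finsupp.ext fun k => ?_) h2
    exact (lt_or_ge k 0).elim (h3 k) (h1 k)
  · rw [codisjoint_iff, eq_top_iff, ← span_eq_top, Submodule.span_le]
    rintro x (⟨k, rfl⟩ | rfl)
    · rcases lt_or_ge k 0 with hk | hk
      · obtain ⟨j, rfl⟩ : ∃ j : ℕ, k = -((j : ℤ) + 1) := ⟨(-k - 1).toNat, by omega⟩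
        exact Submodule.mem_sup_left (d_mem_nMinus j)
      · obtain ⟨j, rfl⟩ := Int.eq_ofNat_of_zero_le hk
        exact Submodule.mem_sup_right (d_mem_bPlus j)
    · exact Submodule.mem_sup_right z_mem_bPlus

theorem exists_add_of_triangular (y : Virasoro) : ∃ (x : nMinus) (b : bPlus), y = x + b := by
  obtain ⟨x, hx, b, hb, h⟩ := Submodule.mem_sup.mp
    (isCompl_nMinus_bPlus.sup_eq_top ▸ Submodule.mem_top :
      y ∈ nMinus.toSubmodule ⊔ bPlus.toSubmodule)
  exact ⟨⟨x, hx⟩, ⟨b, hb⟩, h.symm⟩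

/-- The enveloping algebra of `span {d_k | k < 0}`. -/
abbrev UMinus : Type := UniversalEnvelopingAlgebra ℂ nMinus

/-- The algebra map from the enveloping algebra of `span {d_k | k < 0}`. -/
def emb : UMinus →ₐ[ℂ] UVir :=
  UniversalEnvelopingAlgebra.lift ℂ
    ((UniversalEnvelopingAlgebra.ι ℂ : Virasoro →ₗ⁅ℂ⁆ UVir).comp nMinus.incl)

theorem emb_ι (x : nMinus) : emb (UniversalEnvelopingAlgebra.ι ℂ x) = toU x :=
  UniversalEnvelopingAlgebra.lift_ι_apply ℂ _ x

/-- The map `U(𝔫⁻) ⊗ V → M`, `a ⊗ v ↦ a v`, for a subspace `V` of `M`. -/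
def mulMap (V : Submodule ℂ M) : UMinus ⊗[ℂ] V →ₗ[ℂ] M :=
  TensorProduct.lift
    { toFun := fun a => act M (emb a) ∘ₗ V.subtype
      map_add' := fun a b => by ext v; simp [act, add_smul]
      map_smul' := fun c a => by ext v; simp [act] }

theorem mulMap_tmul (V : Submodule ℂ M) (a : UMinus) (v : V) :
    mulMap V (a ⊗ₜ v) = emb a • (v : M) := rfl

theorem mulMap_smul (V : Submodule ℂ M) (a : UMinus) (t : UMinus ⊗[ℂ] V) :
    mulMap V (a • t) = emb a • mulMap V t := by
  induction t with
  | zero => simp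
  | add s t hs ht => simp only [smul_add, map_add, hs, ht]
  | tmul b v => rw [TensorProduct.smul_tmul', mulMap_tmul, mulMap_tmul, smul_eq_mul, map_mul,
      mul_smul]

/-- A subspace is stable under `𝔟⁺` as soon as it is stable under `z` and the `d_k`, `k ≥ 0`. -/
theorem bPlus_smul_mem {S : Submodule ℂ M} (hd : ∀ k : ℕ, ∀ m ∈ S, toU (d k) • m ∈ S)
    (hz : ∀ m ∈ S, toU z • m ∈ S) (b : bPlus) {m : M} (hm : m ∈ S) : toU b • m ∈ S := by
  obtain ⟨b, hb⟩ := b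
  change b ∈ Submodule.span ℂ _ at hb
  change toU b • m ∈ S
  induction hb using Submodule.span_induction with
  | mem x hx =>
    rcases hx with rfl | ⟨k, rfl⟩
    · exact hz m hm
    · exact hd k m hm
  | zero => rw [toU, map_zero, zero_smul]; exact zero_mem _
  | add x y _ _ hx hy => rw [toU, map_add, add_smul]; exact add_mem hx hy
  | smul c x _ hx => rw [toU, map_smul, smul_assoc]; exact Submodule.smul_mem _ _ hx

theorem emb_smul_mem {S : Submodule ℂ M} (hd : ∀ k : ℕ, ∀ m ∈ S, toU (d (-((k : ℤ) + 1))) • m ∈ S)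
    (a : UMinus) {m : M} (hm : m ∈ S) : emb a • m ∈ S := by
  have hx : ∀ x : nMinus, ∀ m ∈ S, toU x • m ∈ S := by
    rintro ⟨x, hx⟩ m hm
    change x ∈ Submodule.span ℂ _ at hx
    change toU x • m ∈ S
    induction hx using Submodule.span_induction with
    | mem x hx =>
      obtain ⟨k, rfl⟩ := hx
      exact hd k m hm
    | zero => rw [toU, map_zero, zero_smul]; exact zero_mem _
    | add x y _ _ hx hy => rw [toU, map_add, add_smul]; exact add_mem hx hy
    | smul c x _ hx => rw [toU, map_smul, smul_assoc]; exact Submodule.smul_mem _ _ hx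
  induction a using uea_induction with
  | one => rwa [map_one, one_smul]
  | add a b ha hb => rw [map_add, add_smul]; exact add_mem ha hb
  | smul c a ha => rw [map_smul, smul_assoc]; exact S.smul_mem c ha
  | mul x a ha => rw [map_mul, mul_smul, emb_ι]; exact hx x _ ha

/-- If `V` is stable under `𝔟⁺`, then `U(𝔫⁻) V` is a submodule. -/
theorem smul_mem_range_mulMap {V : Submodule ℂ M} (hV : ∀ b : bPlus, ∀ v ∈ V, toU b • v ∈ V)
    (u : UVir) {m : M} (hm : m ∈ LinearMap.range (mulMap V)) :
    u • m ∈ LinearMap.range (mulMap V) := by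
  refine uea_smul_mem _ ?_ u hm
  rintro y _ ⟨t, rfl⟩
  change toU y • _ ∈ _
  induction t using ind_induction generalizing y with
  | one v =>
    obtain ⟨x, b, rfl⟩ := exists_add_of_triangular y
    rw [toU, map_add, add_smul, mulMap_tmul, map_one, one_smul]
    refine add_mem ⟨UniversalEnvelopingAlgebra.ι ℂ x ⊗ₜ v, ?_⟩ ⟨1 ⊗ₜ ⟨_, hV b v v.2⟩, ?_⟩
    · rw [mulMap_tmul, emb_ι]
    · rw [mulMap_tmul, map_one, one_smul]
  | add s t hs ht => rw [map_add, smul_add]; exact add_mem (hs y) (ht y)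
  | smul c t ht => rw [map_smul, smul_comm]; exact Submodule.smul_mem _ c (ht y)
  | mul x t ht =>
    rw [mulMap_smul, emb_ι, lie_smul_eq]
    refine add_mem ?_ (ht _)
    obtain ⟨s, hs⟩ := ht y
    exact ⟨UniversalEnvelopingAlgebra.ι ℂ x • s, by rw [mulMap_smul, emb_ι, hs]⟩

/-- If `V` is stable under `𝔟⁺`, then the submodule generated by `V` is `U(𝔫⁻) V`. -/
theorem span_le_range_mulMap {V : Submodule ℂ M} (hV : ∀ b : bPlus, ∀ v ∈ V, toU b • v ∈ V)
    {m : M} (hm : m ∈ Submodule.span UVir (V : Set M)) : m ∈ LinearMap.range (mulMap V) := by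
  induction hm using Submodule.span_induction with
  | mem x hx => exact ⟨1 ⊗ₜ ⟨x, hx⟩, by rw [mulMap_tmul, map_one, one_smul]⟩
  | zero => exact zero_mem _
  | add x y _ _ hx hy => exact add_mem hx hy
  | smul u x _ hx => exact smul_mem_range_mulMap hV u hx

theorem range_mulMap_le_span (V : Submodule ℂ M) (t : UMinus ⊗[ℂ] V) :
    mulMap V t ∈ Submodule.span UVir (V : Set M) := by
  induction t with
  | zero => rw [map_zero]; exact zero_mem _
  | add s t hs ht => rw [map_add]; exact add_mem hs ht
  | tmul a v => exact Submodule.smul_mem _ _ (Submodule.subset_span v.2)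

/-- A subspace that contains a `𝔟⁺`-stable subspace `V` and is stable under the `d_k`, `k < 0`,
contains the submodule generated by `V`. -/
theorem mem_of_generated {V S : Submodule ℂ M} (hV : ∀ b : bPlus, ∀ v ∈ V, toU b • v ∈ V)
    (hVS : V ≤ S) (hd : ∀ k : ℕ, ∀ m ∈ S, toU (d (-((k : ℤ) + 1))) • m ∈ S)
    {m : M} (hm : m ∈ Submodule.span UVir (V : Set M)) : m ∈ S := by
  obtain ⟨t, rfl⟩ := span_le_range_mulMap hV hm
  induction t with
  | zero => rw [map_zero]; exact zero_mem _
  | add s t hs ht =>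
    rw [map_add]
    exact add_mem (hs (range_mulMap_le_span V s)) (ht (range_mulMap_le_span V t))
  | tmul a v => exact emb_smul_mem hd a (hVS v.2)

end

section

/-! ### Representations as modules over the enveloping algebra -/

section Rep

variable {V : Type} [AddCommGroup V] [Module ℂ V] (ρ : Virasoro →ₗ⁅ℂ⁆ Module.End ℂ V)

/-- A representation of the Virasoro algebra, as a module over the enveloping algebra. -/
def repModule : ModuleCat.{0} UVir :=
  letI : Module UVir V :=
    Module.compHom V (UniversalEnvelopingAlgebra.lift ℂ ρ).toRingHom
  ModuleCat.of UVir V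

/-- The underlying vector space of `repModule ρ` is the space of the representation. -/
def repEquiv : V ≃ₗ[ℂ] repModule ρ where
  toFun v := v
  invFun v := v
  map_add' _ _ := rfl
  map_smul' c v := by
    change c • v = (UniversalEnvelopingAlgebra.lift ℂ ρ (algebraMap ℂ UVir c)) v
    rw [AlgHom.commutes, Module.algebraMap_end_apply]
  left_inv _ := rfl
  right_inv _ := rfl

theorem toU_smul_repEquiv (x : Virasoro) (v : V) :
    toU x • repEquiv ρ v = repEquiv ρ (ρ x v) := by
  change UniversalEnvelopingAlgebra.lift ℂ ρ (UniversalEnvelopingAlgebra.ι ℂ x) v = ρ x v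
  rw [UniversalEnvelopingAlgebra.lift_ι_apply]

end Rep

section Ind

variable {W : Type} [AddCommGroup W] [Module ℂ W] (τ : bPlus →ₗ⁅ℂ⁆ Module.End ℂ W)

/-- The module induced from a representation of `𝔟⁺`; its underlying space is `U(𝔫⁻) ⊗ W`. -/
def indModule : ModuleCat.{0} UVir := repModule (indRep isCompl_nMinus_bPlus τ)

/-- The underlying space of the induced module. -/
def indEquiv : UMinus ⊗[ℂ] W ≃ₗ[ℂ] indModule τ := repEquiv _

theorem toU_smul_indEquiv (x : Virasoro) (t : UMinus ⊗[ℂ] W) :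
    toU x • indEquiv τ t = indEquiv τ (indOp isCompl_nMinus_bPlus τ x t) :=
  toU_smul_repEquiv _ x t

theorem toU_smul_indEquiv_one (b : bPlus) (w : W) :
    toU b • indEquiv τ (1 ⊗ₜ w) = indEquiv τ (1 ⊗ₜ τ b w) := by
  rw [toU_smul_indEquiv, indOp_right]

theorem emb_smul_indEquiv (a : UMinus) (t : UMinus ⊗[ℂ] W) :
    emb a • indEquiv τ t = indEquiv τ (a • t) := by
  induction a using uea_induction with
  | one => rw [map_one, one_smul, one_smul]
  | add a b ha hb => rw [map_add, add_smul, ha, hb, add_smul, map_add]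
  | smul c a ha =>
    rw [map_smul, smul_assoc, ha, smul_assoc]
    exact ((indEquiv τ).map_smul c _).symm
  | mul x a ha =>
    rw [map_mul, mul_smul, ha, emb_ι, toU_smul_indEquiv, indOp_left, mul_smul]

theorem span_indEquiv_one :
    Submodule.span UVir (Set.range fun w : W => indEquiv τ (1 ⊗ₜ w)) = ⊤ := by
  refine eq_top_iff.mpr fun x _ => ?_
  obtain ⟨t, rfl⟩ := (indEquiv τ).surjective x
  induction t with
  | zero => rw [map_zero]; exact zero_mem _
  | add s t hs ht => rw [map_add]; exact add_mem (hs trivial) (ht trivial)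
  | tmul a w =>
    have : a ⊗ₜ[ℂ] w = a • ((1 : UMinus) ⊗ₜ[ℂ] w) := by
      rw [TensorProduct.smul_tmul', smul_eq_mul, mul_one]
    rw [this, ← emb_smul_indEquiv]
    exact Submodule.smul_mem _ _ (Submodule.subset_span ⟨w, rfl⟩)

end Ind

/-! ### Verma modules -/

/-- The homomorphism from a Verma module determined by a singular vector. -/
def vermaLift {M : ModuleCat.{0} UVir} {γ : Weight} {v : M} (hv : v ∈ weightSpace M γ)
    (hs : ∀ k : ℤ, 0 < k → toU (d k) • v = 0) : verma γ →ₗ[UVir] M :=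
  (vermaIdeal γ).liftQ (LinearMap.toSpanSingleton UVir M v) (by
    refine Submodule.span_le.mpr ?_
    rintro u (⟨k, hk, rfl⟩ | ⟨h, rfl⟩)
    · exact hs k hk
    · change (toU h - algebraMap ℂ UVir (γ h)) • v = 0
      have h1 : toU h • v = γ h • v := hv h
      rw [sub_smul, algebraMap_smul, h1, sub_self])

theorem vermaLift_gen {M : ModuleCat.{0} UVir} {γ : Weight} {v : M} (hv : v ∈ weightSpace M γ)
    (hs : ∀ k : ℤ, 0 < k → toU (d k) • v = 0) : vermaLift hv hs (vermaGen γ) = v := by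
  change (1 : UVir) • v = v
  exact one_smul _ v

/-- The projection of the Virasoro algebra to its Cartan subalgebra. -/
def toCartan : Virasoro →ₗ[ℂ] cartan :=
  (dCoeff 0).smulRight ⟨d 0, d_zero_mem_cartan⟩ + zCoeff.smulRight ⟨z, z_mem_cartan⟩

theorem toCartan_d {k : ℤ} (hk : k ≠ 0) : toCartan (d k) = 0 := by
  simp [toCartan, dCoeff_d, zCoeff_d, hk]

theorem toCartan_d_zero : toCartan (d 0) = ⟨d 0, d_zero_mem_cartan⟩ := by
  simp [toCartan, dCoeff_d, zCoeff_d]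

theorem toCartan_z : toCartan z = ⟨z, z_mem_cartan⟩ := by
  simp [toCartan, dCoeff_z, zCoeff_z]

theorem toCartan_lie (x y : bPlus) : toCartan ⁅(x : Virasoro), (y : Virasoro)⁆ = 0 := by
  obtain ⟨x, hx⟩ := x
  obtain ⟨y, hy⟩ := y
  change x ∈ Submodule.span ℂ _ at hx
  change y ∈ Submodule.span ℂ _ at hy
  change toCartan ⁅x, y⁆ = 0
  induction hx, hy using Submodule.span_induction₂ with
  | mem_mem x y hx hy =>
    have hzd : ∀ k, ⁅z, d k⁆ = 0 := fun k => by rw [← lie_skew, lie_d_z, neg_zero]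
    rcases hx with rfl | ⟨j, rfl⟩ <;> rcases hy with rfl | ⟨k, rfl⟩
    · rw [lie_self, map_zero]
    · rw [hzd, map_zero]
    · rw [lie_d_z, map_zero]
    · rw [lie_d_d, map_add, map_smul, map_smul]
      by_cases h : (j : ℤ) + k = 0
      · obtain rfl : j = 0 := by omega
        obtain rfl : k = 0 := by omega
        simp
      · rw [toCartan_d h, if_neg (by omega), smul_zero, zero_smul, add_zero]
  | zero_left y hy => rw [zero_lie, map_zero]
  | zero_right x hx => rw [lie_zero, map_zero]
  | add_left x y w _ _ _ h1 h2 => rw [add_lie, map_add, h1, h2, add_zero]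
  | add_right x y w _ _ _ h1 h2 => rw [lie_add, map_add, h1, h2, add_zero]
  | smul_left c x y _ _ h => rw [smul_lie, map_smul, h, smul_zero]
  | smul_right c x y _ _ h => rw [lie_smul, map_smul, h, smul_zero]

/-- The one-dimensional representation of `𝔟⁺` attached to a weight. -/
def charRep (γ : Weight) : bPlus →ₗ⁅ℂ⁆ Module.End ℂ ℂ where
  toFun b := γ (toCartan b) • LinearMap.id
  map_add' x y := by simp [add_smul]
  map_smul' c x := by simp [mul_smul]
  map_lie' {x y} := by
    rw [LieSubalgebra.coe_bracket, toCartan_lie, map_zero, zero_smul,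
      LieRing.of_associative_ring_bracket]
    ext
    simp [mul_comm]

theorem charRep_apply (γ : Weight) (b : bPlus) (c : ℂ) :
    charRep γ b c = γ (toCartan b) * c := rfl

theorem vermaGen_ne_zero (γ : Weight) : vermaGen γ ≠ 0 := by
  let v := indEquiv (charRep γ) (1 ⊗ₜ 1)
  have hsmul : ∀ b : bPlus, toU b • v = γ (toCartan b) • v := by
    intro b
    rw [toU_smul_indEquiv_one, charRep_apply, ← smul_eq_mul, TensorProduct.tmul_smul, map_smul]
  have hv : v ∈ weightSpace _ γ := by
    refine mem_weightSpace_iff.mpr ⟨?_, ?_⟩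
    · have := hsmul ⟨d 0, d_mem_bPlus 0⟩
      rwa [toCartan_d_zero] at this
    · have := hsmul ⟨z, z_mem_bPlus⟩
      rwa [toCartan_z] at this
  have hs : ∀ k : ℤ, 0 < k → toU (d k) • v = 0 := by
    intro k hk
    obtain ⟨j, rfl⟩ := Int.eq_ofNat_of_zero_le hk.le
    have := hsmul ⟨d j, d_mem_bPlus j⟩
    rwa [toCartan_d hk.ne', map_zero, zero_smul] at this
  intro h0
  have h1 := vermaLift_gen hv hs
  rw [h0, map_zero] at h1
  have h2 : ((1 : UMinus) ⊗ₜ[ℂ] (1 : ℂ)) = 0 := (indEquiv (charRep γ)).injective (by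
    rw [map_zero]; exact h1.symm)
  -- the augmentation `U(𝔫⁻) → ℂ` sends `1` to `1`
  have h3 := congrArg (TensorProduct.lift ((LinearMap.mul ℂ ℂ).comp
    (UniversalEnvelopingAlgebra.lift ℂ (0 : nMinus →ₗ⁅ℂ⁆ ℂ)).toLinearMap)) h2
  simp at h3

/-- A Verma module is generated over `U(𝔫⁻)` by its highest weight vector. -/
theorem exists_emb_smul_vermaGen (γ : Weight) (m : verma γ) :
    ∃ a : UMinus, m = emb a • vermaGen γ := by
  let V : Submodule ℂ (verma γ) := Submodule.span ℂ {vermaGen γ}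
  have hV : ∀ b : bPlus, ∀ v ∈ V, toU b • v ∈ V := by
    intro b v hv
    refine bPlus_smul_mem (S := V) ?_ ?_ b hv
    · intro k m hm
      obtain ⟨c, rfl⟩ := Submodule.mem_span_singleton.mp hm
      rw [smul_comm]
      refine Submodule.smul_mem _ _ ?_
      rcases Nat.eq_zero_or_pos k with rfl | hk
      · have : toU (d 0) • vermaGen γ = _ := (mem_weightSpace_iff.mp (vermaGen_mem γ)).1
        rw [Nat.cast_zero, this]
        exact Submodule.smul_mem _ _ (Submodule.mem_span_singleton_self _)
      · rw [d_smul_vermaGen γ (by exact_mod_cast hk)]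
        exact zero_mem _
    · intro m hm
      obtain ⟨c, rfl⟩ := Submodule.mem_span_singleton.mp hm
      rw [smul_comm, (mem_weightSpace_iff.mp (vermaGen_mem γ)).2]
      exact Submodule.smul_mem _ _ (Submodule.smul_mem _ _ (Submodule.mem_span_singleton_self _))
  obtain ⟨u, rfl⟩ := exists_smul_vermaGen γ m
  obtain ⟨t, ht⟩ := span_le_range_mulMap hV (m := u • vermaGen γ)
    (Submodule.smul_mem _ _ (Submodule.subset_span (Submodule.mem_span_singleton_self _)))
  rw [← ht]
  clear ht
  induction t with
  | zero => exact ⟨0, by simp⟩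
  | add s t hs ht =>
    obtain ⟨a, ha⟩ := hs
    obtain ⟨b, hb⟩ := ht
    exact ⟨a + b, by rw [map_add, ha, hb, map_add, add_smul]⟩
  | tmul a v =>
    obtain ⟨v, hv⟩ := v
    obtain ⟨c, rfl⟩ := Submodule.mem_span_singleton.mp hv
    exact ⟨c • a, by rw [mulMap_tmul, map_smul, smul_assoc, smul_comm]⟩

variable {μ : Weight}

theorem vermaGen_mem_grd (n : ℤ) :
    vermaGen (μ + intWeight n) ∈ grd μ (verma (μ + intWeight n)) n := vermaGen_mem _

/-- In `M(μ + n)`, the degrees are at least `n`, and degree `n` is spanned by the highest weight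
vector. -/
theorem mem_verma (n : ℤ) (m : verma (μ + intWeight n)) :
    m ∈ Submodule.span ℂ {vermaGen (μ + intWeight n)} ⊔
      ⨆ k : ℕ, grd μ (verma (μ + intWeight n)) (n + k + 1) := by
  obtain ⟨a, rfl⟩ := exists_emb_smul_vermaGen _ m
  refine emb_smul_mem ?_ a (Submodule.mem_sup_left (Submodule.mem_span_singleton_self _))
  intro k m hm
  refine Submodule.mem_sup_right ?_
  obtain ⟨x, hx, y, hy, rfl⟩ := Submodule.mem_sup.mp hm
  rw [smul_add]
  refine add_mem ?_ ?_
  · obtain ⟨c, rfl⟩ := Submodule.mem_span_singleton.mp hx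
    rw [smul_comm]
    refine Submodule.smul_mem _ _ (Submodule.mem_iSup_of_mem k ?_)
    have := d_smul_mem_grd (-((k : ℤ) + 1)) (vermaGen_mem_grd (μ := μ) n)
    rwa [show n - -((k : ℤ) + 1) = n + k + 1 by ring] at this
  · clear hm
    induction hy using Submodule.iSup_induction' with
    | mem j y hy =>
      refine Submodule.mem_iSup_of_mem (j + k + 1) ?_
      have := d_smul_mem_grd (-((k : ℤ) + 1)) hy
      rwa [show n + j + 1 - -((k : ℤ) + 1) = n + ((j + k + 1 : ℕ) : ℤ) + 1 by
        push_cast; ring] at this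
    | zero => rw [smul_zero]; exact zero_mem _
    | add x y _ _ hx hy => rw [smul_add]; exact add_mem hx hy

theorem isBdd_verma (μ : Weight) {n : ℤ} (hn : 0 ≤ n) : IsBdd μ (verma (μ + intWeight n)) := by
  refine eq_top_iff.mpr fun m _ => ?_
  obtain ⟨j, rfl⟩ := Int.eq_ofNat_of_zero_le hn
  refine (sup_le ?_ (iSup_le fun k => ?_) :
    Submodule.span ℂ {vermaGen (μ + intWeight j)} ⊔ _ ≤ _) (mem_verma (μ := μ) (j : ℤ) m)
  · rw [Submodule.span_singleton_le_iff_mem]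
    exact Submodule.mem_iSup_of_mem j (vermaGen_mem_grd (j : ℤ))
  · exact le_iSup_of_le (j + k + 1) (by push_cast; rfl)

theorem comp_verma_mem {n : ℤ} (h : IsBdd μ (verma (μ + intWeight n)))
    (m : verma (μ + intWeight n)) : comp h n m ∈ Submodule.span ℂ {vermaGen (μ + intWeight n)} := by
  refine (sup_le ?_ (iSup_le fun k => ?_) : Submodule.span ℂ {vermaGen (μ + intWeight n)} ⊔ _ ≤
    (Submodule.span ℂ {vermaGen (μ + intWeight n)}).comap (comp h n)) (mem_verma (μ := μ) n m)
  · rw [Submodule.span_singleton_le_iff_mem, Submodule.mem_comap,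
      comp_of_mem h (vermaGen_mem_grd n)]
    exact Submodule.mem_span_singleton_self _
  · intro x hx
    rw [Submodule.mem_comap, comp_of_ne h (by omega) hx]
    exact zero_mem _

theorem comp_verma_eq_zero {n k : ℤ} (hk : k < n) (h : IsBdd μ (verma (μ + intWeight n)))
    (m : verma (μ + intWeight n)) : comp h k m = 0 := by
  refine (sup_le ?_ (iSup_le fun j => ?_) : Submodule.span ℂ {vermaGen (μ + intWeight n)} ⊔ _ ≤
    LinearMap.ker (comp h k)) (mem_verma (μ := μ) n m)
  · rw [Submodule.span_singleton_le_iff_mem]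
    exact comp_of_ne h (by omega) (vermaGen_mem_grd n)
  · exact fun x hx => comp_of_ne h (by omega) hx

/-! ### The simple quotients -/

theorem exists_eq_add_intWeight (γ : Weight) :
    ∃ (μ : Weight) (n : ℤ), 0 ≤ n ∧ γ = μ + intWeight n :=
  ⟨γ, 0, le_rfl, by rw [intWeight_zero, add_zero]⟩

theorem eq_top_of_vermaGen_mem {γ : Weight} {S : Submodule UVir (verma γ)} (h : vermaGen γ ∈ S) :
    S = ⊤ := by
  refine eq_top_iff.mpr fun m _ => ?_
  obtain ⟨u, rfl⟩ := exists_smul_vermaGen γ m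
  exact S.smul_mem u h

theorem vermaGen_notMem_radical (γ : Weight) : vermaGen γ ∉ vermaRadical γ := by
  obtain ⟨μ, n, hn, rfl⟩ := exists_eq_add_intWeight γ
  have hB := isBdd_verma μ hn
  let K : Submodule UVir (verma (μ + intWeight n)) :=
    { carrier := {x | ∀ u : UVir, comp hB n (u • x) = 0}
      zero_mem' := fun u => by rw [smul_zero, map_zero]
      add_mem' := fun {x y} hx hy u => by rw [smul_add, map_add, hx u, hy u, add_zero]
      smul_mem' := fun c x hx u => by rw [← mul_smul]; exact hx _ }
  have hK : vermaRadical (μ + intWeight n) ≤ K := by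
    refine sSup_le fun S hS x hx u => ?_
    have h1 := comp_mem_submodule hB S (S.smul_mem u hx) n
    obtain ⟨c, hc⟩ := Submodule.mem_span_singleton.mp (comp_verma_mem hB (u • x))
    rw [← hc] at h1 ⊢
    by_cases hc0 : c = 0
    · rw [hc0, zero_smul]
    · refine absurd (eq_top_of_vermaGen_mem ?_) hS
      have h2 := (S.restrictScalars ℂ).smul_mem c⁻¹ h1
      rwa [smul_smul, inv_mul_cancel₀ hc0, one_smul] at h2
  intro h
  have h1 := hK h 1
  rw [one_smul, comp_of_mem hB (vermaGen_mem_grd n)] at h1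
  exact vermaGen_ne_zero _ h1

theorem le_vermaRadical {γ : Weight} {S : Submodule UVir (verma γ)} (h : S ≠ ⊤) :
    S ≤ vermaRadical γ := le_sSup h

/-- The highest weight vector of the simple module `L(γ)`. -/
def simpleGen (γ : Weight) : simple γ := (vermaRadical γ).mkQ (vermaGen γ)

/-- The projection `M(γ) → L(γ)`. -/
def toSimple (γ : Weight) : verma γ →ₗ[UVir] simple γ := (vermaRadical γ).mkQ

theorem toSimple_surjective (γ : Weight) : Function.Surjective (toSimple γ) :=
  Submodule.mkQ_surjective _

theorem simpleGen_ne_zero (γ : Weight) : simpleGen γ ≠ 0 := fun h =>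
  vermaGen_notMem_radical γ ((Submodule.Quotient.mk_eq_zero _).mp h)

theorem simpleGen_mem (γ : Weight) : simpleGen γ ∈ weightSpace (simple γ) γ :=
  map_mem_weightSpace (toSimple γ) (vermaGen_mem γ)

instance isSimpleModule_simple (γ : Weight) : IsSimpleModule UVir (simple γ) where
  exists_pair_ne := ⟨⊥, ⊤, fun h => simpleGen_ne_zero γ (by
    have : simpleGen γ ∈ (⊤ : Submodule UVir (simple γ)) := trivial
    rw [← h] at this
    exact this)⟩
  eq_bot_or_eq_top S := by
    by_cases h : S.comap (toSimple γ) = ⊤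
    · refine Or.inr (eq_top_iff.mpr fun x _ => ?_)
      obtain ⟨y, rfl⟩ := toSimple_surjective γ x
      have : y ∈ S.comap (toSimple γ) := h ▸ trivial
      exact this
    · refine Or.inl (eq_bot_iff.mpr fun x hx => ?_)
      obtain ⟨y, rfl⟩ := toSimple_surjective γ x
      have : y ∈ vermaRadical γ := le_vermaRadical h hx
      exact (Submodule.Quotient.mk_eq_zero _).mpr this

theorem surjective_of_ne_zero {γ : Weight} {X : Type} [AddCommGroup X] [Module UVir X]
    (f : X →ₗ[UVir] simple γ) {x : X} (hx : f x ≠ 0) : Function.Surjective f := by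
  rcases eq_bot_or_eq_top (LinearMap.range f) with h | h
  · exact absurd ((Submodule.mem_bot _).mp (h ▸ LinearMap.mem_range_self f x)) hx
  · exact LinearMap.range_eq_top.mp h

theorem isBdd_simple (μ : Weight) {n : ℤ} (hn : 0 ≤ n) : IsBdd μ (simple (μ + intWeight n)) :=
  (isBdd_verma μ hn).of_surjective _ (toSimple_surjective _)

theorem comp_simple_eq_zero {n k : ℤ} (hn : 0 ≤ n) (hk : k < n)
    (h : IsBdd μ (simple (μ + intWeight n))) (m : simple (μ + intWeight n)) : comp h k m = 0 := by
  obtain ⟨y, rfl⟩ := toSimple_surjective _ m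
  rw [← map_comp (isBdd_verma μ hn) h, comp_verma_eq_zero hk, map_zero]

/-- A module with a nonzero singular vector of weight `γ` has `L(γ)` as a subquotient. -/
theorem isSubquotient_of_singular {M : ModuleCat.{0} UVir} {γ : Weight} {v : M} (h0 : v ≠ 0)
    (hv : v ∈ weightSpace M γ) (hs : ∀ k : ℤ, 0 < k → toU (d k) • v = 0) :
    IsSubquotient (simple γ) M := by
  let f := vermaLift hv hs
  have hker : LinearMap.ker f ≤ vermaRadical γ := by
    refine le_vermaRadical fun h => h0 ?_
    have : vermaGen γ ∈ LinearMap.ker f := h ▸ trivial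
    rw [← vermaLift_gen hv hs]
    exact this
  refine ⟨LinearMap.range f, Submodule.factor hker ∘ₗ f.quotKerEquivRange.symm.toLinearMap, ?_⟩
  exact (Submodule.factor_surjective hker).comp f.quotKerEquivRange.symm.surjective

theorem IsSubquotient.of_injective {S M N : ModuleCat.{0} UVir} (f : M →ₗ[UVir] N)
    (hf : Function.Injective f) (h : IsSubquotient S M) : IsSubquotient S N := by
  obtain ⟨K, g, hg⟩ := h
  refine ⟨K.map f, g ∘ₗ (K.equivMapOfInjective f hf).symm.toLinearMap, ?_⟩
  exact hg.comp (K.equivMapOfInjective f hf).symm.surjective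

/-- A simple subquotient of an extension is a subquotient of the kernel or of the quotient. -/
theorem IsSubquotient.of_extension {γ : Weight} {M N : ModuleCat.{0} UVir} (f : M →ₗ[UVir] N)
    (h : IsSubquotient (simple γ) M) :
    IsSubquotient (simple γ) (ModuleCat.of UVir (LinearMap.ker f)) ∨
      IsSubquotient (simple γ) N := by
  obtain ⟨K, g, hg⟩ := h
  by_cases hK : ∀ x (hx : x ∈ K), f x = 0 → g ⟨x, hx⟩ = 0
  · right
    let f' : K →ₗ[UVir] N := f ∘ₗ K.subtype
    have hker : LinearMap.ker f' ≤ LinearMap.ker g := fun x hx => hK x x.2 hx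
    refine ⟨LinearMap.range f', (LinearMap.ker f').liftQ g hker ∘ₗ
      f'.quotKerEquivRange.symm.toLinearMap, ?_⟩
    intro y
    obtain ⟨x, rfl⟩ := hg y
    refine ⟨f'.quotKerEquivRange ((LinearMap.ker f').mkQ x), ?_⟩
    rw [LinearMap.comp_apply, LinearEquiv.coe_coe, LinearEquiv.symm_apply_apply]
    exact (LinearMap.ker f').liftQ_apply g x
  · left
    push Not at hK
    obtain ⟨x, hx, hfx, hgx⟩ := hK
    refine ⟨K.comap (LinearMap.ker f).subtype,
      g ∘ₗ (LinearMap.ker f).subtype.restrict (p := K.comap (LinearMap.ker f).subtype) (q := K)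
        fun y hy => hy, ?_⟩
    exact surjective_of_ne_zero _ (x := ⟨⟨x, hfx⟩, hx⟩) hgx

end

section

variable {μ : Weight} {M N : ModuleCat.{0} UVir}

/-! ### Finiteness of graded pieces -/

theorem finiteDimensional_of_le {S T : Submodule ℂ M} [FiniteDimensional ℂ T] (h : S ≤ T) :
    FiniteDimensional ℂ S :=
  Module.Finite.of_injective (Submodule.inclusion h) (Submodule.inclusion_injective h)

/-- In a bounded module generated by a finite dimensional subspace stable under `𝔟⁺`, the graded
pieces are finite dimensional. -/
theorem finiteDimensional_grd_of_generated (h : IsBdd μ M) {V : Submodule ℂ M}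
    [FiniteDimensional ℂ V] (hV : ∀ b : bPlus, ∀ v ∈ V, toU b • v ∈ V)
    (hgen : Submodule.span UVir (V : Set M) = ⊤) (n : ℕ) : FiniteDimensional ℂ (grd μ M n) := by
  let Y : ℤ → Submodule ℂ M := fun n => V.map (comp h n) ⊔
    ⨆ j : Fin n.toNat, (grd μ M (n - (j + 1))).map (act M (toU (d (-((j : ℤ) + 1)))))
  have hY : ∀ n, Y n ≤ grd μ M n := by
    refine fun n => sup_le ?_ (iSup_le fun j => ?_)
    · rintro _ ⟨v, _, rfl⟩
      exact comp_mem h n v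
    · rintro _ ⟨m, hm, rfl⟩
      have := d_smul_mem_grd (-((j : ℤ) + 1)) hm
      rwa [show n - ((j : ℤ) + 1) - -((j : ℤ) + 1) = n by ring] at this
  have htop : ∀ m : M, m ∈ ⨆ n, Y n := by
    intro m
    refine mem_of_generated hV ?_ ?_ (hgen ▸ Submodule.mem_top : m ∈ _)
    · exact fun v hv => mem_of_comp_mem h _ v fun n =>
        Submodule.mem_iSup_of_mem (n : ℤ) (Submodule.mem_sup_left ⟨v, hv, rfl⟩)
    · intro k m hm
      induction hm using Submodule.iSup_induction' with
      | mem n x hx =>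
        rcases lt_or_ge n 0 with hn | hn
        · rw [grd_eq_zero_of_neg h hn (hY n hx), smul_zero]
          exact zero_mem _
        · refine Submodule.mem_iSup_of_mem (n + (k + 1)) (Submodule.mem_sup_right
            (Submodule.mem_iSup_of_mem ⟨k, by omega⟩ ⟨x, ?_, rfl⟩))
          have := hY n hx
          rwa [show n = n + ((k : ℤ) + 1) - (k + 1) by ring] at this
      | zero => rw [smul_zero]; exact zero_mem _
      | add x y _ _ hx hy => rw [smul_add]; exact add_mem hx hy
  have hle : grd μ M n ≤ Y n := fun m hm => by
    rw [← comp_of_mem h hm]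
    exact comp_mem_of_mem_iSup h hY (htop m) n
  induction n using Nat.strong_induction_on with
  | _ n ih =>
    have : ∀ j : Fin (n : ℤ).toNat, FiniteDimensional ℂ
        ((grd μ M (n - (j + 1))).map (act M (toU (d (-((j : ℤ) + 1)))))) := by
      intro j
      have hj : (j : ℕ) < n := by have := j.2; omega
      obtain ⟨i, hi⟩ : ∃ i, n = j + 1 + i := Nat.exists_eq_add_of_le hj
      have h1 : FiniteDimensional ℂ (grd μ M i) := ih i (by omega) fun m hm => by
        rw [← comp_of_mem h hm]
        exact comp_mem_of_mem_iSup h hY (htop m) i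
      rw [show (n : ℤ) - ((j : ℤ) + 1) = i by omega]
      infer_instance
    have : FiniteDimensional ℂ (Y n) := by
      change FiniteDimensional ℂ ((V.map (comp h n) ⊔ _ : Submodule ℂ M))
      infer_instance
    exact finiteDimensional_of_le hle

/-- The span of the vectors `d_{k_1} ⋯ d_{k_r} v` with `k_i ≥ 1` and `∑ k_i = m`. -/
def posLevel (v : M) (m : ℕ) : Submodule ℂ M :=
  (if m = 0 then Submodule.span ℂ {v} else ⊥) ⊔
    ⨆ k : Fin m, (posLevel v k).map (act M (toU (d ((m : ℤ) - k))))
termination_by m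
decreasing_by exact k.2

theorem finiteDimensional_posLevel (v : M) (m : ℕ) : FiniteDimensional ℂ (posLevel v m) := by
  induction m using Nat.strong_induction_on with
  | _ m ih =>
    rw [posLevel]
    have : ∀ k : Fin m, FiniteDimensional ℂ
        ((posLevel v k).map (act M (toU (d ((m : ℤ) - k))))) := by
      intro k
      have := ih k k.2
      infer_instance
    by_cases hm : m = 0
    · rw [if_pos hm]; infer_instance
    · rw [if_neg hm]; infer_instance

theorem d_smul_mem_posLevel (v : M) (m : ℕ) (k : ℕ) {x : M} (hx : x ∈ posLevel v m) :
    toU (d ((k : ℤ) + 1)) • x ∈ posLevel v (m + k + 1) := by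
  rw [posLevel]
  refine Submodule.mem_sup_right (Submodule.mem_iSup_of_mem ⟨m, by omega⟩ ⟨x, hx, ?_⟩)
  change toU (d _) • x = _
  congr 3
  push_cast; ring

theorem mem_posLevel_zero (v : M) : v ∈ posLevel v 0 := by
  rw [posLevel]
  exact Submodule.mem_sup_left (by simp)

theorem posLevel_le {v : M} {p : ℕ → Submodule ℂ M} (h0 : v ∈ p 0)
    (hd : ∀ (m k : ℕ), ∀ x ∈ p m, toU (d ((k : ℤ) + 1)) • x ∈ p (m + k + 1)) (m : ℕ) :
    posLevel v m ≤ p m := by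
  induction m using Nat.strong_induction_on with
  | _ m ih =>
    rw [posLevel]
    refine sup_le ?_ (iSup_le fun k => ?_)
    · split_ifs with hm
      · subst hm
        rwa [Submodule.span_singleton_le_iff_mem]
      · exact bot_le
    · rintro _ ⟨x, hx, rfl⟩
      obtain ⟨k, hk⟩ := k
      obtain ⟨j, rfl⟩ : ∃ j, m = k + 1 + j := Nat.exists_eq_add_of_le hk
      have := hd k j x (ih k hk hx)
      rw [show k + j + 1 = k + 1 + j by ring] at this
      rwa [show (j : ℤ) + 1 = ((k + 1 + j : ℕ) : ℤ) - k by push_cast; ring] at this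

theorem posLevel_le_grd {v : M} {n : ℤ} (hv : v ∈ grd μ M n) (m : ℕ) :
    posLevel v m ≤ grd μ M (n - m) := by
  refine posLevel_le (p := fun m => grd μ M (n - m)) (by simpa using hv) ?_ m
  intro m k x hx
  have := d_smul_mem_grd ((k : ℤ) + 1) hx
  rwa [show n - m - ((k : ℤ) + 1) = n - ((m + k + 1 : ℕ) : ℤ) by push_cast; ring] at this

/-- The `𝔟⁺`-submodule generated by a weight vector `v`. -/
def posSpan (v : M) : Submodule ℂ M := ⨆ m, posLevel v m

theorem mem_posSpan (v : M) : v ∈ posSpan v := Submodule.mem_iSup_of_mem 0 (mem_posLevel_zero v)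

theorem posSpan_stable {v : M} {n : ℤ} (hv : v ∈ grd μ M n) (b : bPlus) {x : M}
    (hx : x ∈ posSpan v) : toU b • x ∈ posSpan v := by
  have hc : ∀ u : UVir, (∀ k : ℤ, ∀ x ∈ grd μ M k, ∃ c : ℂ, u • x = c • x) →
      ∀ x ∈ posSpan v, u • x ∈ posSpan v := by
    intro u hu x hx
    induction hx using Submodule.iSup_induction' with
    | mem m x hx =>
      obtain ⟨c, hc⟩ := hu _ x (posLevel_le_grd hv m hx)
      rw [hc]
      exact Submodule.smul_mem _ _ (Submodule.mem_iSup_of_mem m hx)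
    | zero => rw [smul_zero]; exact zero_mem _
    | add x y _ _ hx hy => rw [smul_add]; exact add_mem hx hy
  refine bPlus_smul_mem ?_ ?_ b hx
  · intro k x hx
    cases k with
    | zero => exact hc _ (fun k x hx => ⟨_, d_zero_smul_of_mem_grd hx⟩) x hx
    | succ k =>
      induction hx using Submodule.iSup_induction' with
      | mem m x hx => exact Submodule.mem_iSup_of_mem _ (d_smul_mem_posLevel v m k hx)
      | zero => rw [smul_zero]; exact zero_mem _
      | add x y _ _ hx hy => rw [smul_add]; exact add_mem hx hy
  · exact hc _ fun k x hx => z_smul_of_mem_grd hx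

theorem finiteDimensional_posSpan (h : IsBdd μ M) {v : M} {n : ℕ} (hv : v ∈ grd μ M n) :
    FiniteDimensional ℂ (posSpan v) := by
  have : ∀ m : Fin (n + 1), FiniteDimensional ℂ (posLevel v m) := fun m =>
    finiteDimensional_posLevel v m
  refine finiteDimensional_of_le (T := ⨆ m : Fin (n + 1), posLevel v m) (iSup_le fun m => ?_)
  rcases lt_or_ge m (n + 1) with hm | hm
  · exact le_iSup_of_le ⟨m, hm⟩ le_rfl
  · intro x hx
    rw [grd_eq_zero_of_neg h (by omega) (posLevel_le_grd hv m hx)]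
    exact zero_mem _

/-! ### The module corepresenting a weight space on bounded weight modules -/

/-- The left ideal annihilating all vectors of degree `n` in all bounded weight modules. -/
def projIdeal (μ : Weight) (n : ℤ) : Submodule UVir UVir where
  carrier := {u | ∀ M : ModuleCat.{0} UVir, IsBdd μ M → ∀ v ∈ grd μ M n, u • v = 0}
  zero_mem' M _ v _ := zero_smul _ v
  add_mem' ha hb M hM v hv := by rw [add_smul, ha M hM v hv, hb M hM v hv, add_zero]
  smul_mem' c a ha M hM v hv := by rw [smul_eq_mul, mul_smul, ha M hM v hv, smul_zero]

/-- The bounded weight module corepresenting `M ↦ M^{μ + n}` on bounded weight modules. -/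
def bigProj (μ : Weight) (n : ℤ) : ModuleCat.{0} UVir := ModuleCat.of UVir (UVir ⧸ projIdeal μ n)

/-- The universal vector of degree `n`. -/
def projGen (μ : Weight) (n : ℤ) : bigProj μ n := (projIdeal μ n).mkQ 1

theorem exists_smul_projGen {n : ℤ} (x : bigProj μ n) : ∃ u : UVir, x = u • projGen μ n := by
  obtain ⟨u, rfl⟩ := (projIdeal μ n).mkQ_surjective x
  refine ⟨u, ?_⟩
  rw [projGen]
  refine Eq.trans ?_ (map_smul (projIdeal μ n).mkQ u 1)
  rw [smul_eq_mul, mul_one]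

theorem smul_projGen_eq_zero {n : ℤ} {u : UVir} (hu : u ∈ projIdeal μ n) :
    u • projGen μ n = 0 := by
  refine Eq.trans (map_smul (projIdeal μ n).mkQ u 1).symm ?_
  rw [smul_eq_mul, mul_one]
  exact (Submodule.Quotient.mk_eq_zero _).mpr hu

theorem projGen_mem (μ : Weight) (n : ℤ) : projGen μ n ∈ grd μ (bigProj μ n) n := by
  intro h
  have : toU h - algebraMap ℂ UVir ((μ + intWeight n) h) ∈ projIdeal μ n := by
    intro M _ v hv
    have h1 : toU h • v = (μ + intWeight n) h • v := hv h
    rw [sub_smul, h1, algebraMap_smul, sub_self]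
  have h2 := smul_projGen_eq_zero this
  rwa [sub_smul, algebraMap_smul, sub_eq_zero] at h2

/-- The homomorphism from `bigProj μ n` determined by a vector of degree `n`. -/
def projLift (hM : IsBdd μ M) {n : ℤ} {v : M} (hv : v ∈ grd μ M n) : bigProj μ n →ₗ[UVir] M :=
  (projIdeal μ n).liftQ (LinearMap.toSpanSingleton UVir M v) fun _ hu => hu M hM v hv

theorem projLift_gen (hM : IsBdd μ M) {n : ℤ} {v : M} (hv : v ∈ grd μ M n) :
    projLift hM hv (projGen μ n) = v := by
  change (1 : UVir) • v = v
  exact one_smul _ v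

theorem bigProj_hom_ext {n : ℤ} {f g : bigProj μ n →ₗ[UVir] M}
    (h : f (projGen μ n) = g (projGen μ n)) : f = g := by
  refine LinearMap.ext fun x => ?_
  obtain ⟨u, rfl⟩ := exists_smul_projGen x
  rw [map_smul, map_smul, h]

theorem isBdd_bigProj (μ : Weight) (n : ℤ) : IsBdd μ (bigProj μ n) := by
  refine eq_top_iff.mpr fun x _ => ?_
  obtain ⟨u, rfl⟩ := exists_smul_projGen x
  have h1 : u • projGen μ n ∈ ⨆ k : ℤ, grd μ (bigProj μ n) k := by
    refine smul_mem_of_forall _ ?_ ?_ u (Submodule.mem_iSup_of_mem n (projGen_mem μ n))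
    · intro k m hm
      induction hm using Submodule.iSup_induction' with
      | mem j x hx => exact Submodule.mem_iSup_of_mem _ (d_smul_mem_grd k hx)
      | zero => rw [smul_zero]; exact zero_mem _
      | add x y _ _ hx hy => rw [smul_add]; exact add_mem hx hy
    · intro m hm
      induction hm using Submodule.iSup_induction' with
      | mem j x hx =>
        obtain ⟨c, hc⟩ := z_smul_of_mem_grd hx
        rw [hc]
        exact Submodule.smul_mem _ _ (Submodule.mem_iSup_of_mem _ hx)
      | zero => rw [smul_zero]; exact zero_mem _
      | add x y _ _ hx hy => rw [smul_add]; exact add_mem hx hy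
  refine (iSup_le fun k => ?_ : (⨆ k : ℤ, grd μ (bigProj μ n) k) ≤ _) h1
  rcases lt_or_ge k 0 with hk | hk
  · intro y hy
    obtain ⟨w, rfl⟩ := exists_smul_projGen y
    have hw : w ∈ projIdeal μ n := by
      intro M hM v hv
      have h2 := map_mem_grd (projLift hM hv) hy
      rw [map_smul, projLift_gen] at h2
      exact grd_eq_zero_of_neg hM hk h2
    rw [smul_projGen_eq_zero hw]
    exact zero_mem _
  · obtain ⟨j, rfl⟩ := Int.eq_ofNat_of_zero_le hk
    exact le_iSup (fun j : ℕ => grd μ (bigProj μ n) j) j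

theorem span_posSpan_projGen (μ : Weight) (n : ℤ) :
    Submodule.span UVir (posSpan (projGen μ n) : Set (bigProj μ n)) = ⊤ := by
  refine eq_top_iff.mpr fun x _ => ?_
  obtain ⟨u, rfl⟩ := exists_smul_projGen x
  exact Submodule.smul_mem _ _ (Submodule.subset_span (mem_posSpan _))

theorem finiteDimensional_grd_bigProj (μ : Weight) (n k : ℕ) :
    FiniteDimensional ℂ (grd μ (bigProj μ n) k) := by
  have := finiteDimensional_posSpan (isBdd_bigProj μ n) (projGen_mem μ (n : ℤ))
  exact finiteDimensional_grd_of_generated (isBdd_bigProj μ n)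
    (fun b v hv => posSpan_stable (projGen_mem μ n) b hv) (span_posSpan_projGen μ n) k

/-- The graded pieces of a finitely generated bounded weight module are finite dimensional. -/
theorem finiteDimensional_grd (h : IsBdd μ M) (hfin : Module.Finite UVir M) (k : ℕ) :
    FiniteDimensional ℂ (grd μ M k) := by
  have hsup : ∀ S T : Submodule UVir M,
      FiniteDimensional ℂ ↥(S.restrictScalars ℂ ⊓ grd μ M k) →
      FiniteDimensional ℂ ↥(T.restrictScalars ℂ ⊓ grd μ M k) →
      FiniteDimensional ℂ ↥((S ⊔ T).restrictScalars ℂ ⊓ grd μ M k) := by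
    intro S T hS hT
    refine finiteDimensional_of_le
      (T := (S.restrictScalars ℂ ⊓ grd μ M k) ⊔ (T.restrictScalars ℂ ⊓ grd μ M k)) ?_
    rintro x ⟨hx, hxk⟩
    obtain ⟨s, hs, t, ht, rfl⟩ := Submodule.mem_sup.mp hx
    rw [← comp_of_mem h hxk, map_add]
    exact Submodule.add_mem_sup ⟨comp_mem_submodule h S hs k, comp_mem h k s⟩
      ⟨comp_mem_submodule h T ht k, comp_mem h k t⟩
  have key : ∀ S : Submodule UVir M, S.FG →
      FiniteDimensional ℂ ↥(S.restrictScalars ℂ ⊓ grd μ M k) := by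
    intro S hS
    induction S, hS using Submodule.fg_induction with
    | singleton x =>
      induction x using h.induction with
      | zero =>
        refine finiteDimensional_of_le (T := (⊥ : Submodule ℂ M)) ?_
        rintro x ⟨hx, _⟩
        simpa using hx
      | add a b ha hb =>
        have := hsup _ _ ha hb
        refine finiteDimensional_of_le (T :=
          (Submodule.span UVir {a} ⊔ Submodule.span UVir {b}).restrictScalars ℂ ⊓ grd μ M k) ?_
        have hle : Submodule.span UVir {a + b} ≤
            Submodule.span UVir {a} ⊔ Submodule.span UVir {b} :=
          (Submodule.span_singleton_le_iff_mem (a + b) _).mpr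
            (Submodule.add_mem_sup (Submodule.mem_span_singleton_self a)
              (Submodule.mem_span_singleton_self b))
        exact fun x hx => ⟨hle hx.1, hx.2⟩
      | mem n x hx =>
        have := finiteDimensional_grd_bigProj μ n k
        refine finiteDimensional_of_le
          (T := (grd μ (bigProj μ n) k).map ((projLift h hx).restrictScalars ℂ)) ?_
        rintro y ⟨hy, hyk⟩
        obtain ⟨u, rfl⟩ := Submodule.mem_span_singleton.mp hy
        refine ⟨comp (isBdd_bigProj μ n) k (u • projGen μ n), comp_mem _ _ _, ?_⟩
        rw [LinearMap.restrictScalars_apply, map_comp _ h, map_smul, projLift_gen,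
          comp_of_mem h hyk]
    | sup S T hS hT ihS ihT => exact hsup S T ihS ihT
  have := key ⊤ hfin.1
  exact finiteDimensional_of_le (T := (⊤ : Submodule UVir M).restrictScalars ℂ ⊓ grd μ M k)
    fun x hx => ⟨trivial, hx⟩

/-- Finitely generated bounded weight modules belong to Category `𝒪`. -/
theorem IsBdd.inCategoryO (h : IsBdd μ M) (hfin : Module.Finite UVir M) : InCategoryO M where
  weight := by
    classical
    refine (DirectSum.isInternal_submodule_iff_iSupIndep_and_iSup_eq_top _).mpr
      ⟨iSupIndep_weightSpace _, eq_top_iff.mpr ?_⟩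
    rw [← h]
    exact iSup_le fun n => le_iSup (weightSpace M) (μ + intWeight n)
  finite := hfin
  locallyFinite m := by
    obtain ⟨s, hs⟩ := exists_sum_comp h m
    obtain ⟨K, hK⟩ := s.exists_nat_subset_range
    have : ∀ k : Fin K, FiniteDimensional ℂ (grd μ M k) := fun k => finiteDimensional_grd h hfin k
    refine ⟨⨆ k : Fin K, grd μ M k, ?_, inferInstance, ?_⟩
    · rw [← hs s subset_rfl]
      exact Submodule.sum_mem _ fun k hk => Submodule.mem_iSup_of_mem
        ⟨k, Finset.mem_range.mp (hK hk)⟩ (comp_mem h k m)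
    · intro n hn w hw
      induction hw using Submodule.iSup_induction' with
      | mem k x hx =>
        have hx' := d_smul_mem_grd n hx
        rcases lt_or_ge ((k : ℤ) - n) 0 with h0 | h0
        · rw [grd_eq_zero_of_neg h h0 hx']
          exact zero_mem _
        · obtain ⟨j, hj⟩ := Int.eq_ofNat_of_zero_le h0
          refine Submodule.mem_iSup_of_mem ⟨j, by have := k.2; omega⟩ ?_
          rwa [hj] at hx'
      | zero => rw [smul_zero]; exact zero_mem _
      | add x y _ _ hx hy => rw [smul_add]; exact add_mem hx hy

/-- If `L(γ)` is a subquotient of a module in Category `𝒪` only for weights `γ = μ + n`, `n ≥ 0`,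
then the module is bounded. -/
theorem isBdd_of_subquotient (hM : InCategoryO M)
    (hΛ : ∀ γ, IsSubquotient (simple γ) M → ∃ n : ℕ, γ = μ + intWeight n) : IsBdd μ M := by
  classical
  have htop := ((DirectSum.isInternal_submodule_iff_iSupIndep_and_iSup_eq_top _).mp hM.weight).2
  refine eq_top_iff.mpr ?_
  rw [← htop]
  refine iSup_le fun γ v hv => ?_
  by_cases h0 : v = 0
  · rw [h0]; exact zero_mem _
  obtain ⟨W, hvW, hW, hWs⟩ := hM.locallyFinite v
  let K : Set ℤ := {k : ℤ | ∃ w ∈ W, w ∈ grd γ M k ∧ w ≠ 0}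
  have hK : K.Finite := by
    choose w hw hwk hw0 using fun k : K => k.2
    have h1 : LinearIndependent ℂ w :=
      ((iSupIndep_grd γ M).comp Subtype.val_injective).linearIndependent _ hwk hw0
    have h2 : LinearIndependent ℂ (fun k : K => (⟨w k, hw k⟩ : W)) :=
      LinearIndependent.of_comp W.subtype h1
    exact Set.finite_coe_iff.mp h2.finite_of_isNoetherian
  have h0K : (0 : ℤ) ∈ K := ⟨v, hvW, by rwa [grd, intWeight_zero, add_zero], h0⟩
  -- the degree `k` is minimal, so that a vector of this degree in `W` is singular
  obtain ⟨k, hk, hmin⟩ := Set.exists_min_image K id hK ⟨0, h0K⟩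
  obtain ⟨w, hw, hwk, hw0⟩ := hk
  have hk0 : k ≤ 0 := hmin 0 h0K
  have hsub : IsSubquotient (simple (γ + intWeight k)) M := by
    refine isSubquotient_of_singular hw0 hwk fun j hj => ?_
    by_contra hne
    have := hmin (k - j) ⟨_, hWs j hj w hw, d_smul_mem_grd j hwk, hne⟩
    simp only [id] at this
    omega
  obtain ⟨n, hn⟩ := hΛ _ hsub
  have hγ : γ = μ + intWeight ((n : ℤ) - k) := by
    rw [intWeight_sub, ← add_sub_assoc, ← hn, add_sub_cancel_right]
  obtain ⟨m, hm⟩ := Int.eq_ofNat_of_zero_le (show 0 ≤ (n : ℤ) - k by omega)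
  refine Submodule.mem_iSup_of_mem m ?_
  rwa [grd, ← hm, ← hγ]

end

section

variable {μ : Weight} {M N : ModuleCat.{0} UVir}

/-! ### Projective covers of simple modules as summands -/

/-- A surjective endomorphism of a bounded module with finite dimensional graded pieces is
injective. -/
theorem injective_of_surjective_endomorphism (h : IsBdd μ M)
    (hfin : ∀ k : ℕ, FiniteDimensional ℂ (grd μ M k)) (f : M →ₗ[UVir] M)
    (hf : Function.Surjective f) : Function.Injective f := by
  refine (injective_iff_map_eq_zero f).mpr fun x hx => ?_
  have h0 : x ∈ (⊥ : Submodule ℂ M) := by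
    refine mem_of_comp_mem h ⊥ x fun k => ?_
    have := hfin k
    let g : grd μ M k →ₗ[ℂ] grd μ M k :=
      (f.restrictScalars ℂ).restrict fun y hy => map_mem_grd f hy
    have hg : Function.Surjective g := by
      rintro ⟨y, hy⟩
      obtain ⟨x, hx, hxy⟩ := exists_mem_grd_map_eq h h hf hy
      exact ⟨⟨x, hx⟩, Subtype.ext hxy⟩
    have hg' := LinearMap.injective_iff_surjective.mpr hg
    have h1 : g ⟨comp h k x, comp_mem h k x⟩ = 0 := by
      refine Subtype.ext ?_
      change f (comp h k x) = 0
      rw [map_comp h h, hx, map_zero]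
    have h2 := (map_eq_zero_iff g hg').mp h1
    exact congrArg Subtype.val h2
  exact (Submodule.mem_bot ℂ).mp h0

/-- `P` is a direct summand of `bigProj μ n`. -/
def IsProjSummand (μ : Weight) (n : ℤ) (P : ModuleCat.{0} UVir) : Prop :=
  ∃ (i : P →ₗ[UVir] bigProj μ n) (r : bigProj μ n →ₗ[UVir] P), ∀ x, r (i x) = x

theorem IsProjSummand.isBdd {n : ℤ} {P : ModuleCat.{0} UVir} (h : IsProjSummand μ n P) :
    IsBdd μ P := by
  obtain ⟨i, r, hri⟩ := h
  exact (isBdd_bigProj μ n).of_surjective r fun x => ⟨i x, hri x⟩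

theorem finite_bigProj (μ : Weight) (n : ℤ) : Module.Finite UVir (bigProj μ n) :=
  Module.Finite.of_surjective (projIdeal μ n).mkQ (projIdeal μ n).mkQ_surjective

theorem IsProjSummand.finite {n : ℤ} {P : ModuleCat.{0} UVir} (h : IsProjSummand μ n P) :
    Module.Finite UVir P := by
  obtain ⟨i, r, hri⟩ := h
  have := finite_bigProj μ n
  exact Module.Finite.of_surjective r fun x => ⟨i x, hri x⟩

/-- Summands of `bigProj μ n` are projective relative to bounded modules. -/
theorem IsProjSummand.exists_lift {n : ℤ} {P : ModuleCat.{0} UVir} (h : IsProjSummand μ n P)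
    (hM : IsBdd μ M) (hN : IsBdd μ N) {f : M →ₗ[UVir] N} (hf : Function.Surjective f)
    (g : P →ₗ[UVir] N) : ∃ k : P →ₗ[UVir] M, ∀ x, f (k x) = g x := by
  obtain ⟨i, r, hri⟩ := h
  obtain ⟨x, hx, hxy⟩ := exists_mem_grd_map_eq hM hN hf (map_mem_grd (g ∘ₗ r) (projGen_mem μ n))
  refine ⟨projLift hM hx ∘ₗ i, fun y => ?_⟩
  have key : f ∘ₗ projLift hM hx = g ∘ₗ r :=
    bigProj_hom_ext (by rw [LinearMap.comp_apply, projLift_gen, hxy])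
  have := LinearMap.congr_fun key (i y)
  simp only [LinearMap.comp_apply, hri] at this
  exact this

/-- `p` is essential: a submodule not contained in the kernel of `p` is everything. -/
def IsEssentialMap (p : M →ₗ[UVir] N) : Prop :=
  ∀ S : Submodule UVir M, ¬ S ≤ LinearMap.ker p → S = ⊤

/-- Each `L(μ + n)`, `n ≥ 0`, has a cover by a direct summand of `bigProj μ n`: take a submodule
`S` of `bigProj μ n` mapping onto `L(μ + n)` whose part of degree `n` has minimal dimension, and
the submodule generated by this part. -/
theorem exists_essential_summand (μ : Weight) (n : ℕ) :
    ∃ (P : ModuleCat.{0} UVir) (p : P →ₗ[UVir] simple (μ + intWeight n)),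
      IsProjSummand μ n P ∧ Function.Surjective p ∧ IsEssentialMap p := by
  have hL := isBdd_simple μ (n := n) (by omega)
  have hQ := isBdd_bigProj μ n
  have hgr := finiteDimensional_grd_bigProj μ n
  let q : bigProj μ n →ₗ[UVir] simple (μ + intWeight n) := projLift hL (simpleGen_mem _)
  have hqgen : q (projGen μ n) = simpleGen _ := projLift_gen _ _
  let G : Submodule ℂ (bigProj μ n) := grd μ (bigProj μ n) n
  have hG : FiniteDimensional ℂ G := hgr n
  -- a submodule mapping onto the simple module contains a preimage of `simpleGen` of degree `n`
  have hex : ∀ S : Submodule UVir (bigProj μ n), ¬ S ≤ LinearMap.ker q →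
      ∃ y ∈ S, y ∈ G ∧ q y = simpleGen _ := by
    intro S hS
    obtain ⟨x, hx, hqx⟩ := Set.not_subset.mp hS
    obtain ⟨⟨y, hy⟩, hqy⟩ := surjective_of_ne_zero (q ∘ₗ S.subtype) (x := ⟨x, hx⟩) hqx
      (simpleGen (μ + intWeight n))
    refine ⟨comp hQ n y, comp_mem_submodule hQ S hy n, comp_mem hQ n y, ?_⟩
    rw [map_comp hQ hL]
    have : q y = simpleGen (μ + intWeight n) := hqy
    rw [this]
    exact comp_of_mem hL (simpleGen_mem _)
  have htop : ¬ (⊤ : Submodule UVir (bigProj μ n)) ≤ LinearMap.ker q := fun h =>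
    simpleGen_ne_zero _ (hqgen.symm.trans
      (LinearMap.mem_ker.mp (h (Submodule.mem_top (x := projGen μ n)))))
  obtain ⟨S, hS, hmin⟩ := WellFounded.has_min
    (InvImage.wf (fun S : Submodule UVir (bigProj μ n) =>
      Module.finrank ℂ ↥(S.restrictScalars ℂ ⊓ G)) Nat.lt_wfRel.wf)
    {S | ¬ S ≤ LinearMap.ker q} ⟨⊤, htop⟩
  have hS' : ∀ T : Submodule UVir (bigProj μ n), ¬ T ≤ LinearMap.ker q → T ≤ S →
      S.restrictScalars ℂ ⊓ G ≤ T.restrictScalars ℂ := by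
    intro T hT hTS
    have hle : T.restrictScalars ℂ ⊓ G ≤ S.restrictScalars ℂ ⊓ G :=
      fun x hx => ⟨hTS hx.1, hx.2⟩
    have hfd : FiniteDimensional ℂ ↥(S.restrictScalars ℂ ⊓ G) :=
      finiteDimensional_of_le (T := G) inf_le_right
    have := Submodule.eq_of_le_of_finrank_le hle (not_lt.mp (hmin T hT))
    rw [← this]
    exact inf_le_left
  obtain ⟨y, hyS, hyG, hqy⟩ := hex S hS
  let R : Submodule UVir (bigProj μ n) :=
    Submodule.span UVir ((S.restrictScalars ℂ ⊓ G : Submodule ℂ (bigProj μ n)) : Set (bigProj μ n))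
  have hRS : R ≤ S := Submodule.span_le.mpr fun x hx => hx.1
  have hyR : y ∈ R := Submodule.subset_span ⟨hyS, hyG⟩
  have hess : ∀ T : Submodule UVir (bigProj μ n), ¬ T ≤ LinearMap.ker q → T ≤ R → T = R :=
    fun T hT hTR => le_antisymm hTR (Submodule.span_le.mpr (hS' T hT (hTR.trans hRS)))
  let P : ModuleCat.{0} UVir := ModuleCat.of UVir R
  have hP : IsBdd μ P := hQ.submodule R
  let r : bigProj μ n →ₗ[UVir] P := projLift hP (v := ⟨y, hyR⟩)
    (mem_weightSpace_of_map (f := R.subtype) R.subtype_injective hyG)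
  have hr : r (projGen μ n) = ⟨y, hyR⟩ := projLift_gen _ _
  have hqr : ∀ x, q (r x).1 = q x := by
    have : (q ∘ₗ R.subtype) ∘ₗ r = q := bigProj_hom_ext (by
      rw [LinearMap.comp_apply, hr, hqgen]
      exact hqy)
    exact LinearMap.congr_fun this
  -- `φ` is compatible with `q`, hence surjective by minimality, hence bijective
  let φ : P →ₗ[UVir] P := r ∘ₗ R.subtype
  have hφ : Function.Surjective φ := by
    have h1 : (LinearMap.range φ).map R.subtype = R := by
      refine hess _ (fun h => ?_) (Submodule.map_subtype_le R _)
      have h2 : q (φ ⟨y, hyR⟩).1 = 0 := h ⟨_, ⟨⟨y, hyR⟩, rfl⟩, rfl⟩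
      have h3 : q (φ ⟨y, hyR⟩).1 = q y := hqr y
      exact simpleGen_ne_zero _ (hqy ▸ h3 ▸ h2)
    rintro ⟨x, hx⟩
    rw [← h1] at hx
    obtain ⟨_, ⟨w, rfl⟩, hw⟩ := hx
    exact ⟨w, Subtype.ext hw⟩
  have hφi : Function.Injective φ := by
    refine injective_of_surjective_endomorphism hP (fun k => ?_) φ hφ
    have := finite_bigProj μ n
    exact finiteDimensional_grd hP (Module.Finite.of_surjective r fun x =>
      ⟨(hφ x).choose.1, (hφ x).choose_spec⟩ : Module.Finite UVir P) k
  let e : P ≃ₗ[UVir] P := LinearEquiv.ofBijective φ ⟨hφi, hφ⟩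
  refine ⟨P, q ∘ₗ R.subtype, ⟨R.subtype ∘ₗ e.symm.toLinearMap, r, fun x => ?_⟩, ?_, ?_⟩
  · exact e.apply_symm_apply x
  · refine surjective_of_ne_zero (q ∘ₗ R.subtype) (x := ⟨y, hyR⟩) ?_
    change q y ≠ 0
    rw [hqy]
    exact simpleGen_ne_zero _
  · intro T hT
    have h1 : T.map R.subtype = R := by
      refine hess _ (fun h => hT fun x hx => ?_) (Submodule.map_subtype_le R _)
      exact h ⟨x, hx, rfl⟩
    refine eq_top_iff.mpr fun x _ => ?_
    obtain ⟨w, hw, hwx⟩ := (h1.symm ▸ x.2 : x.1 ∈ T.map R.subtype)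
    rwa [← Subtype.ext hwx]

end

section

variable {μ : Weight} {M N : ModuleCat.{0} UVir}

/-! ### Freeness of projective modules over the negative part -/

/-- The representation of `𝔟⁺` on a stable subspace of a module. -/
def subRep (V : Submodule ℂ M) (hV : ∀ b : bPlus, ∀ v ∈ V, toU b • v ∈ V) :
    bPlus →ₗ⁅ℂ⁆ Module.End ℂ V where
  toFun b := (act M (toU b)).restrict (hV b)
  map_add' x y := by
    refine LinearMap.ext fun v => Subtype.ext ?_
    change toU ((x : Virasoro) + y) • (v : M) = toU x • (v : M) + toU y • (v : M)
    rw [toU, map_add, add_smul]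
  map_smul' c x := by
    refine LinearMap.ext fun v => Subtype.ext ?_
    change toU (c • (x : Virasoro)) • (v : M) = c • toU x • (v : M)
    rw [toU, map_smul, smul_assoc]
  map_lie' {x y} := by
    refine LinearMap.ext fun v => Subtype.ext ?_
    rw [LieRing.of_associative_ring_bracket]
    change toU ⁅(x : Virasoro), (y : Virasoro)⁆ • (v : M) =
      toU x • toU y • (v : M) - toU y • toU x • (v : M)
    rw [lie_smul_eq x y, add_sub_cancel_left]

/-- The module induced from the `𝔟⁺`-submodule of `bigProj μ n` generated by the universal vector is
bounded. This makes the universal property of `bigProj μ n` applicable to it. -/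
theorem isBdd_indModule_posSpan (μ : Weight) (n : ℕ) :
    IsBdd μ (indModule (subRep (posSpan (projGen μ n)) fun b _ hv =>
      posSpan_stable (projGen_mem μ n) b hv)) := by
  set W := posSpan (projGen μ n)
  have hW : ∀ b : bPlus, ∀ v ∈ W, toU b • v ∈ W := fun b _ hv =>
      posSpan_stable (projGen_mem μ n) b hv
  set I := indModule (subRep W hW)
  have hmem : ∀ (k : ℤ) (w : W), (w : bigProj μ n) ∈ grd μ (bigProj μ n) k →
      indEquiv (subRep W hW) (1 ⊗ₜ w) ∈ grd μ I k := by
    intro k w hw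
    refine mem_weightSpace_iff.mpr ⟨?_, ?_⟩
    · rw [show toU (d 0) = toU ((⟨d 0, d_mem_bPlus 0⟩ : bPlus) : Virasoro) from rfl,
        toU_smul_indEquiv_one, ← LinearEquiv.map_smul, ← TensorProduct.tmul_smul]
      congr 2
      exact Subtype.ext (mem_weightSpace_iff.mp hw).1
    · rw [show toU z = toU ((⟨z, z_mem_bPlus⟩ : bPlus) : Virasoro) from rfl,
        toU_smul_indEquiv_one, ← LinearEquiv.map_smul, ← TensorProduct.tmul_smul]
      congr 2
      exact Subtype.ext (mem_weightSpace_iff.mp hw).2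
  let V : Submodule ℂ I := LinearMap.range
    ((indEquiv (subRep W hW)).toLinearMap ∘ₗ TensorProduct.mk ℂ UMinus W 1)
  refine eq_top_iff.mpr fun x _ => mem_of_generated (V := V) ?_ ?_ ?_ ?_
  · rintro b _ ⟨w, rfl⟩
    exact ⟨subRep W hW b w, (toU_smul_indEquiv_one _ b w).symm⟩
  · rintro _ ⟨⟨w, hw⟩, rfl⟩
    have h1 : W ≤ (⨆ k : ℕ, W ⊓ grd μ (bigProj μ n) k) := by
      refine iSup_le fun m y hy => ?_
      have hyk := posLevel_le_grd (projGen_mem μ n) m hy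
      rcases lt_or_ge ((n : ℤ) - m) 0 with h0 | h0
      · rw [grd_eq_zero_of_neg (isBdd_bigProj μ n) h0 hyk]
        exact zero_mem _
      · obtain ⟨j, hj⟩ := Int.eq_ofNat_of_zero_le h0
        rw [hj] at hyk
        exact Submodule.mem_iSup_of_mem j ⟨Submodule.mem_iSup_of_mem m hy, hyk⟩
    have h2 : ∀ y ∈ (⨆ k : ℕ, W ⊓ grd μ (bigProj μ n) k), ∃ hy : y ∈ W,
        indEquiv (subRep W hW) (1 ⊗ₜ ⟨y, hy⟩) ∈ ⨆ k : ℕ, grd μ I k := by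
      intro y hy
      induction hy using Submodule.iSup_induction' with
      | mem k y hy => exact ⟨hy.1, Submodule.mem_iSup_of_mem k (hmem k ⟨y, hy.1⟩ hy.2)⟩
      | zero =>
        refine ⟨zero_mem _, ?_⟩
        rw [show (⟨0, zero_mem W⟩ : W) = 0 from rfl, TensorProduct.tmul_zero, map_zero]
        exact zero_mem _
      | add x y _ _ hx hy =>
        obtain ⟨hx, hx'⟩ := hx
        obtain ⟨hy, hy'⟩ := hy
        refine ⟨add_mem hx hy, ?_⟩
        rw [show (⟨x + y, add_mem hx hy⟩ : W) = ⟨x, hx⟩ + ⟨y, hy⟩ from rfl,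
          TensorProduct.tmul_add, map_add]
        exact add_mem hx' hy'
    exact (h2 w (h1 hw)).2
  · intro k m hm
    induction hm using Submodule.iSup_induction' with
    | mem j y hy =>
      refine Submodule.mem_iSup_of_mem (j + (k + 1)) ?_
      have := d_smul_mem_grd (-((k : ℤ) + 1)) hy
      rwa [show (j : ℤ) - -((k : ℤ) + 1) = ((j + (k + 1) : ℕ) : ℤ) by push_cast; ring] at this
    | zero => rw [smul_zero]; exact zero_mem _
    | add x y _ _ hx hy => rw [smul_add]; exact add_mem hx hy
  · have h3 : (V : Set I) = Set.range fun w : W => indEquiv (subRep W hW) (1 ⊗ₜ w) := rfl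
    rw [h3, span_indEquiv_one]
    trivial

/-- The module `bigProj μ n` is free over `U(𝔫⁻)` on the `𝔟⁺`-submodule generated by the
universal vector, being isomorphic to the module induced from it. -/
theorem mulMap_posSpan_bijective (μ : Weight) (n : ℕ) :
    Function.Bijective (mulMap (posSpan (projGen μ n))) := by
  have hW : ∀ b : bPlus, ∀ v ∈ posSpan (projGen μ n), toU b • v ∈ posSpan (projGen μ n) :=
    fun b _ hv => posSpan_stable (projGen_mem μ n) b hv
  have hI := isBdd_indModule_posSpan μ n
  set W := posSpan (projGen μ n) with hWdef
  let T := indEquiv (subRep W hW)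
  let g : W := ⟨projGen μ n, mem_posSpan _⟩
  have hgen : T (1 ⊗ₜ g) ∈ grd μ (indModule (subRep W hW)) n := by
    refine mem_weightSpace_iff.mpr ⟨?_, ?_⟩
    · rw [show toU (d 0) = toU ((⟨d 0, d_mem_bPlus 0⟩ : bPlus) : Virasoro) from rfl,
        toU_smul_indEquiv_one, ← LinearEquiv.map_smul, ← TensorProduct.tmul_smul]
      congr 2
      exact Subtype.ext (mem_weightSpace_iff.mp (projGen_mem μ n)).1
    · rw [show toU z = toU ((⟨z, z_mem_bPlus⟩ : bPlus) : Virasoro) from rfl,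
        toU_smul_indEquiv_one, ← LinearEquiv.map_smul, ← TensorProduct.tmul_smul]
      congr 2
      exact Subtype.ext (mem_weightSpace_iff.mp (projGen_mem μ n)).2
  -- `θ` is the inverse of `mulMap W`, up to the identification `T`
  let θ : bigProj μ n →ₗ[UVir] indModule (subRep W hW) := projLift hI hgen
  let A : Submodule ℂ (bigProj μ n) :=
    { carrier := {x | ∃ hx : x ∈ W, θ x = T (1 ⊗ₜ ⟨x, hx⟩)}
      zero_mem' := ⟨zero_mem _, by
        rw [show (⟨0, zero_mem W⟩ : W) = 0 from rfl, TensorProduct.tmul_zero, map_zero, map_zero]⟩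
      add_mem' := by
        rintro x y ⟨hx, hx'⟩ ⟨hy, hy'⟩
        refine ⟨add_mem hx hy, ?_⟩
        rw [show (⟨x + y, add_mem hx hy⟩ : W) = ⟨x, hx⟩ + ⟨y, hy⟩ from rfl,
          TensorProduct.tmul_add, map_add, map_add, hx', hy']
      smul_mem' := by
        rintro c x ⟨hx, hx'⟩
        refine ⟨W.smul_mem c hx, ?_⟩
        rw [show (⟨c • x, W.smul_mem c hx⟩ : W) = c • ⟨x, hx⟩ from rfl,
          TensorProduct.tmul_smul, LinearMap.map_smul_of_tower, hx']
        exact (T.map_smul c _).symm }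
  have hA : W ≤ A := by
    refine iSup_le fun m => posLevel_le (p := fun _ => A) ?_ ?_ m
    · exact ⟨mem_posSpan _, projLift_gen _ _⟩
    · rintro m k x ⟨hx, hx'⟩
      have hd : d ((k : ℤ) + 1) ∈ bPlus := by exact_mod_cast d_mem_bPlus (k + 1)
      refine ⟨hW ⟨_, hd⟩ x hx, ?_⟩
      rw [map_smul, hx']
      exact toU_smul_indEquiv_one _ ⟨_, hd⟩ _
  have hθ : ∀ t, θ (mulMap W t) = T t := by
    intro t
    induction t with
    | zero => simp only [map_zero]
    | add s t hs ht => simp only [map_add, hs, ht]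
    | tmul a w =>
      rw [mulMap_tmul, map_smul, (hA w.2).2]
      refine (emb_smul_indEquiv _ a _).trans ?_
      rw [TensorProduct.smul_tmul', smul_eq_mul, mul_one]
  refine ⟨fun s t h => T.injective ?_, fun x => ?_⟩
  · rw [← hθ, ← hθ, h]
  · exact span_le_range_mulMap hW (span_posSpan_projGen μ n ▸ Submodule.mem_top)

/-! ### The filtration by degrees -/

/-- The submodule generated by the vectors of degree `< n`. -/
def low (μ : Weight) (M : ModuleCat.{0} UVir) (n : ℕ) : Submodule UVir M :=
  Submodule.span UVir {x | ∃ s < n, x ∈ grd μ M (s : ℕ)}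

theorem mem_low {n s : ℕ} (hs : s < n) {x : M} (hx : x ∈ grd μ M s) : x ∈ low μ M n :=
  Submodule.subset_span ⟨s, hs, hx⟩

theorem map_mem_low (f : M →ₗ[UVir] N) {n : ℕ} {x : M} (hx : x ∈ low μ M n) :
    f x ∈ low μ N n := by
  refine (Submodule.span_le.mpr ?_ : low μ M n ≤ (low μ N n).comap f) hx
  rintro y ⟨s, hs, hy⟩
  exact mem_low hs (map_mem_grd f hy)

/-- A functional on `bigProj μ k` vanishing on the vectors generated in degrees `< n` gives rise to
a coordinate with values in `U(𝔫⁻)` on the submodule generated in degrees `≤ n`: by freeness,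
`bigProj μ k = U(𝔫⁻) ⊗ W`, and the coordinate is `a ⊗ w ↦ ψ (w_n) a`, where `w_n` is the component
of `w` of degree `n`. -/
theorem exists_coord_bigProj (μ : Weight) (k n : ℕ) (ψ : bigProj μ k →ₗ[ℂ] ℂ)
    (hψ : ∀ x ∈ low μ (bigProj μ k) n, ψ x = 0) :
    ∃ Ψ : bigProj μ k →ₗ[ℂ] UMinus, (∀ x ∈ low μ (bigProj μ k) n, Ψ x = 0) ∧
      ∀ (a : UMinus), ∀ y ∈ grd μ (bigProj μ k) n, Ψ (emb a • y) = ψ y • a := by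
  have hQ := isBdd_bigProj μ k
  have hW : ∀ b : bPlus, ∀ v ∈ posSpan (projGen μ k), toU b • v ∈ posSpan (projGen μ k) :=
    fun b _ hv => posSpan_stable (projGen_mem μ k) b hv
  have hbij := mulMap_posSpan_bijective μ k
  have hspan := span_posSpan_projGen μ k
  have hcW : ∀ w ∈ posSpan (projGen μ (k : ℤ)), ∀ j : ℤ,
      comp hQ j w ∈ posSpan (projGen μ (k : ℤ)) := by
    intro w hw j
    induction hw using Submodule.iSup_induction' with
    | mem m x hx =>
      rw [comp_of_mem_eq hQ (posLevel_le_grd (projGen_mem μ k) m hx)]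
      split_ifs
      · exact Submodule.mem_iSup_of_mem m hx
      · exact zero_mem _
    | zero => rw [map_zero]; exact zero_mem _
    | add x y _ _ hx hy => rw [map_add]; exact add_mem hx hy
  generalize posSpan (projGen μ (k : ℤ)) = W at *
  let e : UMinus ⊗[ℂ] W ≃ₗ[ℂ] bigProj μ k := LinearEquiv.ofBijective (mulMap W) hbij
  let coord : UMinus ⊗[ℂ] W →ₗ[ℂ] UMinus := (TensorProduct.rid ℂ UMinus).toLinearMap ∘ₗ
    LinearMap.lTensor UMinus (ψ ∘ₗ comp hQ n ∘ₗ W.subtype)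
  let Ψ : bigProj μ k →ₗ[ℂ] UMinus := coord ∘ₗ e.symm.toLinearMap
  have hΨ : ∀ (a : UMinus) (w : bigProj μ k), w ∈ W → Ψ (emb a • w) = ψ (comp hQ n w) • a := by
    intro a w hw
    have h1 : e (a ⊗ₜ ⟨w, hw⟩) = emb a • w := mulMap_tmul W a ⟨w, hw⟩
    have h2 : e.symm (emb a • w) = a ⊗ₜ ⟨w, hw⟩ := by rw [← h1, e.symm_apply_apply]
    change coord (e.symm (emb a • w)) = _
    rw [h2]
    simp [coord]
  let W' : Submodule ℂ (bigProj μ k) := W ⊓ ⨆ s : Fin n, grd μ (bigProj μ k) (s : ℕ)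
  have hW' : ∀ b : bPlus, ∀ v ∈ W', toU b • v ∈ W' := by
    intro b v hv
    refine ⟨hW b v hv.1, bPlus_smul_mem ?_ ?_ b hv.2⟩
    · intro j x hx
      induction hx using Submodule.iSup_induction' with
      | mem s x hx =>
        have hx' := d_smul_mem_grd (j : ℤ) hx
        rcases lt_or_ge ((s : ℕ) - (j : ℤ)) 0 with h0 | h0
        · rw [grd_eq_zero_of_neg hQ h0 hx']
          exact zero_mem _
        · obtain ⟨i, hi⟩ := Int.eq_ofNat_of_zero_le h0
          rw [hi] at hx'
          exact Submodule.mem_iSup_of_mem (⟨i, by have := s.2; omega⟩ : Fin n) hx'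
      | zero => rw [smul_zero]; exact zero_mem _
      | add x y _ _ hx hy => rw [smul_add]; exact add_mem hx hy
    · intro x hx
      induction hx using Submodule.iSup_induction' with
      | mem s x hx =>
        obtain ⟨c, hc⟩ := z_smul_of_mem_grd hx
        rw [hc]
        exact Submodule.smul_mem _ _ (Submodule.mem_iSup_of_mem s hx)
      | zero => rw [smul_zero]; exact zero_mem _
      | add x y _ _ hx hy => rw [smul_add]; exact add_mem hx hy
  have hWlow : ∀ w ∈ W', w ∈ low μ (bigProj μ k) n := by
    intro w hw
    have := hw.2
    refine (iSup_le fun s x hx => ?_ : _ ≤ (low μ (bigProj μ k) n).restrictScalars ℂ) this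
    exact mem_low s.2 hx
  let R : Submodule ℂ (bigProj μ k) := LinearMap.range (mulMap W')
  have hRlow : ∀ x ∈ R, x ∈ low μ (bigProj μ k) n := by
    rintro _ ⟨t, rfl⟩
    exact Submodule.span_le.mpr hWlow (range_mulMap_le_span W' t)
  have hRU : ∀ (u : UVir), ∀ x ∈ R, u • x ∈ R := fun u x hx => smul_mem_range_mulMap hW' u hx
  have hRΨ : ∀ x ∈ R, Ψ x = 0 := by
    rintro _ ⟨t, rfl⟩
    induction t with
    | zero => simp only [map_zero]
    | add s t hs ht => simp only [map_add, hs, ht, add_zero]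
    | tmul a w =>
      rw [mulMap_tmul, hΨ a w w.2.1]
      have h0 : comp hQ n (w : bigProj μ k) = 0 := by
        refine (iSup_le fun s x hx => ?_ : _ ≤ LinearMap.ker (comp hQ n)) w.2.2
        exact comp_of_ne hQ (by have := s.2; omega) hx
      rw [h0, map_zero, zero_smul]
  -- `R = U(𝔫⁻) W'` turns out to be `low μ (bigProj μ k) n`; this is read off from a description of
  -- the graded pieces in degrees `≤ n` in terms of the generating space `W`
  let Y : ℤ → Submodule ℂ (bigProj μ k) := fun j => grd μ (bigProj μ k) j ⊓
    (if j < n then R else if j = n then (W ⊓ grd μ (bigProj μ k) n) ⊔ R else ⊤)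
  have hY : ∀ x, x ∈ ⨆ j, Y j := by
    intro x
    refine mem_of_generated hW ?_ ?_ (hspan ▸ Submodule.mem_top : x ∈ _)
    · refine fun w hw => mem_of_comp_mem hQ _ w fun j => Submodule.mem_iSup_of_mem (j : ℤ) ?_
      refine ⟨comp_mem hQ j w, ?_⟩
      split_ifs with h1 h2
      · refine ⟨1 ⊗ₜ ⟨comp hQ j w, hcW w hw j, ?_⟩, by rw [mulMap_tmul, map_one, one_smul]⟩
        exact Submodule.mem_iSup_of_mem (⟨j, by omega⟩ : Fin n) (comp_mem hQ j w)
      · exact Submodule.mem_sup_left ⟨hcW w hw j, h2 ▸ comp_mem hQ j w⟩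
      · trivial
    · intro i m hm
      induction hm using Submodule.iSup_induction' with
      | mem j x hx =>
        refine Submodule.mem_iSup_of_mem (j + (i + 1)) ⟨?_, ?_⟩
        · have := d_smul_mem_grd (-((i : ℤ) + 1)) hx.1
          rwa [sub_neg_eq_add] at this
        · by_cases hj : j < n
          · have hxR : x ∈ R := by
              have := hx.2
              rwa [if_pos hj] at this
            split_ifs with h1 h2
            · exact hRU _ x hxR
            · exact Submodule.mem_sup_right (hRU _ x hxR)
            · trivial
          · rw [if_neg (by omega), if_neg (by omega)]
            trivial
      | zero => rw [smul_zero]; exact zero_mem _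
      | add x y _ _ hx hy => rw [smul_add]; exact add_mem hx hy
  have hYj : ∀ j, ∀ x ∈ grd μ (bigProj μ k) j, x ∈ Y j := by
    intro j x hx
    rw [← comp_of_mem hQ hx]
    exact comp_mem_of_mem_iSup hQ (fun j => inf_le_left) (hY x) j
  have hlowR : ∀ x ∈ low μ (bigProj μ k) n, x ∈ R := by
    intro x hx
    induction hx using Submodule.span_induction with
    | mem x hx =>
      obtain ⟨s, hs, hx⟩ := hx
      have := (hYj s x hx).2
      rwa [if_pos (by omega)] at this
    | zero => exact zero_mem _
    | add x y _ _ hx hy => exact add_mem hx hy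
    | smul u x _ hx => exact hRU u x hx
  refine ⟨Ψ, fun x hx => hRΨ x (hlowR x hx), fun a y hy => ?_⟩
  have hy' := (hYj n y hy).2
  rw [if_neg (lt_irrefl _), if_pos rfl] at hy'
  obtain ⟨w, hw, ρ, hρ, rfl⟩ := Submodule.mem_sup.mp hy'
  rw [smul_add, map_add, hΨ a w hw.1, hRΨ _ (hRU _ ρ hρ), add_zero, comp_of_mem hQ hw.2, map_add,
    hψ ρ (hRlow ρ hρ), add_zero]

theorem IsProjSummand.exists_coord {k : ℕ} {P : ModuleCat.{0} UVir} (h : IsProjSummand μ k P)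
    (n : ℕ) (ψ : P →ₗ[ℂ] ℂ) (hψ : ∀ x ∈ low μ P n, ψ x = 0) :
    ∃ Ψ : P →ₗ[ℂ] UMinus, (∀ x ∈ low μ P n, Ψ x = 0) ∧
      ∀ (a : UMinus), ∀ y ∈ grd μ P n, Ψ (emb a • y) = ψ y • a := by
  obtain ⟨i, r, hri⟩ := h
  obtain ⟨Ψ, h1, h2⟩ := exists_coord_bigProj μ k n (ψ ∘ₗ r.restrictScalars ℂ)
    fun x hx => hψ _ (map_mem_low r hx)
  refine ⟨Ψ ∘ₗ i.restrictScalars ℂ, fun x hx => h1 _ (map_mem_low i hx), fun a y hy => ?_⟩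
  have := h2 a (i y) (map_mem_grd i hy)
  rw [← map_smul] at this
  simpa [hri] using this

end

section

variable {μ : Weight} {M N : ModuleCat.{0} UVir}

/-! ### Verma flags -/

/-- `X` has a finite filtration with subquotients `M(δ)`, `δ ∈ S`. -/
inductive Flag (S : Set Weight) : ModuleCat.{0} UVir → Prop
  | zero (X : ModuleCat.{0} UVir) (h : Subsingleton X) : Flag S X
  | step (A X : ModuleCat.{0} UVir) (δ : Weight) (hδ : δ ∈ S) (j : A →ₗ[UVir] X)
      (f : X →ₗ[UVir] verma δ) (hj : Function.Injective j) (hjf : Function.Exact j f)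
      (hf : Function.Surjective f) (hA : Flag S A) : Flag S X

theorem Flag.mono {S T : Set Weight} (hST : S ⊆ T) (h : Flag S M) : Flag T M := by
  induction h with
  | zero X h => exact .zero X h
  | step A X δ hδ j f hj hjf hf _ ih => exact .step A X δ (hST hδ) j f hj hjf hf ih

theorem Flag.of_equiv {S : Set Weight} (h : Flag S M) (e : M ≃ₗ[UVir] N) : Flag S N := by
  cases h with
  | zero _ h => exact .zero N e.symm.injective.subsingleton
  | step A _ δ hδ j f hj hjf hf hA =>
    refine .step A N δ hδ (e.toLinearMap ∘ₗ j) (f ∘ₗ e.symm.toLinearMap) (e.injective.comp hj) ?_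
      (hf.comp e.symm.surjective) hA
    intro y
    refine (hjf (e.symm y)).trans ⟨?_, ?_⟩
    · rintro ⟨a, ha⟩
      exact ⟨a, by rw [LinearMap.comp_apply, ha]; exact e.apply_symm_apply y⟩
    · rintro ⟨a, rfl⟩
      exact ⟨a, (e.symm_apply_apply _).symm⟩

theorem Flag.extension {S : Set Weight} {A B : ModuleCat.{0} UVir} (hB : Flag S B) (hA : Flag S A)
    (j : A →ₗ[UVir] M) (g : M →ₗ[UVir] B) (hj : Function.Injective j) (hjg : Function.Exact j g)
    (hg : Function.Surjective g) : Flag S M := by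
  induction hB generalizing M with
  | zero B hB =>
    refine hA.of_equiv (LinearEquiv.ofBijective j ⟨hj, fun x => ?_⟩)
    exact (hjg x).mp (Subsingleton.elim _ _)
  | step B' B δ hδ i f hi hif hf _ ih =>
    let K : Submodule UVir M := LinearMap.ker (f ∘ₗ g)
    have hmem : ∀ x : K, g x ∈ LinearMap.range i := fun x => (hif _).mp x.2
    let e := LinearEquiv.ofInjective i hi
    let g' : K →ₗ[UVir] B' := e.symm.toLinearMap ∘ₗ
      LinearMap.codRestrict (LinearMap.range i) (g ∘ₗ K.subtype) hmem
    have hg' : ∀ x : K, i (g' x) = g x := fun x =>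
      congrArg Subtype.val (e.apply_symm_apply ⟨g x, hmem x⟩)
    have hjK : ∀ a, j a ∈ K := fun a => by
      change f (g (j a)) = 0
      rw [(hjg (j a)).mpr ⟨a, rfl⟩, map_zero]
    have hK : Flag S (ModuleCat.of UVir K) := by
      refine ih (M := ModuleCat.of UVir K) (j.codRestrict K hjK) g' ?_ ?_ ?_
      · exact fun a b hab => hj (congrArg Subtype.val hab)
      · intro x
        constructor
        · intro hx
          have h0 : g x = 0 := by rw [← hg', hx, map_zero]
          obtain ⟨a, ha⟩ := (hjg x).mp h0
          exact ⟨a, Subtype.ext ha⟩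
        · rintro ⟨a, rfl⟩
          refine hi ?_
          rw [hg', map_zero]
          exact (hjg _).mpr ⟨a, rfl⟩
      · intro b
        obtain ⟨x, hx⟩ := hg (i b)
        have hxK : x ∈ K := by
          change f (g x) = 0
          rw [hx]
          exact (hif _).mpr ⟨b, rfl⟩
        exact ⟨⟨x, hxK⟩, hi (by rw [hg']; exact hx)⟩
    refine .step _ M δ hδ K.subtype (f ∘ₗ g) K.subtype_injective ?_ (hf.comp hg) hK
    exact fun x => ⟨fun hx => ⟨⟨x, hx⟩, rfl⟩, by rintro ⟨y, rfl⟩; exact y.2⟩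

theorem Flag.finite {S : Set Weight} (h : Flag S M) : Module.Finite UVir M := by
  induction h with
  | zero X h => exact Module.Finite.of_finite
  | step A X δ hδ j f hj hjf hf _ ih =>
    have := (verma_inCategoryO δ).finite
    exact Module.Finite.of_exact hjf hf

/-- A simple subquotient of a module with a Verma flag is a subquotient of a Verma module of
the flag. -/
theorem Flag.exists_preceq {S : Set Weight} (h : Flag S M) {γ : Weight}
    (hγ : IsSubquotient (simple γ) M) : ∃ δ ∈ S, Preceq γ δ := by
  induction h with
  | zero X h =>
    obtain ⟨K, g, hg⟩ := hγ
    obtain ⟨x, hx⟩ := hg (simpleGen γ)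
    have : x = 0 := Subtype.ext (Subsingleton.elim _ _)
    rw [this, map_zero] at hx
    exact absurd hx.symm (simpleGen_ne_zero γ)
  | step A X δ hδ j f hj hjf hf _ ih =>
    rcases hγ.of_extension f with h | h
    · refine ih (h.of_injective (N := A) ?_ ?_)
      · exact (LinearEquiv.ofInjective j hj).symm.toLinearMap ∘ₗ
          LinearMap.codRestrict (LinearMap.range j) (LinearMap.ker f).subtype
            fun x => (hjf x).mp x.2
      · exact (LinearEquiv.ofInjective j hj).symm.injective.comp fun x y hxy =>
          Subtype.ext (congrArg (fun w : LinearMap.range j => (w : X)) hxy)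
    · exact ⟨δ, hδ, h⟩

/-- If `v` is singular modulo the submodule `A` and generates a free `U(𝔫⁻)`-module modulo `A`,
then `(A + U v) / A` is a Verma module. -/
theorem exists_surjective_verma {A : Submodule UVir M} {δ : Weight} {v : M}
    (hv : v ∈ weightSpace M δ) (hs : ∀ k : ℤ, 0 < k → toU (d k) • v ∈ A)
    (hfree : ∀ a : UMinus, emb a • v ∈ A → a = 0) :
    ∃ f : ↥(A ⊔ Submodule.span UVir {v}) →ₗ[UVir] verma δ,
      Function.Surjective f ∧ ∀ x, f x = 0 ↔ (x : M) ∈ A := by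
  let B := A ⊔ Submodule.span UVir {v}
  let F : verma δ →ₗ[UVir] ModuleCat.of UVir (M ⧸ A) :=
    vermaLift (M := ModuleCat.of UVir (M ⧸ A)) (v := A.mkQ v)
      (map_mem_weightSpace (N := ModuleCat.of UVir (M ⧸ A)) A.mkQ hv) fun k hk =>
        (A.mkQ.map_smul _ v).symm.trans ((Submodule.Quotient.mk_eq_zero A).mpr (hs k hk))
  have hFu : ∀ u : UVir, F (u • vermaGen δ) = A.mkQ (u • v) := fun u => by
    rw [map_smul, map_smul]
    exact congrArg (u • ·) (vermaLift_gen _ _)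
  have hF : Function.Injective F := by
    refine (injective_iff_map_eq_zero F).mpr fun m hm => ?_
    obtain ⟨a, rfl⟩ := exists_emb_smul_vermaGen δ m
    rw [hFu] at hm
    rw [hfree a ((Submodule.Quotient.mk_eq_zero A).mp hm), map_zero, zero_smul]
  have hmem : ∀ x : B, A.mkQ x ∈ LinearMap.range F := by
    rintro ⟨x, hx⟩
    obtain ⟨a, ha, y, hy, rfl⟩ := Submodule.mem_sup.mp hx
    obtain ⟨u, rfl⟩ := Submodule.mem_span_singleton.mp hy
    refine ⟨u • vermaGen δ, ?_⟩
    rw [hFu]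
    change _ = A.mkQ (a + u • v)
    rw [map_add, show A.mkQ a = 0 from (Submodule.Quotient.mk_eq_zero A).mpr ha, zero_add]
  let e := LinearEquiv.ofInjective F hF
  let f : B →ₗ[UVir] verma δ := e.symm.toLinearMap ∘ₗ
    LinearMap.codRestrict (LinearMap.range F) (A.mkQ ∘ₗ B.subtype) hmem
  have hf : ∀ x : B, F (f x) = A.mkQ x := fun x =>
    congrArg Subtype.val (e.apply_symm_apply ⟨A.mkQ x, hmem x⟩)
  refine ⟨f, fun m => ?_, fun x => ?_⟩
  · obtain ⟨u, rfl⟩ := exists_smul_vermaGen δ m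
    refine ⟨⟨u • v, Submodule.mem_sup_right (Submodule.smul_mem _ u
      (Submodule.mem_span_singleton_self v))⟩, hF ?_⟩
    rw [hf, hFu]
  · rw [← Submodule.Quotient.mk_eq_zero A, ← map_eq_zero_iff F hF, hf]
    rfl

/-! ### Verma flags of projective modules -/

theorem pos_smul_mem_low (h : IsBdd μ M) {n : ℕ} {x : M} (hx : x ∈ grd μ M n) {k : ℤ} (hk : 0 < k) :
    toU (d k) • x ∈ low μ M n := by
  have hx' := d_smul_mem_grd k hx
  rcases lt_or_ge ((n : ℤ) - k) 0 with h0 | h0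
  · rw [grd_eq_zero_of_neg h h0 hx']
    exact zero_mem _
  · obtain ⟨i, hi⟩ := Int.eq_ofNat_of_zero_le h0
    rw [hi] at hx'
    exact mem_low (by omega) hx'

/-- A coordinate as in `IsProjSummand.exists_coord` vanishes on the submodule generated by
`low μ M n` and vectors of degree `n` in the kernel of `ψ`. -/
theorem coord_eq_zero (h : IsBdd μ M) {n : ℕ} {s : Set M} (hs : ∀ x ∈ s, x ∈ grd μ M n)
    {ψ : M →ₗ[ℂ] ℂ} (hψs : ∀ x ∈ s, ψ x = 0) {Ψ : M →ₗ[ℂ] UMinus} (hΨ : ∀ x ∈ low μ M n, Ψ x = 0)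
    (hΨψ : ∀ (a : UMinus), ∀ y ∈ grd μ M n, Ψ (emb a • y) = ψ y • a) {x : M}
    (hx : x ∈ low μ M n ⊔ Submodule.span UVir s) : Ψ x = 0 := by
  let V : Submodule ℂ M := (low μ M n).restrictScalars ℂ ⊔ Submodule.span ℂ s
  have hsub : Submodule.span ℂ s ≤ grd μ M n := Submodule.span_le.mpr hs
  have hV : ∀ b : bPlus, ∀ v ∈ V, toU b • v ∈ V := by
    intro b v hv
    refine bPlus_smul_mem ?_ ?_ b hv
    · intro k m hm
      obtain ⟨l, hl, y, hy, rfl⟩ := Submodule.mem_sup.mp hm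
      rw [smul_add]
      refine add_mem (Submodule.mem_sup_left ((low μ M n).smul_mem _ hl)) ?_
      rcases Nat.eq_zero_or_pos k with rfl | hk
      · have h0 := d_zero_smul_of_mem_grd (hsub hy)
        rw [Nat.cast_zero, h0]
        exact Submodule.mem_sup_right (Submodule.smul_mem _ _ hy)
      · exact Submodule.mem_sup_left (pos_smul_mem_low h (hsub hy) (Int.natCast_pos.mpr hk))
    · intro m hm
      obtain ⟨l, hl, y, hy, rfl⟩ := Submodule.mem_sup.mp hm
      rw [smul_add]
      refine add_mem (Submodule.mem_sup_left ((low μ M n).smul_mem _ hl)) ?_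
      obtain ⟨c, hc⟩ := z_smul_of_mem_grd (hsub hy)
      rw [hc]
      exact Submodule.mem_sup_right (Submodule.smul_mem _ _ hy)
  have hxV : x ∈ Submodule.span UVir (V : Set M) := by
    have h1 : (low μ M n).restrictScalars ℂ ≤ V := le_sup_left
    have h2 : Submodule.span ℂ s ≤ V := le_sup_right
    have h3 : low μ M n ≤ Submodule.span UVir (V : Set M) := fun y hy =>
      Submodule.subset_span (h1 hy)
    have h4 : Submodule.span UVir s ≤ Submodule.span UVir (V : Set M) :=
      Submodule.span_mono fun y hy => h2 (Submodule.subset_span hy)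
    exact sup_le h3 h4 hx
  obtain ⟨t, rfl⟩ := span_le_range_mulMap hV hxV
  clear hx hxV
  induction t with
  | zero => rw [map_zero, map_zero]
  | add a b ha hb => rw [map_add, map_add, ha, hb, add_zero]
  | tmul a v =>
    obtain ⟨l, hl, y, hy, hv⟩ := Submodule.mem_sup.mp v.2
    have hψy : ψ y = 0 := (Submodule.span_le.mpr hψs : Submodule.span ℂ s ≤ LinearMap.ker ψ) hy
    rw [mulMap_tmul, ← hv, smul_add, map_add, hΨ _ ((low μ M n).smul_mem _ hl),
      hΨψ a y (hsub hy), hψy, zero_smul, add_zero]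

theorem exists_functional {S : Submodule UVir M} {v : M} (hv : v ∉ S) :
    ∃ ψ : M →ₗ[ℂ] ℂ, (∀ x ∈ S, ψ x = 0) ∧ ψ v = 1 := by
  obtain ⟨f, hf, hS⟩ := Submodule.exists_le_ker_of_notMem (p := S.restrictScalars ℂ) hv
  refine ⟨(f v)⁻¹ • f, fun x hx => ?_, ?_⟩
  · have : f x = 0 := hS hx
    simp [this]
  · simp [hf]

namespace IsProjSummand

variable {k : ℕ} {P : ModuleCat.{0} UVir}

/-- A vector of degree `n` outside a submodule `A` generated by `low μ P n` and vectors of degree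
`n` generates a Verma module modulo `A`. -/
theorem exists_surjective_verma (h : IsProjSummand μ k P) (n : ℕ) {s : Set P}
    (hs : ∀ x ∈ s, x ∈ grd μ P n) {v : P} (hv : v ∈ grd μ P n)
    (hvA : v ∉ low μ P n ⊔ Submodule.span UVir s) :
    ∃ f : ↥((low μ P n ⊔ Submodule.span UVir s) ⊔ Submodule.span UVir {v}) →ₗ[UVir]
      verma (μ + intWeight n), Function.Surjective f ∧
        ∀ x, f x = 0 ↔ (x : P) ∈ low μ P n ⊔ Submodule.span UVir s := by
  obtain ⟨ψ, hψ, hψv⟩ := exists_functional hvA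
  obtain ⟨Ψ, hΨ, hΨψ⟩ := h.exists_coord n ψ fun x hx => hψ x (Submodule.mem_sup_left hx)
  refine VirO.exists_surjective_verma hv
    (fun j hj => Submodule.mem_sup_left (pos_smul_mem_low h.isBdd hv hj)) fun a ha => ?_
  have h0 := coord_eq_zero h.isBdd hs
    (fun x hx => hψ x (Submodule.mem_sup_right (Submodule.subset_span hx))) hΨ hΨψ ha
  rwa [hΨψ a v hv, hψv, one_smul] at h0

theorem flag_low_sup (h : IsProjSummand μ k P) {S : Set Weight} {n : ℕ}
    (hS : (∃ x ∈ grd μ P n, x ∉ low μ P n) → μ + intWeight n ∈ S)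
    (hlow : Flag S (ModuleCat.of UVir (low μ P n))) (s : Finset P)
    (hs : ∀ x ∈ s, x ∈ grd μ P n) :
    Flag S (ModuleCat.of UVir ↥(low μ P n ⊔ Submodule.span UVir (s : Set P))) := by
  classical
  induction s using Finset.induction_on with
  | empty =>
    have h0 : low μ P n ⊔ Submodule.span UVir ((∅ : Finset P) : Set P) = low μ P n := by simp
    rwa [h0]
  | insert v s _ ih =>
    have ih := ih fun x hx => hs x (Finset.mem_insert_of_mem hx)
    have heq : low μ P n ⊔ Submodule.span UVir ((insert v s : Finset P) : Set P) =
        (low μ P n ⊔ Submodule.span UVir (s : Set P)) ⊔ Submodule.span UVir {v} := by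
      rw [Finset.coe_insert, Submodule.span_insert, sup_comm (Submodule.span UVir {v}), sup_assoc]
    rw [heq]
    have hv := hs v (Finset.mem_insert_self v s)
    by_cases hvA : v ∈ low μ P n ⊔ Submodule.span UVir (s : Set P)
    · rwa [sup_eq_left.mpr ((Submodule.span_singleton_le_iff_mem _ _).mpr hvA)]
    · obtain ⟨f, hf, hker⟩ := h.exists_surjective_verma n
        (fun x hx => hs x (Finset.mem_insert_of_mem hx)) hv hvA
      refine .step _ _ _ (hS ⟨v, hv, fun hl => hvA (Submodule.mem_sup_left hl)⟩)
        (Submodule.inclusion le_sup_left) f (Submodule.inclusion_injective _) ?_ hf ih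
      intro x
      rw [hker]
      exact ⟨fun hx => ⟨⟨x, hx⟩, rfl⟩, by rintro ⟨y, rfl⟩; exact y.2⟩

theorem finiteDimensional_grd (h : IsProjSummand μ k P) (n : ℕ) : FiniteDimensional ℂ (grd μ P n) :=
  VirO.finiteDimensional_grd h.isBdd h.finite n

/-- A summand of `bigProj μ k` has a filtration by Verma modules `M(μ + n)`, where `n` runs through
degrees with generators. -/
theorem flag_low (h : IsProjSummand μ k P) {S : Set Weight}
    (hS : ∀ n : ℕ, (∃ x ∈ grd μ P n, x ∉ low μ P n) → μ + intWeight n ∈ S) (n : ℕ) :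
    Flag S (ModuleCat.of UVir (low μ P n)) := by
  induction n with
  | zero =>
    refine .zero _ ?_
    have : low μ P 0 = ⊥ := by simp [low]
    rw [this]
    exact inferInstanceAs (Subsingleton (⊥ : Submodule UVir P))
  | succ n ih =>
    have := h.finiteDimensional_grd n
    obtain ⟨s, hs⟩ := (Module.Finite.iff_fg.mp this : (grd μ P n).FG)
    have hsub : ∀ x ∈ s, x ∈ grd μ P n := fun x hx => hs ▸ Submodule.subset_span hx
    have heq : low μ P (n + 1) = low μ P n ⊔ Submodule.span UVir (s : Set P) := by
      refine le_antisymm (Submodule.span_le.mpr ?_) (sup_le (Submodule.span_le.mpr ?_)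
        (Submodule.span_le.mpr ?_))
      · rintro x ⟨j, hj, hx⟩
        rcases Nat.lt_succ_iff_lt_or_eq.mp hj with hj | rfl
        · exact Submodule.mem_sup_left (mem_low hj hx)
        · rw [← hs] at hx
          exact Submodule.mem_sup_right (Submodule.span_le_restrictScalars ℂ UVir _ hx)
      · rintro x ⟨j, hj, hx⟩
        exact mem_low (by omega) hx
      · exact fun x hx => mem_low (by omega) (hsub x hx)
    rw [heq]
    exact h.flag_low_sup (hS n) ih s hsub

theorem low_succ_eq_top (h : IsProjSummand μ k P) : low μ P (k + 1) = ⊤ := by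
  obtain ⟨i, r, hri⟩ := h
  refine eq_top_iff.mpr fun x _ => ?_
  obtain ⟨u, hu⟩ := exists_smul_projGen (i x)
  rw [← hri x, hu, map_smul]
  exact Submodule.smul_mem _ u (mem_low (by omega) (map_mem_grd r (projGen_mem μ k)))

/-- If the summand has generators in degree `k`, a hyperplane of degree `k` containing the vectors
generated in smaller degrees gives the kernel of a surjection onto `M(μ + k)`. -/
theorem exists_verma_quotient (h : IsProjSummand μ k P) {S : Set Weight}
    (hS : ∀ n : ℕ, (∃ x ∈ grd μ P n, x ∉ low μ P n) → μ + intWeight n ∈ S)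
    (htop : low μ P k ≠ ⊤) :
    ∃ q : P →ₗ[UVir] verma (μ + intWeight k), Function.Surjective q ∧
      Flag S (ModuleCat.of UVir (LinearMap.ker q)) := by
  obtain ⟨v, hv, hvl⟩ : ∃ v ∈ grd μ P k, v ∉ low μ P k := by
    by_contra! hcon
    refine htop (eq_top_iff.mpr ?_)
    rw [← h.low_succ_eq_top]
    refine Submodule.span_le.mpr ?_
    rintro x ⟨j, hj, hx⟩
    rcases Nat.lt_succ_iff_lt_or_eq.mp hj with hj | rfl
    · exact mem_low hj hx
    · exact hcon x hx
  obtain ⟨ψ, hψ, hψv⟩ := exists_functional hvl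
  have := h.finiteDimensional_grd k
  have hfd : FiniteDimensional ℂ ↥(grd μ P k ⊓ LinearMap.ker ψ) :=
    finiteDimensional_of_le (T := grd μ P k) inf_le_left
  obtain ⟨s, hs⟩ := (Module.Finite.iff_fg.mp hfd : (grd μ P k ⊓ LinearMap.ker ψ).FG)
  have hsub : ∀ x ∈ s, x ∈ grd μ P k ⊓ LinearMap.ker ψ := fun x hx => hs ▸ Submodule.subset_span hx
  have hvA : v ∉ low μ P k ⊔ Submodule.span UVir (s : Set P) := by
    intro hmem
    obtain ⟨Ψ, hΨ, hΨψ⟩ := h.exists_coord k ψ hψ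
    have h0 := coord_eq_zero h.isBdd (fun x hx => (hsub x hx).1) (fun x hx => (hsub x hx).2)
      hΨ hΨψ hmem
    have h1 := hΨψ 1 v hv
    rw [map_one, one_smul, h0, hψv, one_smul] at h1
    refine vermaGen_ne_zero 0 ?_
    rw [← one_smul UVir (vermaGen 0), ← map_one emb, ← h1, map_zero, zero_smul]
  obtain ⟨f, hf, hker⟩ := h.exists_surjective_verma k (fun x hx => (hsub x hx).1) hv hvA
  have hall : ∀ x, x ∈ (low μ P k ⊔ Submodule.span UVir (s : Set P)) ⊔ Submodule.span UVir {v} := by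
    suffices hle : low μ P (k + 1) ≤ _ from fun x => hle (h.low_succ_eq_top ▸ trivial)
    refine Submodule.span_le.mpr ?_
    rintro x ⟨j, hj, hx⟩
    rcases Nat.lt_succ_iff_lt_or_eq.mp hj with hj | rfl
    · exact Submodule.mem_sup_left (Submodule.mem_sup_left (mem_low hj hx))
    · have hx' : x - ψ x • v ∈ Submodule.span ℂ (s : Set P) := by
        rw [hs]
        refine ⟨sub_mem hx (Submodule.smul_mem _ _ hv), ?_⟩
        simp [hψv]
      rw [← sub_add_cancel x (ψ x • v)]
      refine add_mem (Submodule.mem_sup_left (Submodule.mem_sup_right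
        (Submodule.span_le_restrictScalars ℂ UVir _ hx'))) (Submodule.mem_sup_right ?_)
      exact Submodule.smul_of_tower_mem _ _ (Submodule.mem_span_singleton_self v)
  refine ⟨f ∘ₗ LinearMap.codRestrict _ LinearMap.id hall, fun y => ?_, ?_⟩
  · obtain ⟨x, rfl⟩ := hf y
    exact ⟨x, rfl⟩
  · have heq : LinearMap.ker (f ∘ₗ LinearMap.codRestrict _ LinearMap.id hall) =
        low μ P k ⊔ Submodule.span UVir (s : Set P) := by
      ext x
      exact hker ⟨x, hall x⟩
    rw [heq]
    exact h.flag_low_sup (hS k) (h.flag_low hS k) s fun x hx => (hsub x hx).1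

theorem flag (h : IsProjSummand μ k P) {S : Set Weight}
    (hS : ∀ n : ℕ, (∃ x ∈ grd μ P n, x ∉ low μ P n) → μ + intWeight n ∈ S) : Flag S P := by
  refine (h.flag_low hS (k + 1)).of_equiv (LinearEquiv.ofTop _ h.low_succ_eq_top)

end IsProjSummand

end

section

variable {μ : Weight} {M N : ModuleCat.{0} UVir}

/-! ### The dual of a module -/

/-- The anti-involution `d_k ↦ d_{-k}`, `z ↦ z` of the Virasoro algebra. -/
def antiInv : Virasoro →ₗ[ℂ] Virasoro :=
  (LinearMap.prodMap (Finsupp.lmapDomain ℂ ℂ (Neg.neg : ℤ → ℤ)) LinearMap.id :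
    (ℤ →₀ ℂ) × ℂ →ₗ[ℂ] (ℤ →₀ ℂ) × ℂ)

theorem antiInv_d (k : ℤ) : antiInv (d k) = d (-k) := by
  refine Prod.ext ?_ rfl
  change Finsupp.mapDomain Neg.neg (Finsupp.single k (1 : ℂ)) = Finsupp.single (-k) 1
  rw [Finsupp.mapDomain_single]

theorem antiInv_z : antiInv z = z := by
  refine Prod.ext ?_ rfl
  change Finsupp.mapDomain Neg.neg (0 : ℤ →₀ ℂ) = 0
  rw [Finsupp.mapDomain_zero]

theorem antiInv_antiInv (x : Virasoro) : antiInv (antiInv x) = x := by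
  refine Prod.ext ?_ rfl
  change Finsupp.mapDomain Neg.neg (Finsupp.mapDomain Neg.neg x.1) = x.1
  rw [← Finsupp.mapDomain_comp, neg_comp_neg, Finsupp.mapDomain_id]

theorem antiInv_lie (x y : Virasoro) : antiInv ⁅x, y⁆ = ⁅antiInv y, antiInv x⁆ := by
  have hx : x ∈ Submodule.span ℂ (Set.range d ∪ {z}) := span_eq_top ▸ Submodule.mem_top
  have hy : y ∈ Submodule.span ℂ (Set.range d ∪ {z}) := span_eq_top ▸ Submodule.mem_top
  have hzd : ∀ k, ⁅z, d k⁆ = 0 := fun k => by rw [← lie_skew, lie_d_z, neg_zero]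
  induction hx using Submodule.span_induction with
  | mem x hx =>
    induction hy using Submodule.span_induction with
    | mem y hy =>
      rcases hx with ⟨j, rfl⟩ | rfl <;> rcases hy with ⟨k, rfl⟩ | rfl
      · rw [lie_d_d, map_add, map_smul, map_smul, antiInv_d, antiInv_d, antiInv_d, antiInv_z,
          lie_d_d]
        congr 1
        · rw [neg_add_rev]
          congr 1
          push_cast; ring
        · congr 1
          by_cases h : j = -k
          · subst h
            rw [if_pos rfl, if_pos (by ring)]
          · rw [if_neg h, if_neg (by omega)]
      · rw [antiInv_z, antiInv_d, hzd, lie_d_z, map_zero]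
      · rw [antiInv_z, antiInv_d, hzd, lie_d_z, map_zero]
      · rw [lie_self, antiInv_z, lie_self, map_zero]
    | zero => simp only [lie_zero, map_zero, zero_lie]
    | add a b _ _ ha hb => simp only [lie_add, map_add, add_lie, ha, hb]
    | smul c a _ ha => simp only [lie_smul, map_smul, smul_lie, ha]
  | zero => simp only [lie_zero, map_zero, zero_lie]
  | add a b _ _ ha hb => simp only [lie_add, map_add, add_lie, ha, hb]
  | smul c a _ ha => simp only [lie_smul, map_smul, smul_lie, ha]

/-- The representation on the full dual of a module, twisted by `antiInv`. -/
def dualRep (M : ModuleCat.{0} UVir) : Virasoro →ₗ⁅ℂ⁆ Module.End ℂ (Module.Dual ℂ M) where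
  toFun x := (act M (toU (antiInv x))).dualMap
  map_add' x y := by
    refine LinearMap.ext fun f => LinearMap.ext fun m => ?_
    change f (toU (antiInv (x + y)) • m) = f (toU (antiInv x) • m) + f (toU (antiInv y) • m)
    rw [map_add, toU, map_add, add_smul, map_add]
  map_smul' c x := by
    refine LinearMap.ext fun f => LinearMap.ext fun m => ?_
    change f (toU (antiInv (c • x)) • m) = c • f (toU (antiInv x) • m)
    rw [LinearMap.map_smul, show toU (c • antiInv x) = c • toU (antiInv x) from map_smul _ _ _,
      smul_assoc, LinearMap.map_smul]
  map_lie' {x y} := by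
    refine LinearMap.ext fun f => LinearMap.ext fun m => ?_
    rw [LieRing.of_associative_ring_bracket]
    change f (toU (antiInv ⁅x, y⁆) • m) =
      f (toU (antiInv y) • toU (antiInv x) • m) - f (toU (antiInv x) • toU (antiInv y) • m)
    rw [antiInv_lie, lie_smul_eq (antiInv y), map_add, add_sub_cancel_left]

/-- The full dual of a module, with the action twisted by `antiInv`. -/
def dualModule (M : ModuleCat.{0} UVir) : ModuleCat.{0} UVir := repModule (dualRep M)

/-- The elements of the dual module as functionals. -/
def evalAt (f : dualModule M) : Module.Dual ℂ M := (repEquiv (dualRep M)).symm f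

theorem evalAt_smul (x : Virasoro) (f : dualModule M) (m : M) :
    evalAt (toU x • f) m = evalAt f (toU (antiInv x) • m) := by
  obtain ⟨f, rfl⟩ := (repEquiv (dualRep M)).surjective f
  exact LinearMap.congr_fun
    (congrArg (repEquiv (dualRep M)).symm (toU_smul_repEquiv (dualRep M) x f)) m

theorem evalAt_add (f g : dualModule M) : evalAt (f + g) = evalAt f + evalAt g :=
  map_add (repEquiv (dualRep M)).symm f g

theorem evalAt_csmul (c : ℂ) (f : dualModule M) : evalAt (c • f) = c • evalAt f :=
  map_smul (repEquiv (dualRep M)).symm c f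

theorem evalAt_zero : evalAt (0 : dualModule M) = 0 := map_zero (repEquiv (dualRep M)).symm

theorem evalAt_injective : Function.Injective (evalAt (M := M)) :=
  (repEquiv (dualRep M)).symm.injective

/-- A functional of degree `n` vanishes on the other degrees. -/
theorem evalAt_eq_zero {n k : ℤ} (hnk : k ≠ n) {f : dualModule M} (hf : f ∈ grd μ (dualModule M) n)
    {m : M} (hm : m ∈ grd μ M k) : evalAt f m = 0 := by
  have h1 := evalAt_smul (d 0) f m
  rw [d_zero_smul_of_mem_grd hf, antiInv_d, neg_zero, d_zero_smul_of_mem_grd hm, evalAt_csmul,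
    map_smul, LinearMap.smul_apply, ← sub_eq_zero, ← sub_smul] at h1
  refine (smul_eq_zero.mp h1).resolve_left fun h2 => hnk ?_
  have h3 : (n : ℂ) = k := by linear_combination h2
  exact_mod_cast h3.symm

/-- A functional concentrated in degree `n` has degree `n`. -/
theorem mem_grd_dualModule (h : IsBdd μ M) {n : ℤ} {f : dualModule M}
    (hf : ∀ k : ℕ, (k : ℤ) ≠ n → ∀ m ∈ grd μ M k, evalAt f m = 0) :
    f ∈ grd μ (dualModule M) n := by
  have key : ∀ (x : Virasoro) (c : ℂ), antiInv x = x →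
      (∀ m ∈ grd μ M n, toU x • m = c • m) →
      (∀ k, ∀ m ∈ grd μ M k, toU x • m ∈ grd μ M k) → toU x • f = c • f := by
    intro x c hx hc hk
    refine evalAt_injective (LinearMap.ext fun m => ?_)
    rw [evalAt_smul, evalAt_csmul, hx, LinearMap.smul_apply]
    induction m using h.induction with
    | zero => simp only [smul_zero, map_zero]
    | add a b ha hb => simp only [smul_add, map_add, ha, hb]
    | mem k m hm =>
      by_cases hkn : (k : ℤ) = n
      · rw [hc m (hkn ▸ hm), map_smul]
      · rw [hf k hkn m hm, hf k hkn _ (hk k m hm), smul_zero]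
  refine mem_weightSpace_iff.mpr ⟨key _ _ (by rw [antiInv_d, neg_zero])
    (fun m hm => (mem_weightSpace_iff.mp hm).1) fun k m hm => ?_,
    key _ _ antiInv_z (fun m hm => (mem_weightSpace_iff.mp hm).2) fun k m hm => ?_⟩
  · rw [d_zero_smul_of_mem_grd hm]
    exact Submodule.smul_mem _ _ hm
  · obtain ⟨c, hc⟩ := z_smul_of_mem_grd hm
    rw [hc]
    exact Submodule.smul_mem _ _ hm

/-- If `P` covers `L(μ + k)` and has generators in degree `n`, then `L(μ + k)` is a subquotient of
`M(μ + n)`. A functional on these generators is a singular vector of degree `n` in the dual of `P`,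
and the submodule generated by it contains the functionals on `L(μ + k)` of degree `k`. -/
theorem preceq_of_essential {P : ModuleCat.{0} UVir} (hP : IsBdd μ P)
    (hfd : ∀ j : ℕ, FiniteDimensional ℂ (grd μ P j)) {k n : ℕ}
    (p : P →ₗ[UVir] simple (μ + intWeight k)) (hp : Function.Surjective p) (hess : IsEssentialMap p)
    (hn : ∃ x ∈ grd μ P n, x ∉ low μ P n) : Preceq (μ + intWeight k) (μ + intWeight n) := by
  obtain ⟨x, hx, hxl⟩ := hn
  obtain ⟨ψ₀, hψ₀, hψx⟩ := exists_functional hxl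
  have hL := isBdd_simple μ (n := k) (by omega)
  -- the singular functional `ψ` of degree `n`
  let ψ : dualModule P := repEquiv (dualRep P) (ψ₀ ∘ₗ comp hP n)
  have hψ : ∀ m, evalAt ψ m = ψ₀ (comp hP n m) := fun m => rfl
  have hψn : ψ ∈ grd μ (dualModule P) n := mem_grd_dualModule hP fun j hj m hm => by
    rw [hψ, comp_of_ne hP hj hm, map_zero]
  have hψs : ∀ j : ℤ, 0 < j → toU (d j) • ψ = 0 := by
    intro j hj
    refine evalAt_injective (LinearMap.ext fun m => ?_)
    rw [evalAt_smul, antiInv_d, hψ, evalAt_zero, LinearMap.zero_apply]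
    induction m using hP.induction with
    | zero => simp only [smul_zero, map_zero]
    | add a b ha hb => simp only [smul_add, map_add, ha, hb, add_zero]
    | mem s m hm =>
      have hm' := d_smul_mem_grd (-j) hm
      by_cases hs : (s : ℤ) - -j = n
      · rw [hs] at hm'
        rw [comp_of_mem hP hm']
        exact hψ₀ _ (Submodule.smul_mem _ _ (mem_low (by omega) hm))
      · rw [comp_of_ne hP hs hm', map_zero]
  have hψ0 : evalAt ψ x ≠ 0 := by
    rw [hψ, comp_of_mem hP hx, hψx]
    exact one_ne_zero
  let F : verma (μ + intWeight n) →ₗ[UVir] dualModule P := vermaLift hψn hψs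
  have hV := isBdd_verma μ (n := n) (by omega)
  -- the functional `g₀` on `L(μ + k)`
  obtain ⟨lam, -, hlam⟩ := exists_functional (M := simple (μ + intWeight k)) (S := ⊥)
    (v := simpleGen (μ + intWeight k))
    fun h => simpleGen_ne_zero _ ((Submodule.mem_bot _).mp h)
  let G : Submodule ℂ P := grd μ P k
  have := hfd k
  let res : verma (μ + intWeight n) →ₗ[ℂ] Module.Dual ℂ G :=
    { toFun := fun m => evalAt (F m) ∘ₗ G.subtype
      map_add' := fun a b => by rw [map_add, evalAt_add, LinearMap.add_comp]
      map_smul' := fun c a => by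
        rw [LinearMap.map_smul_of_tower, evalAt_csmul, LinearMap.smul_comp]; rfl }
  let E : Submodule ℂ (Module.Dual ℂ G) := (grd μ (verma (μ + intWeight n)) k).map res
  let g₀ : Module.Dual ℂ G := lam ∘ₗ p.restrictScalars ℂ ∘ₗ G.subtype
  have hcomp : ∀ (m : verma (μ + intWeight n)) (y : G), res m y = res (comp hV k m) y := by
    intro m y
    induction m using hV.induction with
    | zero => simp only [map_zero]
    | add a b ha hb => simp only [map_add, LinearMap.add_apply, ha, hb]
    | mem s m hm =>
      by_cases hs : (s : ℤ) = k
      · rw [comp_of_mem hV (hs ▸ hm)]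
      · rw [comp_of_ne hV hs hm, map_zero]
        exact evalAt_eq_zero (Ne.symm hs) (map_mem_grd F hm) y.2
  -- the annihilator of the submodule generated by `ψ` is contained in the kernel of `p`
  let A : Submodule UVir P :=
    { carrier := {y | ∀ m, evalAt (F m) y = 0}
      zero_mem' := fun m => map_zero _
      add_mem' := fun ha hb m => by rw [map_add, ha m, hb m, add_zero]
      smul_mem' := by
        intro u y hy
        let S : Submodule ℂ P :=
          { carrier := {y | ∀ m, evalAt (F m) y = 0}
            zero_mem' := fun m => map_zero _
            add_mem' := fun ha hb m => by rw [map_add, ha m, hb m, add_zero]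
            smul_mem' := fun c y hy m => by rw [map_smul, hy m, smul_zero] }
        refine uea_smul_mem S (fun v y hy m => ?_) u hy
        change evalAt (F m) (toU v • y) = 0
        rw [← antiInv_antiInv v, ← evalAt_smul, ← map_smul]
        exact hy _ }
  have hA : A ≤ LinearMap.ker p := by
    by_contra hcon
    have hxA : x ∈ A := hess A hcon ▸ Submodule.mem_top
    have h1 : F (vermaGen _) = ψ := vermaLift_gen _ _
    exact hψ0 (h1 ▸ hxA (vermaGen _))
  have hg₀ : g₀ ∈ E := by
    rw [← Subspace.dualCoannihilator_dualAnnihilator_eq (W := E)]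
    refine (Submodule.mem_dualAnnihilator _).mpr fun y hy => ?_
    have hyA : (y : P) ∈ A := by
      intro m
      change res m y = 0
      rw [hcomp]
      exact (Submodule.mem_dualCoannihilator _).mp hy _ ⟨_, comp_mem hV k m, rfl⟩
    change lam (p y) = 0
    rw [show p y = 0 from hA hyA, map_zero]
  obtain ⟨m, hm, hmg⟩ := hg₀
  have hFm := map_mem_grd F hm
  have hval : ∀ y ∈ grd μ P k, evalAt (F m) y = lam (p y) := fun y hy =>
    LinearMap.congr_fun hmg ⟨y, hy⟩
  -- `F m` is a singular vector of degree `k` in the submodule generated by `ψ`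
  have hsing : ∀ j : ℤ, 0 < j → toU (d j) • F m = 0 := by
    intro j hj
    refine evalAt_injective (LinearMap.ext fun y => ?_)
    rw [evalAt_smul, antiInv_d, evalAt_zero, LinearMap.zero_apply]
    induction y using hP.induction with
    | zero => simp only [smul_zero, map_zero]
    | add a b ha hb => simp only [smul_add, map_add, ha, hb, add_zero]
    | mem s y hy =>
      have hy' := d_smul_mem_grd (-j) hy
      by_cases hs : (s : ℤ) - -j = k
      · rw [hs] at hy'
        have h0 : p y = 0 := by
          rw [← comp_of_mem hL (map_mem_grd p hy)]
          exact comp_simple_eq_zero (by omega) (by omega) hL _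
        rw [hval _ hy', map_smul, h0, smul_zero, map_zero]
      · exact evalAt_eq_zero hs hFm hy'
  have hne : F m ≠ 0 := by
    intro h0
    obtain ⟨y, hy, hpy⟩ := exists_mem_grd_map_eq hP hL hp (n := k) (simpleGen_mem _)
    have h1 := hval y hy
    rw [h0, evalAt_zero, hpy, hlam] at h1
    exact zero_ne_one h1
  let K : ModuleCat.{0} UVir := ModuleCat.of UVir (LinearMap.range F)
  have hsub : IsSubquotient (simple (μ + intWeight k)) K := by
    refine isSubquotient_of_singular (M := K) (v := ⟨F m, m, rfl⟩)
      (fun h => hne (congrArg Subtype.val h))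
      (mem_weightSpace_of_map (f := (LinearMap.range F).subtype)
        (Submodule.subtype_injective _) hFm)
      fun j hj => Subtype.ext (hsing j hj)
  exact hsub.of_surjective (N := K) F.rangeRestrict F.surjective_rangeRestrict

/-- Each `L(μ + n)`, `n ≥ 0`, has an essential cover by a summand of `bigProj μ n`, which has a flag
with top `M(μ + n)` and subquotients `M(δ)` with `μ + n ⪯ δ`. -/
theorem exists_cover (μ : Weight) (n : ℕ) :
    ∃ (P : ModuleCat.{0} UVir) (p : P →ₗ[UVir] simple (μ + intWeight n)),
      IsProjSummand μ n P ∧ Function.Surjective p ∧ IsEssentialMap p ∧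
      Flag {δ | Preceq (μ + intWeight n) δ} P ∧
      ∃ q : P →ₗ[UVir] verma (μ + intWeight n), Function.Surjective q ∧
        Flag {δ | Preceq (μ + intWeight n) δ} (ModuleCat.of UVir (LinearMap.ker q)) := by
  obtain ⟨P, p, hP, hp, hess⟩ := exists_essential_summand μ n
  have hS : ∀ j : ℕ, (∃ x ∈ grd μ P j, x ∉ low μ P j) →
      μ + intWeight j ∈ {δ | Preceq (μ + intWeight n) δ} := fun j hj =>
    preceq_of_essential hP.isBdd hP.finiteDimensional_grd p hp hess hj
  refine ⟨P, p, hP, hp, hess, hP.flag hS, hP.exists_verma_quotient hS fun htop => ?_⟩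
  have hL := isBdd_simple μ (n := n) (by omega)
  obtain ⟨y, hy⟩ := hp (simpleGen _)
  have h1 : simpleGen (μ + intWeight n) ∈ low μ (simple (μ + intWeight n)) n := by
    rw [← hy]
    exact map_mem_low p (htop ▸ Submodule.mem_top)
  have h2 : low μ (simple (μ + intWeight n)) n = ⊥ := by
    refine eq_bot_iff.mpr (Submodule.span_le.mpr ?_)
    rintro x ⟨s, hs, hx⟩
    rw [← comp_of_mem hL hx]
    exact comp_simple_eq_zero (by omega) (by omega) hL _
  rw [h2] at h1
  exact simpleGen_ne_zero _ ((Submodule.mem_bot _).mp h1)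

end

section

variable {μ : Weight} {M N : ModuleCat.{0} UVir}

/-! ### Bounded blocks -/

/-- All weights of `Λ` are of the form `μ + n` with `n ≥ 0`. -/
def IsBoundedBy (μ : Weight) (Λ : Set Weight) : Prop := ∀ γ ∈ Λ, ∃ n : ℕ, γ = μ + intWeight n

theorem exists_eq_of_mem_weightSpace (h : IsBdd μ M) {γ : Weight} {m : M} (hm : m ∈ weightSpace M γ)
    (h0 : m ≠ 0) : ∃ n : ℕ, γ = μ + intWeight n := by
  by_contra! hcon
  refine h0 ((Submodule.mem_bot ℂ).mp ?_)
  have hd := iSupIndep_weightSpace M γ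
  refine hd.le_bot ⟨hm, ?_⟩
  have htop : m ∈ ⨆ n : ℕ, grd μ M n := h ▸ Submodule.mem_top
  refine (iSup_le fun n => ?_ : (⨆ n : ℕ, grd μ M n) ≤ _) htop
  exact le_iSup₂_of_le (f := fun j (_ : j ≠ γ) => weightSpace M j) (μ + intWeight n)
    (fun h => hcon n h.symm) le_rfl

theorem Preceq.exists_eq {γ δ : Weight} (h : Preceq γ δ) : ∃ n : ℕ, γ = δ + intWeight n := by
  obtain ⟨K, f, hf⟩ := h
  have hV : IsBdd δ (verma δ) := by
    have := isBdd_verma δ (n := 0) le_rfl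
    rwa [intWeight_zero, add_zero] at this
  exact exists_eq_of_mem_weightSpace ((hV.submodule K).of_surjective (N := simple γ) f hf)
    (simpleGen_mem γ) (simpleGen_ne_zero γ)

theorem IsBlock.mem_of_preceq {Λ : Set Weight} (hΛ : IsBlock Λ) {γ δ : Weight} (h : Preceq γ δ) :
    γ ∈ Λ ↔ δ ∈ Λ := by
  obtain ⟨μ, rfl⟩ := hΛ
  exact ⟨fun hγ => hγ.trans _ _ _ (.rel _ _ h), fun hδ => hδ.trans _ _ _ (.symm _ _ (.rel _ _ h))⟩

/-- A block with a maximal element is bounded by this element. -/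
theorem IsBlock.exists_isBoundedBy {Λ : Set Weight} (hΛ : IsBlock Λ)
    (hmax : ∃ μ ∈ Λ, ∀ γ ∈ Λ, ¬ WeightLT μ γ) : ∃ μ, IsBoundedBy μ Λ := by
  obtain ⟨μ, hμ, hmax⟩ := hmax
  have hint : ∀ γ δ : Weight, Relation.EqvGen Preceq γ δ → ∃ n : ℤ, γ = δ + intWeight n := by
    intro γ δ h
    induction h with
    | rel γ δ h =>
      obtain ⟨n, hn⟩ := h.exists_eq
      exact ⟨n, hn⟩
    | refl γ => exact ⟨0, by rw [intWeight_zero, add_zero]⟩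
    | symm γ δ _ ih =>
      obtain ⟨n, rfl⟩ := ih
      exact ⟨-n, by rw [add_assoc, ← intWeight_add, add_neg_cancel, intWeight_zero, add_zero]⟩
    | trans α β γ _ _ ih₁ ih₂ =>
      obtain ⟨m, rfl⟩ := ih₁
      obtain ⟨n, rfl⟩ := ih₂
      exact ⟨n + m, by rw [add_assoc, ← intWeight_add]⟩
  refine ⟨μ, fun γ hγ => ?_⟩
  have hμγ : Relation.EqvGen Preceq μ γ := by
    obtain ⟨β, rfl⟩ := hΛ
    exact (Relation.EqvGen.symm _ _ hμ).trans _ _ _ hγ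
  obtain ⟨n, hn⟩ := hint μ γ hμγ
  have hn0 : n ≤ 0 := not_lt.mp fun h => hmax γ hγ ⟨n, h, hn⟩
  obtain ⟨j, hj⟩ := Int.eq_ofNat_of_zero_le (neg_nonneg.mpr hn0)
  refine ⟨j, ?_⟩
  rw [← hj, hn, add_assoc, ← intWeight_add, add_neg_cancel, intWeight_zero, add_zero]

/-! ### Objects and morphisms of a block -/

section Block

variable {Λ : Set Weight} {X Y Z : BlockCat Λ}

/-- The morphism of a block given by a linear map. -/
def homOf (f : X.obj →ₗ[UVir] Y.obj) : X ⟶ Y := ObjectProperty.homMk (ModuleCat.ofHom f)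

theorem homOf_hom (f : X.obj →ₗ[UVir] Y.obj) : (homOf f).hom.hom = f := rfl

theorem block_hom_ext {f g : X ⟶ Y} (h : ∀ x : X.obj, f.hom.hom x = g.hom.hom x) : f = g :=
  ObjectProperty.hom_ext _ (ModuleCat.hom_ext (LinearMap.ext h))

theorem block_comp_apply (f : X ⟶ Y) (g : Y ⟶ Z) (x : X.obj) :
    (f ≫ g).hom.hom x = g.hom.hom (f.hom.hom x) := rfl

theorem IsBoundedBy.isBdd (hμ : IsBoundedBy μ Λ) (X : BlockCat Λ) : IsBdd μ X.obj :=
  isBdd_of_subquotient X.property.1 fun γ hγ => hμ γ (X.property.2 γ hγ)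

theorem blockProperty.of_surjective (hM : blockProperty Λ M) (f : M →ₗ[UVir] N)
    (hf : Function.Surjective f) : blockProperty Λ N :=
  ⟨hM.1.of_surjective f hf, fun γ hγ => hM.2 γ (hγ.of_surjective f hf)⟩

theorem Flag.mem_block {S : Set Weight} (h : Flag S M) (hM : IsBdd μ M) (hΛ : IsBlock Λ)
    (hS : S ⊆ Λ) : blockProperty Λ M := by
  refine ⟨hM.inCategoryO h.finite, fun γ hγ => ?_⟩
  obtain ⟨δ, hδ, hγδ⟩ := h.exists_preceq hγ
  exact (hΛ.mem_of_preceq hγδ).mpr (hS hδ)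

/-- Epimorphisms of a block are surjective, as a block is closed under quotients. -/
theorem surjective_of_epi (f : X ⟶ Y) [Epi f] : Function.Surjective f.hom.hom := by
  let R := LinearMap.range f.hom.hom
  let Q : BlockCat Λ := ⟨ModuleCat.of UVir (Y.obj ⧸ R),
    blockProperty.of_surjective Y.property R.mkQ R.mkQ_surjective⟩
  have h : f ≫ (homOf R.mkQ : Y ⟶ Q) = f ≫ 0 := block_hom_ext fun x =>
    (Submodule.Quotient.mk_eq_zero R).mpr ⟨x, rfl⟩
  have h' := (cancel_epi f).mp h
  refine LinearMap.range_eq_top.mp (eq_top_iff.mpr fun y _ => ?_)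
  refine (Submodule.Quotient.mk_eq_zero R).mp ?_
  exact congrArg (fun g : Y ⟶ Q => g.hom.hom y) h'

theorem epi_of_surjective (f : X ⟶ Y) (hf : Function.Surjective f.hom.hom) : Epi f where
  left_cancellation g h hgh := block_hom_ext fun y => by
    obtain ⟨x, rfl⟩ := hf y
    exact congrArg (fun k => k.hom.hom x) hgh

theorem exists_lift_of_projective {P : BlockCat Λ} (hP : Projective P) {f : X ⟶ Y}
    (hf : Function.Surjective f.hom.hom) (g : P ⟶ Y) : ∃ k : P ⟶ X, k ≫ f = g :=
  have := epi_of_surjective f hf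
  hP.factors g f

/-- Lifting through an exact sequence `X ⟶ Y ⟶ Z`. -/
theorem exists_lift_of_exact {P : BlockCat Λ} (hP : Projective P) {f : X ⟶ Y} {g : Y ⟶ Z}
    (hfg : Function.Exact f.hom.hom g.hom.hom) (k : P ⟶ Y) (hk : k ≫ g = 0) :
    ∃ l : P ⟶ X, l ≫ f = k := by
  let R := LinearMap.range f.hom.hom
  let Q : BlockCat Λ := ⟨ModuleCat.of UVir R,
    blockProperty.of_surjective X.property f.hom.hom.rangeRestrict
      f.hom.hom.surjective_rangeRestrict⟩
  have hkR : ∀ x, k.hom.hom x ∈ R := fun x =>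
    (hfg _).mp (congrArg (fun h => h.hom.hom x) hk)
  obtain ⟨l, hl⟩ := exists_lift_of_projective hP (X := X) (Y := Q)
    (f := homOf f.hom.hom.rangeRestrict) f.hom.hom.surjective_rangeRestrict
    (homOf (k.hom.hom.codRestrict R hkR))
  refine ⟨l, block_hom_ext fun x => ?_⟩
  exact congrArg Subtype.val (congrArg (fun h : P ⟶ Q => h.hom.hom x) hl)

theorem IsProjSummand.projective (hμ : IsBoundedBy μ Λ) {n : ℕ} {P : BlockCat Λ}
    (h : IsProjSummand μ n P.obj) : Projective P where
  factors {E X} f e _ := by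
    obtain ⟨k, hk⟩ := h.exists_lift (hμ.isBdd E) (hμ.isBdd X) (surjective_of_epi e) f.hom.hom
    exact ⟨homOf k, block_hom_ext hk⟩

/-! ### Projective covers in a block -/

theorem IsEssentialMap.isProjectiveCover {p : X ⟶ Y} (hX : Projective X)
    (hp : Function.Surjective p.hom.hom) (hess : IsEssentialMap p.hom.hom)
    (hne : ∃ x, p.hom.hom x ≠ 0) : IsProjectiveCover p where
  projective := hX
  epi := epi_of_surjective p hp
  essential {Q} q _ := by
    have hs := surjective_of_epi (q ≫ p)
    refine epi_of_surjective q (LinearMap.range_eq_top.mp (hess _ fun hle => ?_))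
    obtain ⟨x, hx⟩ := hne
    obtain ⟨y, hy⟩ := hs (p.hom.hom x)
    exact hx (hy ▸ hle ⟨y, rfl⟩)

/-- The cover of `L(γ)` by a summand of `bigProj μ n`, `γ = μ + n`, belongs to the block and is
projective there. -/
theorem exists_block_cover (hΛ : IsBlock Λ) (hμ : IsBoundedBy μ Λ) (γ : Λ) :
    ∃ (P : BlockCat Λ) (p : P ⟶ simpleObj hΛ γ), Projective P ∧ Function.Surjective p.hom.hom ∧
      IsEssentialMap p.hom.hom ∧
      ∃ q : P.obj →ₗ[UVir] verma γ, Function.Surjective q ∧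
        Flag {δ | Preceq γ δ} (ModuleCat.of UVir (LinearMap.ker q)) := by
  obtain ⟨γ, hγ⟩ := γ
  obtain ⟨n, rfl⟩ := hμ γ hγ
  obtain ⟨P, p, hP, hp, hess, hflag, q, hq, hker⟩ := exists_cover μ n
  have hblock : blockProperty Λ P :=
    hflag.mem_block hP.isBdd hΛ fun δ hδ => (hΛ.mem_of_preceq hδ).mp hγ
  exact ⟨⟨P, hblock⟩, homOf (Y := simpleObj hΛ ⟨_, hγ⟩) p, IsProjSummand.projective hμ hP, hp, hess,
    q, hq, hker⟩

theorem exists_isProjectiveCover (hΛ : IsBlock Λ) (hμ : IsBoundedBy μ Λ) (γ : Λ) :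
    ∃ (P : BlockCat Λ) (p : P ⟶ simpleObj hΛ γ), IsProjectiveCover p := by
  obtain ⟨P, p, hP, hp, hess, -⟩ := exists_block_cover hΛ hμ γ
  obtain ⟨x, hx⟩ := hp (simpleGen (γ : Weight))
  exact ⟨P, p, hess.isProjectiveCover hP hp ⟨x, hx ▸ simpleGen_ne_zero _⟩⟩

/-- Every projective cover of `L(γ)` in the block has a flag with top `M(γ)`. -/
theorem IsProjectiveCover.exists_verma_quotient {hΛ : IsBlock Λ} (hμ : IsBoundedBy μ Λ) {γ : Λ}
    {P : BlockCat Λ} {p : P ⟶ simpleObj hΛ γ} (hp : IsProjectiveCover p) :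
    ∃ q : P.obj →ₗ[UVir] verma γ, Function.Surjective q ∧
      Flag {δ | Preceq γ δ} (ModuleCat.of UVir (LinearMap.ker q)) := by
  obtain ⟨P', p', hP', hp', hess, q, hq, hker⟩ := exists_block_cover hΛ hμ γ
  have := hp.epi
  -- a lift `P ⟶ P'` is surjective as `p'` is essential, and its section is surjective as `p` is
  obtain ⟨a, ha⟩ := exists_lift_of_projective hp.projective hp' p
  have has : Function.Surjective a.hom.hom := by
    refine LinearMap.range_eq_top.mp (hess _ fun hle => ?_)
    obtain ⟨x, hx⟩ := surjective_of_epi p (simpleGen (γ : Weight))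
    refine simpleGen_ne_zero (γ : Weight) ?_
    rw [← hx, ← ha]
    exact hle ⟨x, rfl⟩
  obtain ⟨s, hs⟩ := exists_lift_of_projective hP' has (𝟙 P')
  have hsp : s ≫ p = p' := by rw [← ha, ← Category.assoc, hs, Category.id_comp]
  have hse : Epi s := hp.essential s (by rw [hsp]; exact epi_of_surjective p' hp')
  have hss := surjective_of_epi s
  have hsa : ∀ x, a.hom.hom (s.hom.hom x) = x := fun x => congrArg (fun h => h.hom.hom x) hs
  have hai : Function.Injective a.hom.hom := by
    intro x y hxy
    obtain ⟨x, rfl⟩ := hss x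
    obtain ⟨y, rfl⟩ := hss y
    rw [hsa, hsa] at hxy
    rw [hxy]
  let e := LinearEquiv.ofBijective a.hom.hom ⟨hai, has⟩
  refine ⟨q ∘ₗ a.hom.hom, hq.comp has, hker.of_equiv (M := ModuleCat.of UVir (LinearMap.ker q))
    (N := ModuleCat.of UVir (LinearMap.ker (q ∘ₗ a.hom.hom))) ?_⟩
  exact (LinearEquiv.ofSubmodule' e (LinearMap.ker q)).symm

/-! ### Projective resolutions of modules with a Verma flag -/

variable (P : Λ → BlockCat Λ)

/-- `T` is a direct summand of a finite direct sum of modules `P(γ)`, `γ ∈ Ω`. -/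
def IsAdd (Ω : Set Λ) (T : ModuleCat.{0} UVir) : Prop :=
  ∃ (ι : Type) (_ : Fintype ι) (δ : ι → Λ) (a : ∀ i, T →ₗ[UVir] (P (δ i)).obj)
    (b : ∀ i, (P (δ i)).obj →ₗ[UVir] T), (∀ i, δ i ∈ Ω) ∧ ∀ x, ∑ i, b i (a i x) = x

variable {P}

theorem IsAdd.projective {Ω : Set Λ} (hP : ∀ γ, Projective (P γ)) {T : BlockCat Λ}
    (h : IsAdd P Ω T.obj) : Projective T where
  factors {E X} f e _ := by
    obtain ⟨ι, _, δ, a, b, -, hab⟩ := h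
    choose k hk using fun i => exists_lift_of_projective (hP (δ i)) (surjective_of_epi e)
      ((homOf (b i) : P (δ i) ⟶ T) ≫ f)
    refine ⟨homOf (∑ i, (k i).hom.hom ∘ₗ a i), block_hom_ext fun x => ?_⟩
    have hk' : ∀ i y, e.hom.hom ((k i).hom.hom y) = f.hom.hom (b i y) := fun i y =>
      congrArg (fun h => h.hom.hom y) (hk i)
    rw [block_comp_apply, homOf_hom, LinearMap.sum_apply, map_sum]
    simp only [LinearMap.comp_apply, hk']
    rw [← map_sum, hab]

theorem IsAdd.of_subsingleton (Ω : Set Λ) {T : ModuleCat.{0} UVir} (h : Subsingleton T) :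
    IsAdd P Ω T :=
  ⟨PEmpty, inferInstance, PEmpty.elim, fun i => i.elim, fun i => i.elim, fun i => i.elim,
    fun _ => Subsingleton.elim _ _⟩

theorem IsAdd.prod {Ω : Set Λ} {T : ModuleCat.{0} UVir} (h : IsAdd P Ω T) {γ : Λ} (hγ : γ ∈ Ω) :
    IsAdd P Ω (ModuleCat.of UVir (T × (P γ).obj)) := by
  obtain ⟨ι, _, δ, a, b, hδ, hab⟩ := h
  refine ⟨Option ι, inferInstance, fun i => i.elim γ δ,
    fun i => match i with
      | none => LinearMap.snd UVir T (P γ).obj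
      | some i => a i ∘ₗ LinearMap.fst UVir T (P γ).obj,
    fun i => match i with
      | none => LinearMap.inr UVir T (P γ).obj
      | some i => LinearMap.inl UVir T (P γ).obj ∘ₗ b i, ?_, ?_⟩
  · rintro (_ | i)
    · exact hγ
    · exact hδ i
  · rintro ⟨t, p⟩
    rw [Fintype.sum_option]
    have h1 : ∑ i, LinearMap.inl UVir T (P γ).obj (b i (a i t)) = (t, 0) := by
      rw [← map_sum, hab]
      rfl
    refine (congrArg (((0 : T), p) + ·) h1).trans ?_
    simp

/-- The weights of a subset `Ω` of a block. -/
def weightsOf (Ω : Set Λ) : Set Weight := {γ | ∃ h : γ ∈ Λ, ⟨γ, h⟩ ∈ Ω}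

theorem weightsOf_subset (Ω : Set Λ) : weightsOf Ω ⊆ Λ := fun _ h => h.1

/-- A module with a Verma flag in a coideal `Ω` is a quotient of a sum of modules `P(γ)`, `γ ∈ Ω`,
such that the kernel has a Verma flag in `Ω`. -/
theorem Flag.exists_cover {hΛ : IsBlock Λ} (hμ : IsBoundedBy μ Λ)
    {p : ∀ γ : Λ, P γ ⟶ simpleObj hΛ γ} (hp : ∀ γ : Λ, IsProjectiveCover (p γ))
    {Ω : Set Λ} (hΩ : IsCoideal Ω) {X : ModuleCat.{0} UVir} (hX : Flag (weightsOf Ω) X)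
    (hB : IsBdd μ X) :
    ∃ (T : ModuleCat.{0} UVir) (g : T →ₗ[UVir] X), IsAdd P Ω T ∧ IsBdd μ T ∧
      Function.Surjective g ∧ Flag (weightsOf Ω) (ModuleCat.of UVir (LinearMap.ker g)) := by
  induction hX with
  | zero X h =>
    refine ⟨X, LinearMap.id, IsAdd.of_subsingleton Ω h, hB, Function.surjective_id, .zero _ ?_⟩
    exact ⟨fun a b => Subtype.ext (Subsingleton.elim _ _)⟩
  | step A X δ hδ j f hj hjf hf hA ih =>
    obtain ⟨T, g, hT, hTB, hg, hker⟩ := ih (hB.of_injective j hj)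
    obtain ⟨hδΛ, hδΩ⟩ := hδ
    have hXΛ : blockProperty Λ X := (Flag.step A X δ (S := weightsOf Ω) ⟨hδΛ, hδΩ⟩ j f hj hjf hf
      hA).mem_block hB hΛ (weightsOf_subset Ω)
    let γ : Λ := ⟨δ, hδΛ⟩
    obtain ⟨q, hq, hqker⟩ := (hp γ).exists_verma_quotient hμ
    have hqker : Flag (weightsOf Ω) (ModuleCat.of UVir (LinearMap.ker q)) := by
      refine hqker.mono fun ε hε => ?_
      have hε' : ε ∈ Λ := (hΛ.mem_of_preceq hε).mp hδΛ
      exact ⟨hε', hΩ γ hδΩ ⟨ε, hε'⟩ hε⟩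
    obtain ⟨k, hk⟩ := exists_lift_of_projective (hp γ).projective (X := ⟨X, hXΛ⟩)
      (Y := vermaObj hΛ γ) (f := homOf f) hf (homOf q)
    have hk' : ∀ y, f (k.hom.hom y) = q y := fun y => congrArg (fun h => h.hom.hom y) hk
    let G : (T × (P γ).obj) →ₗ[UVir] X := LinearMap.coprod (j ∘ₗ g) k.hom.hom
    have hG : ∀ t y, G (t, y) = j (g t) + k.hom.hom y := fun t y => by simp [G]
    have hjf0 : ∀ x, f (j x) = 0 := fun x => (hjf _).mpr ⟨x, rfl⟩
    have hKq : ∀ x : LinearMap.ker G, x.1.2 ∈ LinearMap.ker q := by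
      rintro ⟨⟨t, y⟩, hx⟩
      have h1 : G (t, y) = 0 := hx
      have h2 := congrArg f h1
      rwa [hG, map_add, hjf0, zero_add, hk', map_zero] at h2
    have hgK : ∀ x : LinearMap.ker g, (x.1, (0 : (P γ).obj)) ∈ LinearMap.ker G := by
      rintro ⟨t, ht⟩
      change G (t, 0) = 0
      rw [hG, show g t = 0 from ht, map_zero, map_zero, add_zero]
    refine ⟨ModuleCat.of UVir (T × (P γ).obj), G, hT.prod hδΩ, hTB.prod (hμ.isBdd _), ?_, ?_⟩
    · intro x
      obtain ⟨y, hy⟩ := hq (f x)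
      obtain ⟨a, ha⟩ := (hjf (x - k.hom.hom y)).mp (by rw [map_sub, hk', hy, sub_self])
      obtain ⟨t, rfl⟩ := hg a
      exact ⟨(t, y), by rw [hG, ha, sub_add_cancel]⟩
    · refine hqker.extension hker
        ((LinearMap.inl UVir T (P γ).obj ∘ₗ (LinearMap.ker g).subtype).codRestrict
          (LinearMap.ker G) hgK)
        ((LinearMap.snd UVir T (P γ).obj ∘ₗ (LinearMap.ker G).subtype).codRestrict
          (LinearMap.ker q) hKq) ?_ ?_ ?_
      · intro x y hxy
        exact Subtype.ext (congrArg (fun w : LinearMap.ker G => w.1.1) hxy)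
      · rintro ⟨⟨t, y⟩, hx⟩
        constructor
        · intro h
          have hy : y = 0 := congrArg Subtype.val h
          subst hy
          have h1 : G (t, 0) = 0 := hx
          rw [hG, map_zero, add_zero] at h1
          exact ⟨⟨t, hj (h1.trans (map_zero j).symm)⟩, rfl⟩
        · rintro ⟨x, hx⟩
          have : y = 0 := (congrArg (fun w : LinearMap.ker G => w.1.2) hx).symm
          exact Subtype.ext this
      · rintro ⟨y, hy⟩
        obtain ⟨a, ha⟩ := (hjf (k.hom.hom y)).mp (by rw [hk']; exact hy)
        obtain ⟨t, rfl⟩ := hg a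
        refine ⟨⟨(-t, y), ?_⟩, rfl⟩
        change G (-t, y) = 0
        rw [hG, map_neg, map_neg, ha, neg_add_cancel]

/-- A module with a Verma flag in a coideal `Ω` has a resolution in the block by sums of modules
`P(γ)`, `γ ∈ Ω`. -/
theorem Flag.exists_resolution {hΛ : IsBlock Λ} (hμ : IsBoundedBy μ Λ)
    {p : ∀ γ : Λ, P γ ⟶ simpleObj hΛ γ} (hp : ∀ γ : Λ, IsProjectiveCover (p γ))
    {Ω : Set Λ} (hΩ : IsCoideal Ω) {X : BlockCat Λ} (hX : Flag (weightsOf Ω) X.obj) :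
    ∃ R : BlockResolution X, ∀ n, IsAdd P Ω (R.complex.X n).obj := by
  let St := {X : ModuleCat.{0} UVir // IsBdd μ X ∧ Flag (weightsOf Ω) X}
  choose T g hT hTB hg hker using fun X : St => X.2.2.exists_cover hμ hp hΩ X.2.1
  let next : St → St := fun X =>
    ⟨ModuleCat.of UVir (LinearMap.ker (g X)), (hTB X).submodule _, hker X⟩
  let K : ℕ → St := fun n => next^[n] ⟨X.obj, hμ.isBdd X, hX⟩
  have hK : ∀ n, K (n + 1) = next (K n) := fun n => Function.iterate_succ_apply' next n _
  have hTΛ : ∀ X : St, blockProperty Λ (T X) := fun X =>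
    (X.2.2.extension (hker X) (LinearMap.ker (g X)).subtype (g X) Subtype.val_injective
      (fun x => ⟨fun h => ⟨⟨x, h⟩, rfl⟩, by rintro ⟨y, rfl⟩; exact y.2⟩) (hg X)).mem_block
        (hTB X) hΛ (weightsOf_subset Ω)
  let Tn : ℕ → BlockCat Λ := fun n => ⟨T (K n), hTΛ (K n)⟩
  have hd : ∀ n, ∃ d : T (K (n + 1)) →ₗ[UVir] T (K n),
      LinearMap.ker d = LinearMap.ker (g (K (n + 1))) ∧
      LinearMap.range d = LinearMap.ker (g (K n)) := by
    intro n
    rw [hK]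
    refine ⟨(LinearMap.ker (g (K n))).subtype ∘ₗ g (next (K n)), ?_, ?_⟩
    · ext x
      exact ⟨fun h => Subtype.ext h, fun h => congrArg Subtype.val h⟩
    · rw [LinearMap.range_comp, LinearMap.range_eq_top.mpr (hg _), Submodule.map_top,
        Submodule.range_subtype]
  choose d hdk hdr using hd
  have hdd : ∀ n x, d n (d (n + 1) x) = 0 := by
    intro n x
    have : d (n + 1) x ∈ LinearMap.ker (d n) := by
      rw [hdk, ← hdr]
      exact ⟨x, rfl⟩
    exact this
  let dn : ∀ n, Tn (n + 1) ⟶ Tn n := fun n => homOf (d n)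
  let C : ChainComplex (BlockCat Λ) ℕ := ChainComplex.of Tn dn fun n =>
    block_hom_ext fun x => hdd n x
  have hCd : ∀ n, C.d (n + 1) n = dn n := fun n => ChainComplex.of_d Tn dn n
  have hP : ∀ γ, Projective (P γ) := fun γ => (hp γ).projective
  refine ⟨⟨C, fun n => IsAdd.projective (T := Tn n) hP (hT (K n)), homOf (X := Tn 0) (g (K 0)),
    hg (K 0), ?_, ?_⟩, fun n => hT (K n)⟩
  · rw [hCd]
    intro x
    exact ⟨fun h => (hdr 0 ▸ h : x ∈ LinearMap.range (d 0)),
      fun h => (hdr 0 ▸ h : x ∈ LinearMap.ker (g (K 0)))⟩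
  · intro n
    rw [hCd, hCd]
    intro x
    have h1 : LinearMap.ker (d n) = LinearMap.range (d (n + 1)) := by rw [hdk, hdr]
    exact ⟨fun h => (h1 ▸ h : x ∈ LinearMap.range (d (n + 1))),
      fun h => (h1 ▸ h : x ∈ LinearMap.ker (d n))⟩

theorem flag_verma {S : Set Weight} {γ : Weight} (hγ : γ ∈ S) : Flag S (verma γ) :=
  .step (ModuleCat.of UVir PUnit) (verma γ) γ hγ 0 LinearMap.id (fun _ _ _ => rfl)
    (fun x => ⟨fun h => ⟨0, h.symm⟩, by rintro ⟨y, rfl⟩; rfl⟩) Function.surjective_id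
    (.zero _ (inferInstanceAs (Subsingleton PUnit)))

end Block

end

section

/-! ### Comparison of projective resolutions -/

section Comparison

variable {C : Type*} [Category C] [Preadditive C] {X : C}

/-- The complex of vector spaces `Hom(K_0, Y) → Hom(K_1, Y) → ⋯`. -/
abbrev homComplex [Linear ℂ C] (K : ChainComplex C ℕ) (Y : C) :
    HomologicalComplex (ModuleCat ℂ) (ComplexShape.down ℕ).symm :=
  ((((linearYoneda ℂ C).obj Y).rightOp.mapHomologicalComplex _).obj K).unop

/-- A complex of projective objects over `X` that has the lifting properties of a resolution
with respect to projective objects. -/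
structure LiftingResolution (X : C) where
  complex : ChainComplex C ℕ
  projective : ∀ n, Projective (complex.X n)
  π : complex.X 0 ⟶ X
  d_comp_π : complex.d 1 0 ≫ π = 0
  exists_lift : ∀ {T : C}, Projective T → ∀ k : T ⟶ X, ∃ l, l ≫ π = k
  exists_lift_zero : ∀ {T : C}, Projective T → ∀ k : T ⟶ complex.X 0, k ≫ π = 0 →
    ∃ l, l ≫ complex.d 1 0 = k
  exists_lift_succ : ∀ (n : ℕ) {T : C}, Projective T → ∀ k : T ⟶ complex.X (n + 1),
    k ≫ complex.d (n + 1) n = 0 → ∃ l, l ≫ complex.d (n + 2) (n + 1) = k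

namespace LiftingResolution

theorem exists_hom (R S : LiftingResolution X) :
    ∃ f : R.complex ⟶ S.complex, f.f 0 ≫ S.π = R.π := by
  obtain ⟨f₀, h₀⟩ := S.exists_lift (R.projective 0) R.π
  obtain ⟨f₁, h₁⟩ := S.exists_lift_zero (R.projective 1) (R.complex.d 1 0 ≫ f₀)
    (by rw [Category.assoc, h₀, R.d_comp_π])
  refine ⟨ChainComplex.mkHom _ _ f₀ f₁ h₁ fun n p => ?_, ?_⟩
  · have h := S.exists_lift_succ n (R.projective (n + 2)) (R.complex.d (n + 2) (n + 1) ≫ p.2.1)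
      (by rw [Category.assoc, p.2.2, ← Category.assoc, R.complex.d_comp_d, zero_comp])
    exact ⟨h.choose, h.choose_spec⟩
  · rw [ChainComplex.mkHom_f_0]
    exact h₀

theorem nonempty_homotopy_zero (R S : LiftingResolution X) (f : R.complex ⟶ S.complex)
    (hf : f.f 0 ≫ S.π = 0) : Nonempty (Homotopy f 0) := by
  obtain ⟨h₀, e₀⟩ := S.exists_lift_zero (R.projective 0) (f.f 0) hf
  obtain ⟨h₁, e₁⟩ := S.exists_lift_succ 0 (R.projective 1) (f.f 1 - R.complex.d 1 0 ≫ h₀)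
    (by rw [Preadditive.sub_comp, Category.assoc, e₀, f.comm, sub_self])
  refine ⟨Homotopy.mkInductive f h₀ e₀.symm h₁ (by rw [e₁]; abel) fun n p => ?_⟩
  have h := S.exists_lift_succ (n + 1) (R.projective (n + 2))
    (f.f (n + 2) - R.complex.d (n + 2) (n + 1) ≫ p.2.1) (by
      have h1 : R.complex.d (n + 2) (n + 1) ≫ R.complex.d (n + 1) n = 0 := R.complex.d_comp_d _ _ _
      have h2 := congrArg (R.complex.d (n + 2) (n + 1) ≫ ·) p.2.2
      simp only [Preadditive.comp_add, ← Category.assoc, h1, zero_comp, zero_add] at h2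
      rw [Preadditive.sub_comp, f.comm, sub_eq_zero]
      exact h2)
  exact ⟨h.choose, by rw [h.choose_spec]; abel⟩

/-- Any two resolutions of an object are homotopy equivalent. -/
theorem nonempty_homotopyEquiv (R S : LiftingResolution X) :
    Nonempty (HomotopyEquiv R.complex S.complex) := by
  obtain ⟨f, hf⟩ := R.exists_hom S
  obtain ⟨g, hg⟩ := S.exists_hom R
  obtain ⟨h₁⟩ := R.nonempty_homotopy_zero R (f ≫ g - 𝟙 _) (by
    simp [Preadditive.sub_comp, hf, hg])
  obtain ⟨h₂⟩ := S.nonempty_homotopy_zero S (g ≫ f - 𝟙 _) (by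
    simp [Preadditive.sub_comp, hf, hg])
  exact ⟨⟨f, g, Homotopy.equivSubZero.symm h₁, Homotopy.equivSubZero.symm h₂⟩⟩

/-- The cohomology of `Hom(R, Y)` does not depend on the resolution `R`. -/
theorem nonempty_homology_iso [Linear ℂ C] (R S : LiftingResolution X) (Y : C) (i : ℕ) :
    Nonempty ((homComplex R.complex Y).homology i ≅ (homComplex S.complex Y).homology i) := by
  obtain ⟨h⟩ := R.nonempty_homotopyEquiv S
  let F := ((linearYoneda ℂ C).obj Y).rightOp
  exact ⟨HomologicalComplex.homologyUnop ((F.mapHomologicalComplex _).obj R.complex) i ≪≫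
    ((F.mapHomotopyEquiv h).toHomologyIso i).unop.symm ≪≫
    (HomologicalComplex.homologyUnop ((F.mapHomologicalComplex _).obj S.complex) i).symm⟩

end LiftingResolution

/-- A projective resolution has the lifting properties. -/
def ofProjectiveResolution {C : Type*} [Category C] [Abelian C] {X : C}
    (R : ProjectiveResolution X) : LiftingResolution X where
  complex := R.complex
  projective := R.projective
  π := R.π.f 0
  d_comp_π := R.complex_d_comp_π_f_zero
  exists_lift hT k := by
    have h : Epi (R.π.f 0) := inferInstance
    exact @Projective.factors _ _ _ hT _ _ k (R.π.f 0) h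
  exists_lift_zero hT k hk :=
    ⟨R.exact₀.liftFromProjective k hk, R.exact₀.liftFromProjective_comp k hk⟩
  exists_lift_succ n _ hT k hk :=
    ⟨(R.exact_succ n).liftFromProjective k hk, (R.exact_succ n).liftFromProjective_comp k hk⟩

/-- A complex of projective modules which is exact over `X` has the lifting properties. -/
def ofExactModule {A : Type} [Ring A] {X : ModuleCat.{0} A} (K : ChainComplex (ModuleCat.{0} A) ℕ)
    (hK : ∀ n, Projective (K.X n)) (π : K.X 0 ⟶ X) (hπ : Function.Surjective π.hom)
    (h₀ : Function.Exact (K.d 1 0).hom π.hom)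
    (h : ∀ n, Function.Exact (K.d (n + 2) (n + 1)).hom (K.d (n + 1) n).hom) :
    LiftingResolution X where
  complex := K
  projective := hK
  π := π
  d_comp_π := ModuleCat.hom_ext (LinearMap.ext fun x => (h₀ _).mpr ⟨x, rfl⟩)
  exists_lift {T} hT k := by
    have := (ModuleCat.epi_iff_surjective π).mpr hπ
    exact hT.factors k π
  exists_lift_zero {T} hT k hk := by
    have hS : (ShortComplex.mk (K.d 1 0) π
        (ModuleCat.hom_ext (LinearMap.ext fun x => (h₀ _).mpr ⟨x, rfl⟩))).Exact :=
      (ShortComplex.moduleCat_exact_iff _).mpr fun x hx => (h₀ x).mp hx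
    exact ⟨hS.liftFromProjective k hk, hS.liftFromProjective_comp k hk⟩
  exists_lift_succ n {T} hT k hk := by
    have hS : (ShortComplex.mk (K.d (n + 2) (n + 1)) (K.d (n + 1) n) (K.d_comp_d _ _ _)).Exact :=
      (ShortComplex.moduleCat_exact_iff _).mpr fun x hx => (h n x).mp hx
    exact ⟨hS.liftFromProjective k hk, hS.liftFromProjective_comp k hk⟩

/-- A projective resolution in a block has the lifting properties. -/
def BlockResolution.toLiftingResolution {Λ : Set Weight} {X : BlockCat Λ} (R : BlockResolution X) :
    LiftingResolution X where
  complex := R.complex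
  projective := R.projective
  π := R.π
  d_comp_π := block_hom_ext fun x => (R.exact_zero _).mpr ⟨x, rfl⟩
  exists_lift hT k := exists_lift_of_projective hT R.surjective k
  exists_lift_zero hT k hk := exists_lift_of_exact hT R.exact_zero k hk
  exists_lift_succ n _ hT k hk := exists_lift_of_exact hT (R.exact_succ n) k hk

end Comparison

end

section

/-! ### Modules over the corner algebra -/

section Corner

variable {μ : Weight} {Λ : Set Weight} {P : Λ → BlockCat Λ} {Ω : Set Λ} {M N X Y Z : BlockCat Λ}

open Classical in
/-- The inclusion of `P(γ)` in `⨁ P(γ)`. -/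
def incl (P : Λ → BlockCat Λ) (γ : Λ) : (P γ).obj →ₗ[UVir] totalModule P :=
  DirectSum.lof UVir Λ (fun γ => ((P γ).obj : Type)) γ

/-- The projection of `⨁ P(γ)` onto `P(γ)`. -/
def proj (P : Λ → BlockCat Λ) (γ : Λ) : totalModule P →ₗ[UVir] (P γ).obj :=
  DirectSum.component UVir Λ (fun γ => ((P γ).obj : Type)) γ

theorem proj_incl (γ : Λ) (x : (P γ).obj) : proj P γ (incl P γ x) = x := by
  classical
  exact DirectSum.component.lof_self UVir (M := fun γ : Λ => ((P γ).obj : Type)) γ x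

theorem idem_incl_of_mem {γ : Λ} (hγ : γ ∈ Ω) (x : (P γ).obj) :
    (idem P Ω).unop.hom (incl P γ x) = incl P γ x := by
  classical
  refine (DFinsupp.filter_single (β := fun γ : Λ => ((P γ).obj : Type)) (· ∈ Ω) γ x).trans ?_
  exact if_pos hγ

theorem idem_incl_of_notMem {γ : Λ} (hγ : γ ∉ Ω) (x : (P γ).obj) :
    (idem P Ω).unop.hom (incl P γ x) = 0 := by
  classical
  refine (DFinsupp.filter_single (β := fun γ : Λ => ((P γ).obj : Type)) (· ∈ Ω) γ x).trans ?_
  exact if_neg hγ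

theorem total_hom_ext {f g : totalModule P ⟶ M.obj}
    (h : ∀ γ x, f.hom (incl P γ x) = g.hom (incl P γ x)) : f = g := by
  classical
  refine ModuleCat.hom_ext ?_
  exact DirectSum.linearMap_ext UVir fun γ => LinearMap.ext (h γ)

theorem idem_comp (g : quotModule P Ω M) : (idem P Ω).unop ≫ g.1 = g.1 := g.2

theorem quot_apply_of_notMem (g : quotModule P Ω M) {γ : Λ} (hγ : γ ∉ Ω) (x : (P γ).obj) :
    g.1.hom (incl P γ x) = 0 := by
  rw [← idem_comp g]
  change g.1.hom ((idem P Ω).unop.hom (incl P γ x)) = 0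
  rw [idem_incl_of_notMem hγ, map_zero]

theorem quot_ext {g h : quotModule P Ω M}
    (H : ∀ γ ∈ Ω, ∀ x, g.1.hom (incl P γ x) = h.1.hom (incl P γ x)) : g = h := by
  refine Subtype.ext (total_hom_ext fun γ x => ?_)
  by_cases hγ : γ ∈ Ω
  · exact H γ hγ x
  · rw [quot_apply_of_notMem g hγ, quot_apply_of_notMem h hγ]

/-- The component at `γ` of an element of `eM`. -/
def component (g : quotModule P Ω M) (γ : Λ) : P γ ⟶ M := homOf (g.1.hom ∘ₗ incl P γ)

open Classical in
/-- The homomorphism from `⨁ P(γ)` with given components. -/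
def totalDesc (f : ∀ γ, (P γ).obj →ₗ[UVir] M.obj) : totalModule P →ₗ[UVir] M.obj :=
  DirectSum.toModule UVir Λ M.obj f

theorem totalDesc_incl (f : ∀ γ, (P γ).obj →ₗ[UVir] M.obj) (γ : Λ) (x : (P γ).obj) :
    totalDesc f (incl P γ x) = f γ x := by
  classical
  exact DirectSum.toModule_lof UVir (M := fun γ : Λ => ((P γ).obj : Type)) γ x

open Classical in
/-- The element of `eM` with given components in `Ω`. -/
def ofComponents (Ω : Set Λ) (f : ∀ γ, P γ ⟶ M) : quotModule P Ω M :=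
  ⟨(ModuleCat.ofHom (totalDesc fun γ => if γ ∈ Ω then (f γ).hom.hom else 0) :
    totalModule P ⟶ M.obj), by
    refine total_hom_ext fun γ x => ?_
    change totalDesc (fun γ => if γ ∈ Ω then (f γ).hom.hom else 0)
      ((idem P Ω).unop.hom (incl P γ x)) = totalDesc _ (incl P γ x)
    by_cases hγ : γ ∈ Ω
    · rw [idem_incl_of_mem hγ]
    · rw [idem_incl_of_notMem hγ, map_zero, totalDesc_incl, if_neg hγ]
      rfl⟩

theorem ofComponents_apply (f : ∀ γ, P γ ⟶ M) {γ : Λ} (hγ : γ ∈ Ω) (x : (P γ).obj) :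
    (ofComponents Ω f).1.hom (incl P γ x) = (f γ).hom.hom x := by
  refine (totalDesc_incl _ γ x).trans ?_
  rw [if_pos hγ]

/-- The functor `M ↦ eM` from the block to modules over `eBe`. -/
def quotFunctor (P : Λ → BlockCat Λ) (Ω : Set Λ) : BlockCat Λ ⥤ ModuleCat.{0} (QuotAlg P Ω) where
  obj M := quotModule P Ω M
  map {M N} f := ModuleCat.ofHom
    { toFun := fun g => (⟨g.1 ≫ f.hom, by
        exact (Category.assoc _ _ _).symm.trans (congrArg (· ≫ f.hom) g.2)⟩ :
          cornerPart (totalModule P ⟶ N.obj) (idem P Ω))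
      map_add' := fun g h => Subtype.ext (Preadditive.add_comp _ _ _ g.1 h.1 f.hom)
      map_smul' := fun b g => Subtype.ext (Category.assoc b.1.unop g.1 f.hom) }
  map_id M := ModuleCat.hom_ext (LinearMap.ext fun g => Subtype.ext (Category.comp_id g.1))
  map_comp f h := ModuleCat.hom_ext (LinearMap.ext fun g => Subtype.ext
    (Category.assoc g.1 f.hom h.hom).symm)

instance : (quotFunctor P Ω).Additive where
  map_add {_ _ f h} := ModuleCat.hom_ext (LinearMap.ext fun g => Subtype.ext
    (Preadditive.comp_add _ _ _ g.1 f.hom h.hom))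

theorem quotFunctor_map_smul (c : ℂ) (f : M ⟶ N) :
    (quotFunctor P Ω).map (c • f) = c • (quotFunctor P Ω).map f := by
  refine ModuleCat.hom_ext (LinearMap.ext fun g => Subtype.ext ?_)
  have hg : (idem P Ω).unop ≫ g.1 = g.1 := g.2
  refine (Linear.comp_smul _ _ _ g.1 c f.hom).trans ?_
  change _ = (c • (idem P Ω).unop) ≫ (g.1 ≫ f.hom)
  refine Eq.trans ?_ (Linear.smul_comp _ _ _ c (idem P Ω).unop (g.1 ≫ f.hom)).symm
  refine congrArg (c • ·) ?_
  exact (congrArg (· ≫ f.hom) hg).symm.trans (Category.assoc _ _ _)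

/-- The functor `M ↦ eM` is exact, since the `P(γ)` are projective. -/
theorem quotFunctor_exact (hP : ∀ γ, Projective (P γ)) {f : X ⟶ Y} {g : Y ⟶ Z}
    (h : Function.Exact f.hom.hom g.hom.hom) :
    Function.Exact ((quotFunctor P Ω).map f).hom ((quotFunctor P Ω).map g).hom := by
  intro y
  constructor
  · intro hy
    have hlift : ∀ γ, ∃ l : P γ ⟶ X, l ≫ f = component y γ := fun γ =>
      exists_lift_of_exact (hP γ) h _ (block_hom_ext fun x =>
        congrArg (fun w : quotModule P Ω Z => w.1.hom (incl P γ x)) hy)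
    choose l hl using hlift
    refine ⟨ofComponents Ω l, quot_ext fun γ hγ x => ?_⟩
    change f.hom.hom ((ofComponents Ω l).1.hom (incl P γ x)) = _
    rw [ofComponents_apply l hγ]
    exact congrArg (fun k : P γ ⟶ Y => k.hom.hom x) (hl γ)
  · rintro ⟨x, rfl⟩
    refine quot_ext fun γ _ p => ?_
    exact (h _).mpr ⟨x.1.hom (incl P γ p), rfl⟩

theorem quotFunctor_surjective (hP : ∀ γ, Projective (P γ)) {f : X ⟶ Y}
    (h : Function.Surjective f.hom.hom) :
    Function.Surjective ((quotFunctor P Ω).map f).hom := by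
  intro y
  choose l hl using fun γ => exists_lift_of_projective (hP γ) h (component y γ)
  refine ⟨ofComponents Ω l, quot_ext fun γ hγ x => ?_⟩
  change f.hom.hom ((ofComponents Ω l).1.hom (incl P γ x)) = _
  rw [ofComponents_apply l hγ]
  exact congrArg (fun k : P γ ⟶ Y => k.hom.hom x) (hl γ)

/-- The projection onto `P(δ)`, `δ ∈ Ω`, as an element of `eP(δ)`. -/
def projElem {δ : Λ} (hδ : δ ∈ Ω) : quotModule P Ω (P δ) :=
  ⟨ModuleCat.ofHom (proj P δ), by
    classical
    refine total_hom_ext fun γ x => ?_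
    change proj P δ ((idem P Ω).unop.hom (incl P γ x)) = proj P δ (incl P γ x)
    by_cases hγ : γ ∈ Ω
    · rw [idem_incl_of_mem hγ]
    · rw [idem_incl_of_notMem hγ, map_zero]
      refine Eq.symm ?_
      refine (DirectSum.component.of UVir (M := fun γ : Λ => ((P γ).obj : Type)) δ γ x).trans ?_
      exact dif_neg fun h : γ = δ => hγ (h ▸ hδ)⟩

/-- The embedding of `eP(δ)`, `δ ∈ Ω`, in `eBe`. -/
def toCorner {δ : Λ} (hδ : δ ∈ Ω) : quotModule P Ω (P δ) →ₗ[QuotAlg P Ω] QuotAlg P Ω where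
  toFun g := ⟨MulOpposite.op (End.of (g.1 ≫ ModuleCat.ofHom (incl P δ))),
    (Subsemigroup.mem_corner_iff (idem_isIdempotentElem P Ω)).mpr ⟨by
      refine MulOpposite.unop_injective ?_
      change (idem P Ω).unop ≫ g.1 ≫ ModuleCat.ofHom (incl P δ) = g.1 ≫ ModuleCat.ofHom (incl P δ)
      rw [← Category.assoc, idem_comp], by
      refine MulOpposite.unop_injective ?_
      change (g.1 ≫ ModuleCat.ofHom (incl P δ)) ≫ (idem P Ω).unop =
        g.1 ≫ ModuleCat.ofHom (incl P δ)
      refine ModuleCat.hom_ext (LinearMap.ext fun x => ?_)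
      exact idem_incl_of_mem hδ (g.1.hom x)⟩⟩
  map_add' g h := Subtype.ext (MulOpposite.unop_injective
    (Preadditive.add_comp _ _ _ g.1 h.1 (ModuleCat.ofHom (incl P δ))))
  map_smul' b g := Subtype.ext (MulOpposite.unop_injective
    (Category.assoc b.1.unop g.1 (ModuleCat.ofHom (incl P δ))))

theorem toCorner_smul {δ : Λ} (hδ : δ ∈ Ω) (g : quotModule P Ω (P δ)) :
    toCorner hδ g • (projElem hδ : quotModule P Ω (P δ)) = g := by
  refine Subtype.ext (ModuleCat.hom_ext (LinearMap.ext fun x => ?_))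
  exact proj_incl δ (g.1.hom x)

/-- The homomorphism from `eP(δ)` given by an element. -/
def cornerLift {δ : Λ} (hδ : δ ∈ Ω) {V : ModuleCat.{0} (QuotAlg P Ω)} (v : V) :
    quotModule P Ω (P δ) ⟶ V :=
  ModuleCat.ofHom ((LinearMap.toSpanSingleton (QuotAlg P Ω) V v) ∘ₗ toCorner hδ)

theorem apply_eq_toCorner_smul {δ : Λ} (hδ : δ ∈ Ω) {V : ModuleCat.{0} (QuotAlg P Ω)}
    (f : quotModule P Ω (P δ) ⟶ V) (g : quotModule P Ω (P δ)) :
    f.hom g = toCorner hδ g • f.hom (projElem hδ) := by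
  rw [← map_smul, toCorner_smul]

/-- The module `eP(δ)`, `δ ∈ Ω`, is projective, being a direct summand of `eBe`. -/
theorem projective_quotFunctor {δ : Λ} (hδ : δ ∈ Ω) :
    Projective ((quotFunctor P Ω).obj (P δ)) where
  factors {V W} f e _ := by
    obtain ⟨v, hv⟩ := (ModuleCat.epi_iff_surjective e).mp inferInstance (f.hom (projElem hδ))
    refine ⟨cornerLift hδ v, ModuleCat.hom_ext (LinearMap.ext fun g => ?_)⟩
    refine Eq.trans ?_ (apply_eq_toCorner_smul hδ f g).symm
    change e.hom (toCorner hδ g • v) = _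
    rw [map_smul]
    exact congrArg (toCorner hδ g • ·) hv

/-- A homomorphism `eP(δ) → eY`, `δ ∈ Ω`, is induced by a homomorphism `P(δ) → Y`. -/
theorem quotFunctor_full_of_mem {δ : Λ} (hδ : δ ∈ Ω)
    (φ : (quotFunctor P Ω).obj (P δ) ⟶ (quotFunctor P Ω).obj Y) :
    ∃ f : P δ ⟶ Y, (quotFunctor P Ω).map f = φ := by
  refine ⟨component (φ.hom (projElem hδ)) δ, ModuleCat.hom_ext (LinearMap.ext fun g => ?_)⟩
  refine Eq.trans ?_ (apply_eq_toCorner_smul hδ φ g).symm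
  exact Subtype.ext (Category.assoc g.1 (ModuleCat.ofHom (incl P δ)) (φ.hom (projElem hδ)).1).symm

theorem quotFunctor_faithful_of_mem {δ : Λ} (hδ : δ ∈ Ω) {f : P δ ⟶ Y}
    (hf : (quotFunctor P Ω).map f = 0) : f = 0 := by
  refine block_hom_ext fun x => ?_
  have h := congrArg (fun k => (k.hom (projElem hδ)).1.hom (incl P δ x)) hf
  change f.hom.hom (proj P δ (incl P δ x)) = 0 at h
  rwa [proj_incl] at h

/-! ### Sums of the `P(γ)`, `γ ∈ Ω`, and the corner algebra -/

namespace IsAdd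

variable {T : BlockCat Λ}

theorem exists_sum_eq_id (h : IsAdd P Ω T.obj) :
    ∃ (ι : Type) (_ : Fintype ι) (δ : ι → Λ) (a : ∀ i, T ⟶ P (δ i)) (b : ∀ i, P (δ i) ⟶ T),
      (∀ i, δ i ∈ Ω) ∧ ∑ i, a i ≫ b i = 𝟙 T := by
  obtain ⟨ι, hι, δ, a, b, hδ, hab⟩ := h
  refine ⟨ι, hι, δ, fun i => homOf (a i), fun i => homOf (b i), hδ, block_hom_ext fun x => ?_⟩
  refine Eq.trans ?_ (hab x)
  let ev : (T ⟶ T) →+ T.obj :=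
    { toFun := fun f => f.hom.hom x
      map_zero' := rfl
      map_add' := fun _ _ => rfl }
  exact map_sum ev _ _

theorem projective_quotFunctor (h : IsAdd P Ω T.obj) :
    Projective ((quotFunctor P Ω).obj T) where
  factors {V W} f e _ := by
    obtain ⟨ι, _, δ, a, b, hδ, hab⟩ := h.exists_sum_eq_id
    have hproj := fun i => VirO.projective_quotFunctor (P := P) (hδ i)
    choose k hk using fun i => (hproj i).factors ((quotFunctor P Ω).map (b i) ≫ f) e
    refine ⟨∑ i, (quotFunctor P Ω).map (a i) ≫ k i, ?_⟩
    rw [Preadditive.sum_comp]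
    simp only [Category.assoc, hk]
    simp only [← Category.assoc, ← CategoryTheory.Functor.map_comp]
    rw [← Preadditive.sum_comp, ← CategoryTheory.Functor.map_sum, hab,
      CategoryTheory.Functor.map_id, Category.id_comp]

/-- The functor `M ↦ eM` is fully faithful on homomorphisms from sums of the `P(γ)`, `γ ∈ Ω`. -/
theorem quotFunctor_bijective (h : IsAdd P Ω T.obj) (Y : BlockCat Λ) :
    Function.Bijective ((quotFunctor P Ω).map : (T ⟶ Y) → _) := by
  obtain ⟨ι, _, δ, a, b, hδ, hab⟩ := h.exists_sum_eq_id
  constructor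
  · intro f g hfg
    have hbi : ∀ i, b i ≫ (f - g) = 0 := fun i => quotFunctor_faithful_of_mem (hδ i) (by
      rw [CategoryTheory.Functor.map_comp, CategoryTheory.Functor.map_sub, hfg,
        sub_self, comp_zero])
    rw [← sub_eq_zero, ← Category.id_comp (f - g), ← hab, Preadditive.sum_comp]
    exact Finset.sum_eq_zero fun i _ => by rw [Category.assoc, hbi, comp_zero]
  · intro φ
    choose f hf using fun i => quotFunctor_full_of_mem (hδ i) ((quotFunctor P Ω).map (b i) ≫ φ)
    refine ⟨∑ i, a i ≫ f i, ?_⟩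
    rw [CategoryTheory.Functor.map_sum]
    simp only [CategoryTheory.Functor.map_comp, hf]
    simp only [← Category.assoc, ← CategoryTheory.Functor.map_comp]
    rw [← Preadditive.sum_comp, ← CategoryTheory.Functor.map_sum, hab,
      CategoryTheory.Functor.map_id, Category.id_comp]

/-- The isomorphism `Hom(T, Y) ≅ Hom(eT, eY)`. -/
def homEquiv (h : IsAdd P Ω T.obj) (Y : BlockCat Λ) :
    (T ⟶ Y) ≃ₗ[ℂ] ((quotFunctor P Ω).obj T ⟶ (quotFunctor P Ω).obj Y) :=
  LinearEquiv.ofBijective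
    { toFun := (quotFunctor P Ω).map
      map_add' := fun _ _ => CategoryTheory.Functor.map_add _
      map_smul' := fun c f => quotFunctor_map_smul c f } (h.quotFunctor_bijective Y)

end IsAdd

/-- For a complex of sums of the `P(γ)`, `γ ∈ Ω`, the complexes of homomorphisms over `B` and over
`eBe` are isomorphic. -/
def homComplexIso (K : ChainComplex (BlockCat Λ) ℕ) (hK : ∀ n, IsAdd P Ω (K.X n).obj)
    (Y : BlockCat Λ) :
    homComplex K Y ≅ homComplex (((quotFunctor P Ω).mapHomologicalComplex _).obj K)
      ((quotFunctor P Ω).obj Y) :=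
  HomologicalComplex.Hom.isoOfComponents (fun n => ((hK n).homEquiv Y).toModuleIso)
    fun i j _ => ModuleCat.hom_ext (LinearMap.ext fun f =>
      ((quotFunctor P Ω).map_comp (K.d j i) f).symm)

/-- If `X` has a resolution by sums of the `P(γ)`, `γ ∈ Ω`, then the spaces `Ext(X, Y)` and
`Ext(eX, eY)` are isomorphic. -/
theorem BlockResolution.nonempty_ext_iso (hP : ∀ γ, Projective (P γ)) (S : BlockResolution X)
    (hS : ∀ n, IsAdd P Ω (S.complex.X n).obj) (R : BlockResolution X) (Y : BlockCat Λ) (i : ℕ) :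
    Nonempty (R.ext Y i ≅ ((Ext ℂ (ModuleCat.{0} (QuotAlg P Ω)) i).obj
      (Opposite.op (quotModule P Ω X))).obj (quotModule P Ω Y)) := by
  obtain ⟨e₁⟩ := R.toLiftingResolution.nonempty_homology_iso S.toLiftingResolution Y i
  let E := quotFunctor P Ω
  let ES : LiftingResolution (E.obj X) :=
    ofExactModule ((E.mapHomologicalComplex _).obj S.complex)
      (fun n => (hS n).projective_quotFunctor) (E.map S.π)
      (quotFunctor_surjective hP S.surjective) (quotFunctor_exact hP S.exact_zero)
      fun n => quotFunctor_exact hP (S.exact_succ n)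
  let Q := projectiveResolution (E.obj X)
  obtain ⟨e₂⟩ := ES.nonempty_homology_iso (ofProjectiveResolution Q) (E.obj Y) i
  let e₃ := HomologicalComplex.homologyMapIso (homComplexIso S.complex hS Y) i
  exact ⟨e₁ ≪≫ e₃ ≪≫ e₂ ≪≫ (Q.isoExt i (E.obj Y)).symm⟩

end Corner

end

end

end VirO

theorem mainTheorem4 (Λ : Set VirO.Weight) (hΛ : VirO.IsBlock Λ) (hinf : Λ.Infinite)
    (hmax : ∃ μ ∈ Λ, ∀ γ ∈ Λ, ¬ VirO.WeightLT μ γ) :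
    (∀ γ : Λ, ∃ (P : VirO.BlockCat Λ) (p : P ⟶ VirO.simpleObj hΛ γ), VirO.IsProjectiveCover p) ∧
    (∀ γ : Λ, Nonempty (VirO.BlockResolution (VirO.vermaObj hΛ γ))) ∧
    ∀ (P : Λ → VirO.BlockCat Λ) (p : ∀ γ : Λ, P γ ⟶ VirO.simpleObj hΛ γ),
      (∀ γ : Λ, VirO.IsProjectiveCover (p γ)) →
      ∀ Ω : Set Λ, Ω.Finite → VirO.IsCoideal Ω →
      ∀ l ∈ Ω, ∀ ν ∈ Ω, ∀ (R : VirO.BlockResolution (VirO.vermaObj hΛ l)) (i : ℕ),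
        Nonempty (R.ext (VirO.simpleObj hΛ ν) i ≅
          ((Ext ℂ (ModuleCat.{0} (VirO.QuotAlg P Ω)) i).obj
            (Opposite.op (VirO.quotModule P Ω (VirO.vermaObj hΛ l)))).obj
              (VirO.quotModule P Ω (VirO.simpleObj hΛ ν))) := by
  obtain ⟨μ, hμ⟩ := hΛ.exists_isBoundedBy hmax
  have hcover := VirO.exists_isProjectiveCover hΛ hμ
  refine ⟨hcover, fun γ => ?_, fun P p hp Ω _ hΩ l hl ν _ R i => ?_⟩
  · choose P p hp using hcover
    obtain ⟨R, -⟩ := VirO.Flag.exists_resolution (Ω := Set.univ) (X := VirO.vermaObj hΛ γ) hμ hp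
      (fun _ _ _ _ => trivial) (VirO.flag_verma ⟨γ.2, trivial⟩)
    exact ⟨R⟩
  · obtain ⟨S, hS⟩ := VirO.Flag.exists_resolution (X := VirO.vermaObj hΛ l) hμ hp hΩ
      (VirO.flag_verma ⟨l.2, hl⟩)
    exact S.nonempty_ext_iso (fun γ => (hp γ).projective) hS R _ i
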